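/- **Theorem of power expended for a saturated mixture with an interface.** *Kinematics.* A mixture of a solid ($a=\mathrm s$) and a fluid ($a=\mathrm f$) occupies an open region $B(t)\subset\mathbb R^3$ for $t$ in an open set $I$ of times. Let $\chi_{\mathrm s}(\cdot,t):B_{\mathrm s}\to B(t)$ and $\chi_{\mathrm f}(\cdot,t):B_{\mathrm f}\to B(t)$ be the motions ($B_{\mathrm s},B_{\mathrm f}$ open), and $F_a=\nabla\chi_a$, $J_a=\det F_a$. Let $S_{\mathrm s}\subset B_{\mathrm s}$ be a fixed embedded $C^1$ surface, relatively closed in $B_{\mathrm s}$, oriented by a continuous unit normal $m_{\mathrm s}$, and let $S(t)=\chi_{\mathrm s}(S_{\mathrm s},t)$, oriented by $m=J_{\mathrm s}F_{\mathrm s}^{-T}m_{\mathrm s}/\|J_{\mathrm s}F_{\mathrm s}^{-T}m_{\mathrm s}\|$. The map $\chi_{\mathrm s}$ is a homeomorphism of $B_{\mathrm s}$ onto $B(t)$ (jointly with time), $C^2$ in $(X,t)$ off $S_{\mathrm s}$ and up to $S_{\mathrm s}$ from either side, with $J_{\mathrm s}>0$, including its one-sided limits. The map $\chi_{\mathrm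 f}$ is, away from the inverse image $S_{\mathrm f}(t)$ of $S(t)$, a $C^2$ bijection of $B_{\mathrm f}\setminus S_{\mathrm f}(t)$ onto $B(t)\setminus S(t)$ with $J_{\mathrm f}>0$; it may be discontinuous across $S_{\mathrm f}(t)$. Let $v_a$ and $a_a$ be the velocities and accelerations $\partial_t\chi_a$, $\partial_t^2\chi_a$ expressed as fields on $B(t)$, $w=v_{\mathrm f}-v_{\mathrm s}$, $L_a=\nabla v_a$ and $D_a=\tfrac12(L_a+L_a^T)$. For a field $f$ and $x\in S(t)$ put $f^\pm(x)=\lim_{s\to0^+}f(x\pm s\,m(x))$ and $[\![f]\!]=f^+-f^-$. *Mass.* The volume fractions $\phi_a\in[0,1]$ satisfy $\phi_{\mathrm s}+\phi_{\mathrm f}=1$; the densities are $\rho_a=\rho_a^*\phi_a$ with constants $\rho_a^*>0$; $\partial_t\rho_a+\operatorname{div}(\rho_av_a)=0$ in $B(t)\setminus S(t)$; and $[\![\phi_{\mathrm f}w]\!]\cdot m=0$ on $S(t)$. Put $d=\rho_{\mathrm f}\,w\cdot m$ on $S(t)$ (so that $d^+=d^-$). *Constitutive laws.* Let $\hat\Psi_{\mathrm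 s}(\overline C,X)\ge0$ be the strain energy of the pure solid, $C_{\mathrm s}=F_{\mathrm s}^TF_{\mathrm s}$, $\overline C_{\mathrm s}=J_{\mathrm s}^{-2/3}C_{\mathrm s}$, $\phi_{R_{\mathrm s}}=J_{\mathrm s}\phi_{\mathrm s}$, $\Psi_{\mathrm s}=\phi_{R_{\mathrm s}}\hat\Psi_{\mathrm s}(\overline C_{\mathrm s},X)$ and $\psi_{\mathrm s}=J_{\mathrm s}^{-1}\Psi_{\mathrm s}$ (as a field on $B(t)$). With $p$ the pore pressure, $\mu_{\mathrm f},\mu_B,\mu_D$ viscosities and $\kappa_{\mathrm s}$ the permeability, $$T_{\mathrm s}=-\phi_{\mathrm s}p\,I+2\phi_{R_{\mathrm s}}J_{\mathrm s}^{-1}F_{\mathrm s}\frac{\partial\hat\Psi_{\mathrm s}}{\partial C_{\mathrm s}}F_{\mathrm s}^T+2\mu_B(D_{\mathrm s}-D_{\mathrm f}),\qquad T_{\mathrm f}=-\phi_{\mathrm f}p\,I+2\mu_{\mathrm f}D_{\mathrm f}+2\mu_B(D_{\mathrm f}-D_{\mathrm s}),$$ $$p_{\mathrm f}=p\nabla\phi_{\mathrm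 f}-\frac{\mu_D\phi_{\mathrm f}^2}{\kappa_{\mathrm s}}w,\qquad p_{\mathrm s}=-p_{\mathrm f}.$$ *Momentum.* With external body forces $b_a$, $\rho_aa_a-\operatorname{div}T_a-b_a-p_a=0$ in $B(t)\setminus S(t)$; and $[\![\rho_a(v_a-v_{\mathrm s})\otimes(v_a-v_{\mathrm s})-T_a]\!]m+\xi_a=0$ on $S(t)$, where $\xi_{\mathrm s}+\xi_{\mathrm f}=0$. *Regularity.* The fields $\phi_a$, $v_{\mathrm f}$, $T_a$ and $\hat\Psi_{\mathrm s}$ are $C^1$, and $b_a$ is continuous, off the interface and up to it from either side. *Control volume.* Fix $t\in I$ and a time-independent bounded Lipschitz open set $\Omega$ with $\overline\Omega\subset B(t)$ and outward unit normal $n$, such that $\partial\Omega\cap S(t)$ has zero area. Put $k_a=\tfrac12\rho_a\|v_a\|^2$, $$\mathcal W_{\mathrm{ext}}(\Omega)=-\int_{\partial\Omega}[(k_{\mathrm s}+\psi_{\mathrm s})v_{\mathrm s}+k_{\mathrm f}v_{\mathrm f}]\cdot n+\int_{\partial\Omega}(T_{\mathrm s}n\cdot v_{\mathrm s}+T_{\mathrm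 f}n\cdot v_{\mathrm f})+\int_\Omega(b_{\mathrm s}\cdot v_{\mathrm s}+b_{\mathrm f}\cdot v_{\mathrm f}),$$ $$\mathscr D=2\mu_{\mathrm f}\|D_{\mathrm f}\|^2+2\mu_B\|D_{\mathrm f}-D_{\mathrm s}\|^2+\frac{\mu_D\phi_{\mathrm f}^2}{\kappa_{\mathrm s}}\|w\|^2,\qquad \mathscr I=[\![T_{\mathrm f}m\cdot w]\!]-\tfrac12d\,[\![\|w\|^2]\!].$$ *Claim.* All these integrands are integrable, $\int_\Omega(k_{\mathrm s}+k_{\mathrm f}+\psi_{\mathrm s})$ is differentiable in time at $t$, and $$\mathcal W_{\mathrm{ext}}(\Omega)=\frac{\mathrm d}{\mathrm dt}\int_\Omega(k_{\mathrm s}+k_{\mathrm f}+\psi_{\mathrm s})+\int_\Omega\mathscr D+\int_{\Omega\cap S(t)}\mathscr I.$$ -/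

import Mathlib

open MeasureTheory Filter Topology Set

noncomputable section

namespace Poro

/-! ### Vectors, second-order tensors and differential operators -/

/-- Three-dimensional Euclidean space, with its inner product, Borel sets and Lebesgue measure
(as a type of its own, so that coordinates do not interfere with the search for instances). -/
def E : Type := EuclideanSpace ℝ (Fin 3)

instance : NormedAddCommGroup E :=
  inferInstanceAs (NormedAddCommGroup (EuclideanSpace ℝ (Fin 3)))

instance : InnerProductSpace ℝ E :=
  inferInstanceAs (InnerProductSpace ℝ (EuclideanSpace ℝ (Fin 3)))

instance : FiniteDimensional ℝ E :=
  inferInstanceAs (FiniteDimensional ℝ (EuclideanSpace ℝ (Fin 3)))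

instance : MeasurableSpace E := borel E

instance : BorelSpace E := ⟨rfl⟩

/-- The identification of `E` with `ℝ³` as inner product spaces. -/
def coords : E ≃ₗᵢ[ℝ] EuclideanSpace ℝ (Fin 3) :=
  LinearIsometryEquiv.refl ℝ (EuclideanSpace ℝ (Fin 3))

/-- Second-order tensors are linear operators on vectors. -/
abbrev Tensor := E →L[ℝ] E

/-- The transpose of a tensor. -/
def transp (A : Tensor) : Tensor := ContinuousLinearMap.adjoint A

/-- The trace of a tensor. -/
def tr (A : Tensor) : ℝ := LinearMap.trace ℝ E (A : E →ₗ[ℝ] E)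

/-- The inner product `A : B = tr (Aᵀ B)` of tensors. -/
def ddot (A B : Tensor) : ℝ := tr (transp A ∘L B)

/-- The dyad `u ⊗ w`, that is `(u ⊗ w) v = (w · v) u`. -/
def dyad (u w : E) : Tensor := InnerProductSpace.rankOne ℝ u w

/-- The symmetric part of a tensor. -/
def symPart (A : Tensor) : Tensor := (1 / 2 : ℝ) • (A + transp A)

/-- The standard orthonormal basis. -/
def e (i : Fin 3) : E := coords.symm (EuclideanSpace.single i 1)

/-- Divergence of a vector field. -/
def divVec (v : E → E) (x : E) : ℝ := tr (fderiv ℝ v x)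

/-- Divergence of a tensor field, `(div T)ᵢ = ∑ⱼ ∂ⱼ Tᵢⱼ`. -/
def divTensor (T : E → Tensor) (x : E) : E := ∑ j, (fderiv ℝ T x (e j)) (e j)

/-! ### One-sided limits and jumps -/

/-- `f⁺ = lim_{s → 0⁺} f (x + s ν)`. -/
def tracePlus {V : Type*} [TopologicalSpace V] [Nonempty V] (ν : E) (f : E → V) (x : E) : V :=
  limUnder (𝓝[>] (0 : ℝ)) (fun s => f (x + s • ν))

/-- `f⁻ = lim_{s → 0⁺} f (x - s ν)`. -/
def traceMinus {V : Type*} [TopologicalSpace V] [Nonempty V] (ν : E) (f : E → V) (x : E) : V :=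
  limUnder (𝓝[>] (0 : ℝ)) (fun s => f (x - s • ν))

/-- The jump `⟦f⟧ = f⁺ - f⁻`. -/
def jump {V : Type*} [TopologicalSpace V] [AddGroup V] (ν : E) (f : E → V) (x : E) : V :=
  tracePlus ν f x - traceMinus ν f x

/-- The mean `⟨f⟩ = (f⁺ + f⁻) / 2`. -/
def mean (ν : E) (f : E → ℝ) (x : E) : ℝ :=
  (1 / 2) * (tracePlus ν f x + traceMinus ν f x)

/-! ### Oriented surfaces and piecewise smooth fields -/

/-- Near the point `X` of `S`, the set `S` is the zero set of the `C¹` function `g`, whose gradient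
does not vanish at `X` and is positively proportional to the unit normal `m` along `S`. Hence
`{g > 0}` is, near `X`, the side of `S` into which `m` points. -/
def IsLocalDefining (S : Set E) (m : E → E) (g : E → ℝ) (X : E) : Prop :=
  ContDiffAt ℝ 1 g X ∧ fderiv ℝ g X ≠ 0 ∧
    ∀ᶠ Y in 𝓝 X, (Y ∈ S ↔ g Y = 0) ∧ (Y ∈ S → gradient g Y = ‖gradient g Y‖ • m Y)

/-- `S` is an embedded `C¹` surface in the open set `B`, without boundary in `B` and closed relative
to `B` (so that it has no self-intersections, and is either closed or cuts through `B`), oriented by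
the continuous unit normal field `m`. -/
def IsOrientedSurface (B S : Set E) (m : E → E) : Prop :=
  S ⊆ B ∧ IsOpen (B \ S) ∧ (∀ X ∈ S, ‖m X‖ = 1) ∧ ∀ X ∈ S, ∃ g : E → ℝ, IsLocalDefining S m g X

/-- The field `f`, depending on a parameter in `U` (for instance time) and on a point of `B`, is of
class `C^k` jointly in both arguments away from `S`, and of class `C^k` up to `S` from either side:
near each point of `S` it coincides on either side with a `C^k` function defined on both sides. -/
def PwContDiff {P V : Type*} [NormedAddCommGroup P] [NormedSpace ℝ P] [NormedAddCommGroup V]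
    [NormedSpace ℝ V] (k : ℕ) (U : Set P) (B S : Set E) (m : E → E) (f : P → E → V) : Prop :=
  (∀ p ∈ U, ∀ X ∈ B \ S, ContDiffAt ℝ k (fun q : P × E => f q.1 q.2) (p, X)) ∧
  ∀ p ∈ U, ∀ X ∈ S, ∃ fp fm : P × E → V,
    ContDiffAt ℝ k fp (p, X) ∧ ContDiffAt ℝ k fm (p, X) ∧
    ∀ g : E → ℝ, IsLocalDefining S m g X →
      ∀ᶠ q in 𝓝 (p, X), (0 < g q.2 → f q.1 q.2 = fp q) ∧ (g q.2 < 0 → f q.1 q.2 = fm q)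

/-! ### Control volumes -/

/-- A bounded open set that is, near each boundary point and in suitable Cartesian coordinates, the
region below the graph of a Lipschitz function. -/
def IsLipschitzDomain (Ω : Set E) : Prop :=
  IsOpen Ω ∧ Bornology.IsBounded Ω ∧
  ∀ x₀ ∈ frontier Ω, ∃ (r : E ≃ₗᵢ[ℝ] EuclideanSpace ℝ (Fin 3))
      (γ : EuclideanSpace ℝ (Fin 2) → ℝ) (K : NNReal),
    LipschitzWith K γ ∧ ∀ᶠ x in 𝓝 x₀, (x ∈ Ω ↔ (r x) 2 < γ !₂[(r x) 0, (r x) 1])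

/-- `n` is the outward unit normal of `Ω` at the boundary point `x`: to first order at `x`, the
set `Ω` is the half-space `{y | (y - x) · n < 0}`. -/
def IsOuterNormal (Ω : Set E) (x n : E) : Prop :=
  ‖n‖ = 1 ∧ ∀ ε > (0 : ℝ), ∀ᶠ y in 𝓝 x,
    (y ∈ Ω → inner ℝ (y - x) n ≤ ε * ‖y - x‖) ∧ (y ∉ Ω → -(ε * ‖y - x‖) ≤ inner ℝ (y - x) n)

/-- The outward unit normal field on the boundary (for a Lipschitz domain it exists at almost every
boundary point, where it is unique). -/
def outerNormal (Ω : Set E) (x : E) : E := Classical.epsilon (IsOuterNormal Ω x)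

/-- The surface area measure: two-dimensional Hausdorff measure, normalized to agree with
the Lebesgue measure on planes. -/
def area : Measure E := μHE[2]

/-! ### The mixture -/

/-- The two constituents. -/
inductive Phase
  | solid
  | fluid

open Phase

/-- The primitive data of a fluid-saturated porous mixture with an interface. -/
structure Mixture where
  /-- The reference configurations. -/
  ref : Phase → Set E
  /-- The motions `χₐ (t, X)`. -/
  χ : Phase → ℝ → E → E
  /-- The interface in the solid reference configuration. -/
  Ss : Set E
  /-- The unit normal orienting the interface in the solid reference configuration. -/
  ms : E → E
  /-- The volume fractions, as functions of time and position. -/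
  φ : Phase → ℝ → E → ℝ
  /-- The constant mass densities of the pure constituents. -/
  ρstar : Phase → ℝ
  /-- The strain energy of the pure solid, a function of the isochoric right Cauchy-Green strain
  and of the solid particle. -/
  Ψhat : Tensor → E → ℝ
  /-- The shear viscosity of the fluid in the mixture. -/
  μf : ℝ → E → ℝ
  /-- The Brinkman viscosity. -/
  μB : ℝ → E → ℝ
  /-- The Darcy viscosity. -/
  μD : ℝ → E → ℝ
  /-- The permeability of the solid. -/
  κs : ℝ → E → ℝ
  /-- The pore pressure. -/
  p : ℝ → E → ℝ
  /-- The external body force densities. -/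
  b : Phase → ℝ → E → E
  /-- The interaction force densities per unit area of the interface. -/
  ξ : Phase → ℝ → E → E

namespace Mixture

variable (M : Mixture)

/-! #### Kinematics -/

/-- The current configuration `B(t)`, the image of the solid motion. -/
def body (t : ℝ) : Set E := M.χ solid t '' M.ref solid

/-- The interface `S(t)`, convected by the solid motion. -/
def interface (t : ℝ) : Set E := M.χ solid t '' M.Ss

/-- The inverse image of `S(t)` under the motion of a phase. -/
def refInterface (a : Phase) (t : ℝ) : Set E := {X ∈ M.ref a | M.χ a t X ∈ M.interface t}

/-- The inverse `χₐ(·, t)⁻¹` of the motion of a phase. -/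
def inv (a : Phase) (t : ℝ) (x : E) : E := Function.invFunOn (M.χ a t) (M.ref a) x

/-- The deformation gradient `Fₐ`, on the reference configuration. -/
def F (a : Phase) (t : ℝ) (X : E) : Tensor := fderiv ℝ (M.χ a t) X

/-- `Jₐ = det Fₐ`. -/
def J (a : Phase) (t : ℝ) (X : E) : ℝ := (M.F a t X).det

/-- The material velocity, on the reference configuration. -/
def velRef (a : Phase) (t : ℝ) (X : E) : E := deriv (fun τ => M.χ a τ X) t

/-- The material acceleration, on the reference configuration. -/
def accRef (a : Phase) (t : ℝ) (X : E) : E := deriv (fun τ => M.velRef a τ X) t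

/-- The velocity as a field on the current configuration. -/
def v (a : Phase) (t : ℝ) (x : E) : E := M.velRef a t (M.inv a t x)

/-- The acceleration as a field on the current configuration. -/
def acc (a : Phase) (t : ℝ) (x : E) : E := M.accRef a t (M.inv a t x)

/-- The velocity gradient `Lₐ`. -/
def L (a : Phase) (t : ℝ) (x : E) : Tensor := fderiv ℝ (M.v a t) x

/-- The stretching tensor `Dₐ`. -/
def D (a : Phase) (t : ℝ) (x : E) : Tensor := symPart (M.L a t x)

/-- The velocity `v_f - v_s` of the fluid relative to the solid. -/
def w (t : ℝ) (x : E) : E := M.v fluid t x - M.v solid t x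

/-- The vector `J_s F_s⁻ᵀ m_s` at the point `X` of the reference interface. It is continuous across
the interface, and is computed here from the positive side. -/
def pushNormal (t : ℝ) (X : E) : E :=
  tracePlus (M.ms X)
    (fun Y => M.J solid t Y • (transp (ContinuousLinearMap.inverse (M.F solid t Y))) (M.ms X)) X

/-- The unit normal `m` orienting `S(t)`. -/
def m (t : ℝ) (x : E) : E :=
  ‖M.pushNormal t (M.inv solid t x)‖⁻¹ • M.pushNormal t (M.inv solid t x)

/-! #### Mass densities and kinetic energies -/

/-- The mass density of a phase in the mixture. -/
def ρ (a : Phase) (t : ℝ) (x : E) : ℝ := M.ρstar a * M.φ a t x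

/-- The kinetic energy density of a phase. -/
def k (a : Phase) (t : ℝ) (x : E) : ℝ := 1 / 2 * M.ρ a t x * ‖M.v a t x‖ ^ 2

/-- The filtration velocity. -/
def vflt (t : ℝ) (x : E) : E := M.φ fluid t x • M.w t x

/-! #### Elasticity of the solid -/

/-- The right Cauchy-Green strain tensor `C_s = F_sᵀ F_s`. -/
def C (t : ℝ) (X : E) : Tensor := transp (M.F solid t X) ∘L M.F solid t X

/-- The isochoric part `J_s^(-2/3) C` of a strain tensor `C`, where `J_s² = det C`. -/
def isochoric (C : Tensor) : Tensor := (C.det ^ (-(1 / 3) : ℝ)) • C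

/-- The referential volume fraction of the solid, `φ_Rs = J_s φ_s`. -/
def φRs (t : ℝ) (X : E) : ℝ := M.J solid t X * M.φ solid t (M.χ solid t X)

/-- The strain energy of the solid in the mixture, per unit reference volume. -/
def Ψs (t : ℝ) (X : E) : ℝ := M.φRs t X * M.Ψhat (isochoric (M.C t X)) X

/-- The strain energy of the solid per unit current volume. -/
def ψs (t : ℝ) (x : E) : ℝ :=
  (M.J solid t (M.inv solid t x))⁻¹ * M.Ψs t (M.inv solid t x)

/-- The symmetric tensor `∂Ψ̂_s/∂C_s`, the gradient of `C ↦ Ψ̂_s (J_s^(-2/3) C, X)` on the space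
of symmetric tensors: its inner product with a symmetric tensor `H` is the derivative along `H`. -/
def dΨdC (C : Tensor) (X : E) : Tensor :=
  ∑ i, ∑ j, (fderiv ℝ (fun A : Tensor => M.Ψhat (isochoric A) X) C (symPart (dyad (e i) (e j)))) •
    dyad (e i) (e j)

/-- The elastic Cauchy stress at the particle `X`. -/
def TeRef (t : ℝ) (X : E) : Tensor :=
  (2 * M.φRs t X * (M.J solid t X)⁻¹) •
    (M.F solid t X ∘L M.dΨdC (M.C t X) X ∘L transp (M.F solid t X))

/-- The elastic Cauchy stress on the current configuration. -/
def Te (t : ℝ) (x : E) : Tensor := M.TeRef t (M.inv solid t x)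

/-! #### Stresses and interaction forces -/

/-- The Cauchy stresses of the two phases. -/
def T (a : Phase) (t : ℝ) (x : E) : Tensor :=
  match a with
  | solid => -(M.φ solid t x * M.p t x) • ContinuousLinearMap.id ℝ E + M.Te t x
      + (2 * M.μB t x) • (M.D solid t x - M.D fluid t x)
  | fluid => -(M.φ fluid t x * M.p t x) • ContinuousLinearMap.id ℝ E
      + ((2 * M.μf t x) • M.D fluid t x + (2 * M.μB t x) • (M.D fluid t x - M.D solid t x))

/-- The interaction force density on the fluid, the sum of `p ∇φ_f` and the Darcy drag. -/
def pf (t : ℝ) (x : E) : E :=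
  M.p t x • gradient (M.φ fluid t) x - (M.μD t x * M.φ fluid t x ^ 2 / M.κs t x) • M.w t x

/-- The interaction force densities, which sum to zero. -/
def pint (a : Phase) (t : ℝ) (x : E) : E :=
  match a with
  | solid => -M.pf t x
  | fluid => M.pf t x

/-! #### Standing assumptions -/

/-- The kinematic assumptions on a time set `I`: the solid motion is a homeomorphism of the solid
body onto `B(t)`, twice continuously differentiable in space-time off the interface and up to it
from either side; the fluid motion is a diffeomorphism away from the interface, across which it may
be discontinuous; Jacobians are positive. -/
structure IsKinematic (I : Set ℝ) : Prop where
  open_ref : ∀ a, IsOpen (M.ref a)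
  surface : IsOrientedSurface (M.ref solid) M.Ss M.ms
  solid_cont : ContinuousOn (fun q : ℝ × E => M.χ solid q.1 q.2) (I ×ˢ M.ref solid)
  solid_inj : ∀ t ∈ I, InjOn (M.χ solid t) (M.ref solid)
  solid_open : IsOpen {q : ℝ × E | q.1 ∈ I ∧ q.2 ∈ M.body q.1}
  solid_inv_cont : ContinuousOn (fun q : ℝ × E => M.inv solid q.1 q.2)
    {q : ℝ × E | q.1 ∈ I ∧ q.2 ∈ M.body q.1}
  solid_smooth : PwContDiff 2 I (M.ref solid) M.Ss M.ms (M.χ solid)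
  solid_det : ∀ t ∈ I, ∀ X ∈ M.ref solid \ M.Ss, 0 < M.J solid t X
  solid_det_trace : ∀ t ∈ I, ∀ X ∈ M.Ss,
    0 < tracePlus (M.ms X) (M.J solid t) X ∧ 0 < traceMinus (M.ms X) (M.J solid t) X
  fluid_maps : ∀ t ∈ I, MapsTo (M.χ fluid t) (M.ref fluid) (M.body t)
  fluid_bij : ∀ t ∈ I, BijOn (M.χ fluid t) (M.ref fluid \ M.refInterface fluid t)
    (M.body t \ M.interface t)
  fluid_smooth : ∀ t ∈ I, ∀ X ∈ M.ref fluid \ M.refInterface fluid t,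
    ContDiffAt ℝ 2 (fun q : ℝ × E => M.χ fluid q.1 q.2) (t, X)
  fluid_det : ∀ t ∈ I, ∀ X ∈ M.ref fluid \ M.refInterface fluid t, 0 < M.J fluid t X

/-- A field on the current configurations is piecewise `C^k`: its pull-back by the solid motion is
`C^k` off the fixed reference interface, and up to it from either side. -/
def PwField {V : Type*} [NormedAddCommGroup V] [NormedSpace ℝ V] (k : ℕ) (I : Set ℝ)
    (f : ℝ → E → V) : Prop :=
  PwContDiff k I (M.ref solid) M.Ss M.ms (fun t X => f t (M.χ solid t X))

/-- The strains at which the energy of the (incompressible) pure solid is evaluated: symmetric,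
positive definite and of unit determinant. -/
def isochoricStrains : Set Tensor :=
  {A | transp A = A ∧ (∀ u : E, u ≠ 0 → 0 < inner ℝ (A u) u) ∧ A.det = 1}

/-- Piecewise regularity of the fields. -/
structure IsRegular (I : Set ℝ) : Prop where
  φ_reg : ∀ a, M.PwField 1 I (M.φ a)
  vf_reg : M.PwField 1 I (M.v fluid)
  T_reg : ∀ a, M.PwField 1 I (M.T a)
  b_reg : ∀ a, M.PwField 0 I (M.b a)
  Ψhat_reg : PwContDiff 1 isochoricStrains (M.ref solid) M.Ss M.ms M.Ψhat
  Ψhat_nonneg : ∀ A ∈ isochoricStrains, ∀ X ∈ M.ref solid, 0 ≤ M.Ψhat A X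

/-- Balance of mass: positive pure densities, saturation, the local balances, and the jump
condition, at time `t`. -/
structure MassBalance (t : ℝ) : Prop where
  ρstar_pos : ∀ a, 0 < M.ρstar a
  φ_mem : ∀ a, ∀ x ∈ M.body t \ M.interface t, M.φ a t x ∈ Icc (0 : ℝ) 1
  saturation : ∀ x ∈ M.body t \ M.interface t, M.φ solid t x + M.φ fluid t x = 1
  balance : ∀ a, ∀ x ∈ M.body t \ M.interface t,
    deriv (fun τ => M.ρ a τ x) t + divVec (fun y => M.ρ a t y • M.v a t y) x = 0
  jump_cond : ∀ x ∈ M.interface t, inner ℝ (jump (M.m t x) (M.vflt t) x) (M.m t x) = 0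

/-- Balance of momentum: the local balances, and the jump conditions with interfacial interaction
forces that sum to zero, at time `t`. -/
structure MomentumBalance (t : ℝ) : Prop where
  balance : ∀ a, ∀ x ∈ M.body t \ M.interface t,
    M.ρ a t x • M.acc a t x - divTensor (M.T a t) x - M.b a t x - M.pint a t x = 0
  jump_cond : ∀ a, ∀ x ∈ M.interface t,
    (jump (M.m t x) (fun y => M.ρ a t y • dyad (M.v a t y - M.v solid t y)
      (M.v a t y - M.v solid t y) - M.T a t y) x) (M.m t x) + M.ξ a t x = 0
  ξ_sum : ∀ x ∈ M.interface t, M.ξ solid t x + M.ξ fluid t x = 0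

/-! #### Power -/

/-- The density of the energy `k_s + k_f + ψ_s`. -/
def energy (t : ℝ) (x : E) : ℝ := M.k solid t x + M.k fluid t x + M.ψs t x

/-- The outward energy flux `[(k_s + ψ_s) v_s + k_f v_f] · n` through the boundary of `Ω`. -/
def energyFlux (Ω : Set E) (t : ℝ) (x : E) : ℝ :=
  inner ℝ ((M.k solid t x + M.ψs t x) • M.v solid t x + M.k fluid t x • M.v fluid t x)
    (outerNormal Ω x)

/-- The power density `T_s n · v_s + T_f n · v_f` of the tractions on the boundary of `Ω`. -/
def tractionPower (Ω : Set E) (t : ℝ) (x : E) : ℝ :=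
  inner ℝ (M.T solid t x (outerNormal Ω x)) (M.v solid t x)
    + inner ℝ (M.T fluid t x (outerNormal Ω x)) (M.v fluid t x)

/-- The power density `b_s · v_s + b_f · v_f` of the external body forces. -/
def bodyPower (t : ℝ) (x : E) : ℝ :=
  inner ℝ (M.b solid t x) (M.v solid t x) + inner ℝ (M.b fluid t x) (M.v fluid t x)

/-- The external supply of mechanical power to `Ω`. -/
def Wext (Ω : Set E) (t : ℝ) : ℝ :=
  -(∫ x in frontier Ω, M.energyFlux Ω t x ∂area) + (∫ x in frontier Ω, M.tractionPower Ω t x ∂area)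
    + ∫ x in Ω, M.bodyPower t x

/-- The volume density of the dissipation rate; `ddot A A` is the squared norm `‖A‖²`. -/
def dissipation (t : ℝ) (x : E) : ℝ :=
  2 * M.μf t x * ddot (M.D fluid t x) (M.D fluid t x)
    + 2 * M.μB t x * ddot (M.D fluid t x - M.D solid t x) (M.D fluid t x - M.D solid t x)
    + M.μD t x * M.φ fluid t x ^ 2 / M.κs t x * ‖M.w t x‖ ^ 2

/-- The mass flux `d = ρ_f (v_f - v_s) · m` through the interface. It has no jump, by the balance of
mass; its two one-sided values are averaged. -/
def d (t : ℝ) (x : E) : ℝ :=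
  mean (M.m t x) (fun y => M.ρ fluid t y * inner ℝ (M.w t y) (M.m t x)) x

/-- The surface density of the power expended on the interface. -/
def interfacePower (t : ℝ) (x : E) : ℝ :=
  jump (M.m t x) (fun y => inner ℝ (M.T fluid t y (M.m t x)) (M.w t y)) x
    - 1 / 2 * M.d t x * jump (M.m t x) (fun y => ‖M.w t y‖ ^ 2) x

end Mixture

end Poro

end

namespace Poro

/-! ### Area of Lipschitz graphs -/

/-! Everything is measured relative to the solid. Put `e = k_s + k_f + ψ_s` and `P = T_s v_s + T_f
v_f - k_f w` (`powerFlux`). Since `k_f v_f = k_f v_s + k_f w` and the stresses are symmetric, the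
boundary terms of the external power are `-∫ e v_s · n + ∫ P · n`. The transport theorem
(`hasDerivAt_setIntegral`) gives `d/dt ∫_Ω e = -∫_∂Ω e v_s · n + ∫_Ω rate e`, where `rate e` is
`J_s⁻¹ ∂_t (J_s e)` at a fixed solid particle; there is no interface term because the interface is
fixed in the solid reference configuration. The divergence theorem across a surface
(`IsPwC1.divergence`) gives `∫_∂Ω P · n = ∫_Ω div P + ∫_{Ω ∩ S} ⟦P⟧ · m`. What remains are two
pointwise identities.

Off `S`, `div P + b_s · v_s + b_f · v_f - rate e` is the dissipation (`local_power_balance`).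
Momentum is multiplied by velocity and mass balance is used for the kinetic energies
(`kinetic_balance`). The elastic stress power is exactly `rate ψ_s` (`rate_ψs`), because mass
balance makes `J_s φ_s` constant at a particle. The pressure drops out by saturation, `φ_s div v_s +
φ_f div v_f + ∇φ_f · w = 0` (`saturation_constraint`). On `S`, `⟦P⟧ · m` is the interface power
(`normalJump_powerFlux`): the forces `ξ_a` cancel in the sum of the momentum jumps, `v_s` is
continuous, and the mass flux has no jump.

The analysis has two layers. For a Lipschitz domain, Rademacher's theorem yields the area formula
for graphs, differentiating the integral of a translated function yields the divergence theorem
below a graph, and cutoffs make it global. Since nothing is known about how `S` meets `∂Ω` beyond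
the area of the intersection being zero, `Ω ∩ S` is never treated as a union of nice domains. The
divergence and transport theorems are first proved against `C¹` test functions, where `S` can be
localized or pulled back, and are then applied to mollified indicators of `Ω`. Their gradients are
minus the mollified normal measure of `∂Ω`, which produces the boundary integrals in the limit. In
the transport theorem this limit is taken jointly in the mollification index and in time, so that it
commutes with the time derivative. -/

theorem hausdorffMeasure_image_le_of_edist_le {X Y : Type*} [EMetricSpace Y]
    [MeasurableSpace Y] [BorelSpace Y] {f g : X → Y} {s : Set X} {K : NNReal}
    (hg : InjOn g s) (h : ∀ x ∈ s, ∀ y ∈ s, edist (f x) (f y) ≤ K * edist (g x) (g y)) (d : ℕ) :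
    (μHE[d] : Measure Y) (f '' s) ≤ (K : ENNReal) ^ d * μHE[d] (g '' s) := by
  rcases s.eq_empty_or_nonempty with rfl | ⟨x₀, hx₀⟩
  · simp
  have : Nonempty X := ⟨x₀⟩
  -- The hypothesis says that `f ∘ g⁻¹` is `K`-Lipschitz from `g '' s` onto `f '' s`, so it expands
  -- two-dimensional, or any `d`-dimensional, measure by at most `K ^ d`.
  have hL : LipschitzOnWith K (f ∘ Function.invFunOn g s) (g '' s) := by
    rintro _ ⟨x, hx, rfl⟩ _ ⟨y, hy, rfl⟩
    simpa [hg.leftInvOn_invFunOn hx, hg.leftInvOn_invFunOn hy] using h x hx y hy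
  have himg : (f ∘ Function.invFunOn g s) '' (g '' s) = f '' s := by
    rw [image_image]
    exact image_congr fun x hx => by simp [hg.leftInvOn_invFunOn hx]
  have := hL.hausdorffMeasure_image_le (d := d) (by positivity)
  rw [himg, ENNReal.rpow_natCast] at this
  simp only [Measure.euclideanHausdorffMeasure_def, Measure.smul_apply, ENNReal.smul_def,
    smul_eq_mul]
  rw [mul_left_comm]
  gcongr

/-- The Euclidean plane. -/
abbrev Plane : Type := EuclideanSpace ℝ (Fin 2)

section Graph

variable {V : Type*} [NormedAddCommGroup V] [InnerProductSpace ℝ V]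
  (q : V ≃ₗᵢ[ℝ] WithLp 2 (Plane × ℝ))

/-- The parametrization of the graph of `γ` in the Cartesian coordinates `q`. -/
noncomputable def graphMap (γ : Plane → ℝ) (y : Plane) : V := q.symm (WithLp.toLp 2 (y, γ y))

/-- The linear map whose graph is that of the functional `l`. -/
noncomputable def graphLin (l : Plane →L[ℝ] ℝ) : Plane →ₗ[ℝ] V where
  toFun y := graphMap q l y
  map_add' x y := by
    rw [graphMap, graphMap, graphMap, ← map_add]; congr 1; apply WithLp.ofLp_injective; ext1 <;> simp
  map_smul' c y := by
    rw [graphMap, graphMap, ← map_smul]; congr 1; apply WithLp.ofLp_injective; ext1 <;> simp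

/-- The area density of a graph. -/
noncomputable def graphJac (l : Plane →L[ℝ] ℝ) : ℝ := √(1 + ‖l‖ ^ 2)

theorem one_le_graphJac (l : Plane →L[ℝ] ℝ) : 1 ≤ graphJac l := by
  rw [graphJac, Real.one_le_sqrt]; nlinarith [sq_nonneg ‖l‖]

/-- `graphJac l` is the Euclidean norm of `(1, ‖l‖)`, hence 1-Lipschitz in `l`. This compares the
area density of a graph with that of its linear approximations. -/
theorem graphJac_le_add (l l' : Plane →L[ℝ] ℝ) : graphJac l ≤ graphJac l' + ‖l - l'‖ := by
  have h1 : ‖l‖ ≤ ‖l'‖ + ‖l - l'‖ := by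
    simpa using norm_add_le l' (l - l')
  have h2 : ‖l'‖ ≤ graphJac l' := Real.le_sqrt_of_sq_le (by linarith)
  have h3 := Real.sq_sqrt (show (0:ℝ) ≤ 1 + ‖l'‖ ^ 2 by positivity)
  have h4 := one_le_graphJac l'
  rw [graphJac, Real.sqrt_le_left (by positivity)]
  rw [← graphJac] at h3
  nlinarith [norm_nonneg l, norm_nonneg (l - l'), norm_nonneg l']

theorem continuous_graphJac : Continuous graphJac := by unfold graphJac; fun_prop

theorem norm_functional_sq (l : Plane →L[ℝ] ℝ) :
    ‖l‖ ^ 2 = l (EuclideanSpace.single 0 1) ^ 2 + l (EuclideanSpace.single 1 1) ^ 2 := by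
  obtain ⟨v, rfl⟩ := (InnerProductSpace.toDual ℝ Plane).surjective l
  simp only [LinearIsometryEquiv.norm_map, InnerProductSpace.toDual_apply_apply]
  rw [EuclideanSpace.norm_sq_eq]
  simp [Fin.sum_univ_two, EuclideanSpace.inner_single_right]

theorem inner_graphLin (l : Plane →L[ℝ] ℝ) (x y : Plane) :
    inner ℝ (graphLin q l x) (graphLin q l y) = inner ℝ x y + l x * l y := by
  change inner ℝ (q.symm _) (q.symm _) = _
  rw [LinearIsometryEquiv.inner_map_map, WithLp.prod_inner_apply]
  simp [mul_comm]

/-- By `inner_graphLin` the Gram matrix of the images of the basis is the identity plus `l lᵀ`,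
whose determinant is `1 + ‖l‖²`. -/
theorem normDet_graphLin (l : Plane →L[ℝ] ℝ) : (graphLin q l).normDet = graphJac l := by
  have h := (graphLin q l).normDet_sq_eq_det_gram (EuclideanSpace.basisFun (Fin 2) ℝ)
  rw [graphJac, norm_functional_sq, eq_comm, Real.sqrt_eq_iff_mul_self_eq (by positivity)
    (LinearMap.normDet_nonneg _), ← sq]
  simp only [RCLike.ofReal_real_eq_id, id_eq] at h
  rw [h, Matrix.det_fin_two]
  simp only [Matrix.gram_apply, EuclideanSpace.basisFun_apply, inner_graphLin,
    EuclideanSpace.inner_single_left]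
  simp
  ring

theorem norm_graphMap_sub_sq (γ : Plane → ℝ) (x y : Plane) :
    ‖graphMap q γ x - graphMap q γ y‖ ^ 2 = ‖x - y‖ ^ 2 + (γ x - γ y) ^ 2 := by
  rw [graphMap, graphMap, ← map_sub, LinearIsometryEquiv.norm_map, WithLp.prod_norm_sq_eq_of_L2]
  simp

theorem norm_sub_le_norm_graphMap_sub (γ : Plane → ℝ) (x y : Plane) :
    ‖x - y‖ ≤ ‖graphMap q γ x - graphMap q γ y‖ := by
  refine le_of_sq_le_sq ?_ (norm_nonneg _)
  rw [norm_graphMap_sub_sq]; nlinarith [sq_nonneg (γ x - γ y)]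

/-- Both chords lie over the same horizontal vector, so they differ by a vertical vector. -/
theorem norm_graphMap_sub_graphMap_le (γ γ' : Plane → ℝ) (x y : Plane) :
    ‖graphMap q γ x - graphMap q γ y‖ ≤
      ‖graphMap q γ' x - graphMap q γ' y‖ + |γ x - γ y - (γ' x - γ' y)| := by
  have : graphMap q γ x - graphMap q γ y = (graphMap q γ' x - graphMap q γ' y)
      + q.symm (WithLp.toLp 2 (0, γ x - γ y - (γ' x - γ' y))) := by
    simp only [graphMap, ← map_sub, ← map_add]; congr 1; apply WithLp.ofLp_injective; ext1 <;> simp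
  rw [this]
  refine (norm_add_le _ _).trans ?_
  rw [LinearIsometryEquiv.norm_map, WithLp.prod_norm_eq_of_L2]
  simp [Real.sqrt_sq_eq_abs]

theorem continuous_graphMap {γ : Plane → ℝ} (hγ : Continuous γ) : Continuous (graphMap q γ) := by
  unfold graphMap
  exact q.symm.continuous.comp ((WithLp.prod_continuous_toLp 2 Plane ℝ).comp (by fun_prop))

theorem graphMap_injective (γ : Plane → ℝ) : Function.Injective (graphMap q γ) := by
  intro x y h
  have := norm_sub_le_norm_graphMap_sub q γ x y
  rw [h, sub_self, norm_zero] at this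
  exact sub_eq_zero.1 (norm_le_zero_iff.1 this)

theorem isClosedEmbedding_graphMap {γ : Plane → ℝ} (hγ : Continuous γ) :
    IsClosedEmbedding (graphMap q γ) := by
  have hl : Function.LeftInverse (fun x => (q x).fst) (graphMap q γ) := fun y => by simp [graphMap]
  exact hl.isClosedEmbedding
    ((WithLp.prod_continuous_ofLp 2 Plane ℝ).fst.comp q.continuous) (continuous_graphMap q hγ)

theorem edist_le_of_norm_sub_le {W W' : Type*} [SeminormedAddCommGroup W]
    [SeminormedAddCommGroup W'] {a b : W} {c d : W'} {K : NNReal} (h : ‖a - b‖ ≤ K * ‖c - d‖) :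
    edist a b ≤ K * edist c d := by
  rw [edist_nndist, edist_nndist, ← ENNReal.coe_mul, ENNReal.coe_le_coe, ← NNReal.coe_le_coe]
  simpa [dist_eq_norm] using h

variable [MeasurableSpace V] [BorelSpace V]

/-- If `γ - l` varies by at most `δ ‖x - y‖`, chords of the two graphs have comparable lengths up to
the factor `1 + δ` in both directions, since a chord is at least as long as its horizontal
projection. The area of the plane graph of `l` is known exactly. With `l = 0` and `δ` the Lipschitz
constant, this is also the crude bound that makes graphs over null sets null and over bounded sets
of finite area. -/
theorem graphMap_area_le_of_approximatesLinearOn {γ : Plane → ℝ} {l : Plane →L[ℝ] ℝ} {s : Set Plane}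
    {δ : NNReal} (h : ∀ x ∈ s, ∀ y ∈ s, |γ x - γ y - (l x - l y)| ≤ δ * ‖x - y‖) :
    μHE[2] (graphMap q γ '' s) ≤ (1 + δ : ENNReal) ^ 2 * (ENNReal.ofReal (graphJac l) * volume s) ∧
    (ENNReal.ofReal (graphJac l) * volume s) ≤ (1 + δ : ENNReal) ^ 2 * μHE[2] (graphMap q γ '' s) := by
  have h0 : μHE[2] (graphMap q l '' s) = ENNReal.ofReal (graphJac l) * volume s := by
    have := (graphLin q l).euclideanHausdorffMeasure_image_eq_normDet_mul_volume s
    rwa [normDet_graphLin, finrank_euclideanSpace_fin] at this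
  rw [← h0]
  have hδ : (1 + δ : ENNReal) = ((1 + δ : NNReal) : ENNReal) := by simp
  rw [hδ]
  refine ⟨hausdorffMeasure_image_le_of_edist_le (graphMap_injective q l).injOn ?_ 2,
    hausdorffMeasure_image_le_of_edist_le (graphMap_injective q γ).injOn ?_ 2⟩
  · intro x hx y hy
    refine edist_le_of_norm_sub_le ?_
    have := norm_graphMap_sub_graphMap_le q γ l x y
    have := norm_sub_le_norm_graphMap_sub q l x y
    push_cast
    nlinarith [h x hx y hy, δ.2]
  · intro x hx y hy
    refine edist_le_of_norm_sub_le ?_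
    have h1 := norm_graphMap_sub_graphMap_le q l γ x y
    rw [abs_sub_comm] at h1
    have := norm_sub_le_norm_graphMap_sub q γ x y
    push_cast
    nlinarith [h x hx y hy, δ.2]

/-- A countable partition on whose pieces `γ` is `δ`-close to linear; at almost every point of a
piece, by density, the derivative of `γ` is within `δ` of the linear map of that piece. -/
theorem exists_partition_graph_approx {γ : Plane → ℝ} {s : Set Plane} (hs : MeasurableSet s)
    (hd : ∀ x ∈ s, DifferentiableAt ℝ γ x) {δ : NNReal} (hδ : δ ≠ 0) :
    ∃ (t : ℕ → Set Plane) (l : ℕ → Plane →L[ℝ] ℝ), Pairwise (Function.onFun Disjoint t) ∧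
      (∀ n, MeasurableSet (t n)) ∧ s ⊆ ⋃ n, t n ∧
      (∀ n, ∀ x ∈ s ∩ t n, ∀ y ∈ s ∩ t n, |γ x - γ y - (l n x - l n y)| ≤ δ * ‖x - y‖) ∧
      ∀ n, ∀ᵐ x ∂volume.restrict (s ∩ t n), ‖fderiv ℝ γ x - l n‖ ≤ δ := by
  -- `γ` is replaced by the self-map `γ e₀` of the plane, to which the change-of-variables estimates
  -- for endomorphisms apply; pairing with the unit vector `e₀` recovers `γ`.
  let e₀ : Plane := EuclideanSpace.single 0 1
  have he₀ : ‖e₀‖ = 1 := by simp [e₀]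
  let f' : Plane → Plane →L[ℝ] Plane := fun x => (fderiv ℝ γ x).smulRight e₀
  have hf' : ∀ x ∈ s, HasFDerivWithinAt (fun y => γ y • e₀) (f' x) s x := fun x hx =>
    ((hd x hx).hasFDerivAt.smul_const e₀).hasFDerivWithinAt
  obtain ⟨t, A, h1, h2, h3, h4, -⟩ := exists_partition_approximatesLinearOn_of_hasFDerivWithinAt
    (fun y => γ y • e₀) s f' hf' (fun _ => δ) (fun _ => hδ)
  have hin : ∀ c : ℝ, inner ℝ e₀ (c • e₀) = c := fun c => by simp [inner_smul_right, he₀]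
  refine ⟨t, fun n => (innerSL ℝ e₀).comp (A n), h1, h2, h3, fun n x hx y hy => ?_, fun n => ?_⟩
  · have h := h4 n x hx y hy
    have h5 : γ x - γ y - (inner ℝ e₀ (A n x) - inner ℝ e₀ (A n y))
        = inner ℝ e₀ (γ x • e₀ - γ y • e₀ - A n (x - y)) := by
      simp only [inner_sub_right, map_sub, hin]
    simp only [ContinuousLinearMap.comp_apply, innerSL_apply_apply]
    rw [h5]
    refine (abs_real_inner_le_norm _ _).trans ?_
    simpa [he₀] using h
  · have h6 := (h4 n).norm_fderiv_sub_le volume (hs.inter (h2 n)) f'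
      (fun x hx => (hf' x hx.1).mono inter_subset_left)
    filter_upwards [h6] with x hx
    have h7 : fderiv ℝ γ x - (innerSL ℝ e₀).comp (A n) = (innerSL ℝ e₀).comp (f' x - A n) := by
      ext v
      simp [f', he₀]
    rw [h7]
    refine (ContinuousLinearMap.opNorm_comp_le _ _).trans ?_
    rw [innerSL_apply_norm, he₀, one_mul]
    exact_mod_cast hx

/-- On each piece of the partition, replacing the graph by a plane costs a factor `(1 + δ) ^ 2` in
area, and replacing the density of the plane by that of `γ` costs `1 + δ`, as densities are at least
one. Summing gives both inequalities up to `(1 + δ) ^ 3`, and `δ` tends to zero. -/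
theorem graphMap_area_eq_of_differentiable {γ : Plane → ℝ} (hγ : Continuous γ) {s : Set Plane}
    (hs : MeasurableSet s) (hd : ∀ x ∈ s, DifferentiableAt ℝ γ x) :
    μHE[2] (graphMap q γ '' s) = ∫⁻ y in s, ENNReal.ofReal (graphJac (fderiv ℝ γ y)) := by
  have hemb := (isClosedEmbedding_graphMap q hγ).measurableEmbedding
  have key : ∀ δ : NNReal, δ ≠ 0 →
      μHE[2] (graphMap q γ '' s) ≤ (1 + δ : ENNReal) ^ 3 *
        ∫⁻ y in s, ENNReal.ofReal (graphJac (fderiv ℝ γ y)) ∧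
      ∫⁻ y in s, ENNReal.ofReal (graphJac (fderiv ℝ γ y)) ≤
        (1 + δ : ENNReal) ^ 3 * μHE[2] (graphMap q γ '' s) := by
    intro δ hδ
    obtain ⟨t, l, h1, h2, h3, h4, h5⟩ := exists_partition_graph_approx hs hd hδ
    have hsu : s = ⋃ n, s ∩ t n := by rw [← inter_iUnion, inter_eq_left.2 h3]
    have hdisj : Pairwise (Function.onFun Disjoint fun n => s ∩ t n) := fun i j hij =>
      (h1 hij).mono inter_subset_right inter_subset_right
    have hm : ∀ n, MeasurableSet (s ∩ t n) := fun n => hs.inter (h2 n)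
    have hcast : (1 + δ : ENNReal) = ENNReal.ofReal (1 + δ) := by
      rw [ENNReal.ofReal_add zero_le_one NNReal.zero_le_coe]; simp
    have e1 : μHE[2] (graphMap q γ '' s) = ∑' n, μHE[2] (graphMap q γ '' (s ∩ t n)) := by
      conv_lhs => rw [hsu, image_iUnion]
      refine measure_iUnion (fun i j hij => ?_) fun n => hemb.measurableSet_image.2 (hm n)
      exact disjoint_image_of_injective (graphMap_injective q γ) (hdisj hij)
    have e2 : ∫⁻ y in s, ENNReal.ofReal (graphJac (fderiv ℝ γ y)) =
        ∑' n, ∫⁻ y in s ∩ t n, ENNReal.ofReal (graphJac (fderiv ℝ γ y)) := by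
      conv_lhs => rw [hsu]
      exact lintegral_iUnion hm hdisj _
    rw [e1, e2, ← ENNReal.tsum_mul_left, ← ENNReal.tsum_mul_left]
    have piece : ∀ n, ENNReal.ofReal (graphJac (l n)) * volume (s ∩ t n) ≤
          (1 + δ) * ∫⁻ y in s ∩ t n, ENNReal.ofReal (graphJac (fderiv ℝ γ y)) ∧
        ∫⁻ y in s ∩ t n, ENNReal.ofReal (graphJac (fderiv ℝ γ y)) ≤
          (1 + δ) * (ENNReal.ofReal (graphJac (l n)) * volume (s ∩ t n)) := by
      intro n
      have hδ0 : (0 : ℝ) ≤ δ := δ.2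
      have hc : ∫⁻ _ in s ∩ t n, ENNReal.ofReal (graphJac (l n)) =
          ENNReal.ofReal (graphJac (l n)) * volume (s ∩ t n) := by
        rw [setLIntegral_const]
      rw [← hc, ← lintegral_const_mul' _ _ (by simp), ← lintegral_const_mul' _ _ (by simp)]
      constructor
      · refine lintegral_mono_ae ?_
        filter_upwards [h5 n] with x hx
        rw [hcast, ← ENNReal.ofReal_mul (by positivity)]
        refine ENNReal.ofReal_le_ofReal ?_
        have := graphJac_le_add (l n) (fderiv ℝ γ x)
        rw [norm_sub_rev] at this
        nlinarith [one_le_graphJac (fderiv ℝ γ x)]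
      · refine lintegral_mono_ae ?_
        filter_upwards [h5 n] with x hx
        rw [hcast, ← ENNReal.ofReal_mul (by positivity)]
        refine ENNReal.ofReal_le_ofReal ?_
        have := graphJac_le_add (fderiv ℝ γ x) (l n)
        nlinarith [one_le_graphJac (l n)]
    constructor
    · refine ENNReal.tsum_le_tsum fun n => ?_
      refine (graphMap_area_le_of_approximatesLinearOn q (h4 n)).1.trans ?_
      rw [pow_succ _ 2, mul_assoc]
      exact mul_le_mul_right (piece n).1 _
    · refine ENNReal.tsum_le_tsum fun n => ?_
      refine (piece n).2.trans ?_
      rw [pow_succ' _ 2, mul_assoc]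
      exact mul_le_mul_right (graphMap_area_le_of_approximatesLinearOn q (h4 n)).2 _
  have lim : ∀ a b : ENNReal, (∀ δ : NNReal, δ ≠ 0 → a ≤ (1 + δ : ENNReal) ^ 3 * b) → a ≤ b := by
    intro a b h
    have ht : Tendsto (fun n : ℕ => (1 + ((1 / (n + 1 : NNReal) : NNReal) : ENNReal)) ^ 3 * b)
        atTop (𝓝 ((1 + ((0 : NNReal) : ENNReal)) ^ 3 * b)) := by
      refine ENNReal.Tendsto.mul_const ?_ (by simp)
      refine ENNReal.Tendsto.pow (tendsto_const_nhds.add ?_)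
      rw [ENNReal.tendsto_coe]
      exact tendsto_one_div_add_atTop_nhds_zero_nat
    simp only [ENNReal.coe_zero, add_zero, one_pow, one_mul] at ht
    exact ge_of_tendsto' ht fun n => h _ (by positivity)
  exact le_antisymm (lim _ _ fun δ hδ => (key δ hδ).1) (lim _ _ fun δ hδ => (key δ hδ).2)

theorem graphMap_area_eq_zero {γ : Plane → ℝ} {K : NNReal} (hγ : LipschitzWith K γ) {s : Set Plane}
    (hs : volume s = 0) : μHE[2] (graphMap q γ '' s) = 0 := by
  have h := (graphMap_area_le_of_approximatesLinearOn q (γ := γ) (l := 0) (s := s) (δ := K)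
    (fun x _ y _ => by simpa [Real.dist_eq, dist_eq_norm] using hγ.dist_le_mul x y)).1
  simpa [hs] using h

/-- The area formula for the graph of a Lipschitz function. -/
theorem graphMap_area_eq {γ : Plane → ℝ} {K : NNReal} (hγ : LipschitzWith K γ) {s : Set Plane}
    (hs : MeasurableSet s) :
    μHE[2] (graphMap q γ '' s) = ∫⁻ y in s, ENNReal.ofReal (graphJac (fderiv ℝ γ y)) := by
  -- Rademacher: the points of non-differentiability are a null set, and a Lipschitz graph over a
  -- null set has zero area.
  let D : Set Plane := {y | DifferentiableAt ℝ γ y}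
  have hD : MeasurableSet D := measurableSet_of_differentiableAt ℝ γ
  have hDc : volume Dᶜ = 0 := hγ.ae_differentiableAt (μ := volume)
  have hae : (s ∩ D : Set Plane) =ᵐ[volume] s := by
    filter_upwards [hγ.ae_differentiableAt (μ := volume)] with x hx
    exact propext ⟨fun h => h.1, fun h => ⟨h, hx⟩⟩
  rw [← setLIntegral_congr hae, ← graphMap_area_eq_of_differentiable q hγ.continuous (hs.inter hD)
    (fun x hx => hx.2)]
  refine le_antisymm ?_ (measure_mono (image_mono inter_subset_left))
  calc μHE[2] (graphMap q γ '' s) ≤ μHE[2] (graphMap q γ '' (s ∩ D) ∪ graphMap q γ '' Dᶜ) := by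
        refine measure_mono ?_
        rw [← image_union]
        refine image_mono fun x hx => ?_
        by_cases h : x ∈ D
        · exact Or.inl ⟨hx, h⟩
        · exact Or.inr h
    _ ≤ _ := (measure_union_le _ _).trans (by rw [graphMap_area_eq_zero q hγ hDc, add_zero])

/-- The area formula as an identity of measures, which turns surface integrals over a graph into
integrals over the plane. -/
theorem restrict_range_graphMap {γ : Plane → ℝ} {K : NNReal} (hγ : LipschitzWith K γ) :
    (μHE[2] : Measure V).restrict (range (graphMap q γ)) =
      (volume.withDensity fun y => ENNReal.ofReal (graphJac (fderiv ℝ γ y))).map (graphMap q γ) := by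
  have hemb := (isClosedEmbedding_graphMap q hγ.continuous).measurableEmbedding
  ext s hs
  rw [hemb.map_apply, Measure.restrict_apply hs, withDensity_apply _ (hemb.measurable hs),
    ← graphMap_area_eq q hγ (hemb.measurable hs), image_preimage_eq_inter_range]

end Graph

end Poro

namespace Poro

/-! ### The divergence theorem below the graph of a Lipschitz function -/

section Subgraph

variable {V : Type*} [NormedAddCommGroup V] [InnerProductSpace ℝ V]
  (q : V ≃ₗᵢ[ℝ] WithLp 2 (Plane × ℝ))

/-- The point with Cartesian coordinates `(y, s)`. -/
noncomputable def cart (z : Plane × ℝ) : V := q.symm (WithLp.toLp 2 z)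

/-- The region below the graph of `γ`. -/
def subgraph (γ : Plane → ℝ) : Set V := {x | (q x).snd < γ (q x).fst}

@[fun_prop]
theorem continuous_cart : Continuous (cart q) :=
  q.symm.continuous.comp (WithLp.prod_continuous_toLp 2 Plane ℝ)

theorem continuous_coord_fst : Continuous fun x : V => (q x).fst :=
  (WithLp.prod_continuous_ofLp 2 Plane ℝ).fst.comp q.continuous

theorem continuous_coord_snd : Continuous fun x : V => (q x).snd :=
  (WithLp.prod_continuous_ofLp 2 Plane ℝ).snd.comp q.continuous

theorem isOpen_subgraph {γ : Plane → ℝ} (hγ : Continuous γ) : IsOpen (subgraph q γ) :=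
  isOpen_lt (continuous_coord_snd q) (hγ.comp (continuous_coord_fst q))

theorem norm_coord_fst_le (x : V) : ‖(q x).fst‖ ≤ ‖x‖ := by
  refine le_of_sq_le_sq ?_ (norm_nonneg _)
  rw [← q.norm_map x, WithLp.prod_norm_sq_eq_of_L2]
  nlinarith [sq_nonneg ‖(q x).snd‖]

theorem abs_coord_snd_le (x : V) : |(q x).snd| ≤ ‖x‖ := by
  refine le_of_sq_le_sq ?_ (norm_nonneg _)
  rw [← q.norm_map x, WithLp.prod_norm_sq_eq_of_L2, Real.norm_eq_abs]
  nlinarith [sq_nonneg ‖(q x).fst‖]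

theorem hasCompactSupport_comp_cart {φ : V → ℝ} (hc : HasCompactSupport φ) (y : Plane) :
    HasCompactSupport fun s => φ (cart q (y, s)) := by
  refine hc.comp_isClosedEmbedding (g := fun s => cart q (y, s)) ?_
  have hl : Function.LeftInverse (fun x => (q x).snd) (fun s => cart q (y, s)) := fun s => by
    simp [cart]
  exact hl.isClosedEmbedding (continuous_coord_snd q) (by fun_prop)

/-- The region below the graph, translated by `h u`, lies below the graph of `y ↦ γ (y - h u') + h
u₃`. The bound on the variation of this height in `h` is the domination needed to differentiate in
`h`. -/
theorem lipschitzWith_translate {γ : Plane → ℝ} {K : NNReal} (hγ : LipschitzWith K γ) (y : Plane)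
    (u : V) (h h' : ℝ) :
    |γ (y - h • (q u).fst) + h * (q u).snd - (γ (y - h' • (q u).fst) + h' * (q u).snd)| ≤
      (K + 1) * ‖u‖ * |h - h'| := by
  have h1 := hγ.dist_le_mul (y - h • (q u).fst) (y - h' • (q u).fst)
  rw [Real.dist_eq, dist_eq_norm] at h1
  have h2 : y - h • (q u).fst - (y - h' • (q u).fst) = (h' - h) • (q u).fst := by module
  rw [h2, norm_smul, Real.norm_eq_abs, abs_sub_comm h' h] at h1
  have h3 : γ (y - h • (q u).fst) + h * (q u).snd - (γ (y - h' • (q u).fst) + h' * (q u).snd)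
    = (γ (y - h • (q u).fst) - γ (y - h' • (q u).fst)) + (h - h') * (q u).snd := by ring
  rw [h3]
  refine (abs_add_le _ _).trans ?_
  rw [abs_mul]
  have h4 := norm_coord_fst_le q u
  have h5 := abs_coord_snd_le q u
  have hK : (0:ℝ) ≤ K := K.2
  calc _ ≤ K * (|h - h'| * ‖u‖) + |h - h'| * ‖u‖ := by
        gcongr
        exact h1.trans (by gcongr)
    _ = _ := by ring

theorem integral_Iic_cart_sub {φ : V → ℝ} (hφ : Continuous φ) (hc : HasCompactSupport φ)
    (y : Plane) (a b : ℝ) :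
    (∫ s in Iic b, φ (cart q (y, s))) - ∫ s in Iic a, φ (cart q (y, s)) =
      ∫ s in a..b, φ (cart q (y, s)) := by
  have : Integrable fun s => φ (cart q (y, s)) :=
    (hφ.comp (by fun_prop : Continuous fun s : ℝ => cart q (y, s))).integrable_of_hasCompactSupport
      (hasCompactSupport_comp_cart q hc y)
  exact intervalIntegral.integral_Iic_sub_Iic this.integrableOn this.integrableOn

variable [MeasurableSpace V] [BorelSpace V] [FiniteDimensional ℝ V]

theorem measurePreserving_cart : MeasurePreserving (cart q) volume volume :=
  q.symm.measurePreserving.comp (WithLp.volume_preserving_toLp Plane ℝ)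

theorem hasDerivAt_setIntegral_translate {φ : V → ℝ} (hφ : ContDiff ℝ 1 φ)
    (hc : HasCompactSupport φ) (D : Set V) (u : V) :
    HasDerivAt (fun h : ℝ => ∫ x in D, φ (x + h • u)) (∫ x in D, fderiv ℝ φ x u) 0 := by
  obtain ⟨C, hC⟩ := hc.fderiv (𝕜 := ℝ) |>.exists_bound_of_continuous (hφ.continuous_fderiv one_ne_zero)
  have hC0 : 0 ≤ C := (norm_nonneg _).trans (hC 0)
  -- For `|h| < 1`, a point `x` with `x + h u` in the support of `φ` lies within `‖u‖` of that
  -- support; this compact set carries the dominating function.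
  let K := Metric.cthickening ‖u‖ (tsupport φ)
  have hK : IsCompact K := IsCompact.cthickening hc
  have hder : ∀ x h, HasDerivAt (fun h : ℝ => φ (x + h • u)) (fderiv ℝ φ (x + h • u) u) h := by
    intro x h
    have h1 : HasDerivAt (fun h : ℝ => x + h • u) u h := by
      simpa using ((hasDerivAt_id h).smul_const u).const_add x
    exact ((hφ.differentiable one_ne_zero).differentiableAt.hasFDerivAt).comp_hasDerivAt h h1
  have := (hasDerivAt_integral_of_dominated_loc_of_deriv_le (μ := volume.restrict D)
    (F := fun (h : ℝ) x => φ (x + h • u)) (F' := fun h x => fderiv ℝ φ (x + h • u) u)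
    (bound := K.indicator fun _ => C * ‖u‖) (x₀ := 0) (Metric.ball_mem_nhds (0:ℝ) one_pos)
    (Eventually.of_forall fun h => ?_) ?_ ?_ ?_ ?_ ?_).2
  · simpa using this
  · exact (hφ.continuous.comp (by fun_prop : Continuous fun x => x + h • u)).aestronglyMeasurable
  · simpa using (hφ.continuous.integrable_of_hasCompactSupport hc).restrict
  · have : Continuous fun x => fderiv ℝ φ (x + (0:ℝ) • u) u := by
      have := hφ.continuous_fderiv one_ne_zero
      fun_prop
    exact this.aestronglyMeasurable
  · refine Eventually.of_forall fun x h hh => ?_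
    by_cases hx : x ∈ K
    · rw [indicator_of_mem hx]
      exact (ContinuousLinearMap.le_opNorm _ _).trans (by gcongr; exact hC _)
    · rw [indicator_of_notMem hx]
      have : x + h • u ∉ tsupport φ := fun hm => hx <| by
        refine Metric.mem_cthickening_of_dist_le _ _ _ _ hm ?_
        rw [dist_eq_norm]
        simp only [sub_add_cancel_left, norm_neg, norm_smul]
        have : ‖h‖ < 1 := by simpa using hh
        nlinarith [norm_nonneg u]
      have h0 : fderiv ℝ φ (x + h • u) = 0 :=
        image_eq_zero_of_notMem_tsupport fun h => this (tsupport_fderiv_subset ℝ h)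
      simp [h0]
  · exact ((integrable_indicator_iff hK.measurableSet).2
      (integrableOn_const hK.measure_lt_top.ne)).restrict
  · exact Eventually.of_forall fun x h _ => hder x h

/-- The change of variable `x ↦ x - h u` moves the translation from `φ` to the region, which stays a
subgraph; Fubini in Cartesian coordinates then leaves only the height depending on `h`. -/
theorem setIntegral_subgraph_translate {φ : V → ℝ} (hφ : Continuous φ)
    (hc : HasCompactSupport φ) {γ : Plane → ℝ} (hγ : Continuous γ) (u : V) (h : ℝ) :
    Integrable (fun y : Plane => ∫ s in Iic (γ (y - h • (q u).fst) + h * (q u).snd), φ (cart q (y, s)))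
      ∧ ∫ x in subgraph q γ, φ (x + h • u) =
      ∫ y : Plane, ∫ s in Iic (γ (y - h • (q u).fst) + h * (q u).snd), φ (cart q (y, s)) := by
  have hD := (isOpen_subgraph q hγ).measurableSet
  let f : V → ℝ := fun x => (subgraph q γ).indicator (fun _ => φ x) (x - h • u)
  have hf : f = ((fun x => x - h • u) ⁻¹' subgraph q γ).indicator φ := by
    rfl
  have hfi : Integrable f := by
    rw [hf]
    exact (hφ.integrable_of_hasCompactSupport hc).indicator
      (hD.preimage (by fun_prop : Continuous fun x : V => x - h • u).measurable)
  have e1 : ∫ x in subgraph q γ, φ (x + h • u) = ∫ x, f x := by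
    rw [← integral_indicator hD, ← integral_add_right_eq_self f (h • u)]
    simp only [f, add_sub_cancel_right]
    rfl
  have hmp := measurePreserving_cart q
  have hfc : Integrable (f ∘ cart q) (volume.prod volume) :=
    hmp.integrable_comp_of_integrable hfi
  have hemb : MeasurableEmbedding (cart q) :=
    (q.symm.toHomeomorph.measurableEmbedding).comp
      (MeasurableEquiv.toLp 2 (Plane × ℝ)).measurableEmbedding
  have e3 : ∀ y, ∫ s, (f ∘ cart q) (y, s) =
      ∫ s in Iic (γ (y - h • (q u).fst) + h * (q u).snd), φ (cart q (y, s)) := by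
    intro y
    rw [integral_Iic_eq_integral_Iio, ← integral_indicator measurableSet_Iio]
    congr 1
    ext s
    have : cart q (y, s) - h • u ∈ subgraph q γ ↔ s ∈ Iio (γ (y - h • (q u).fst) + h * (q u).snd) := by
      simp [subgraph, cart, sub_lt_iff_lt_add]
    simp only [f, Function.comp, indicator, this]
  have := hfc.integral_prod_left
  simp only [e3] at this
  refine ⟨this, ?_⟩
  rw [e1, ← hmp.integral_comp hemb f]
  change ∫ z, (f ∘ cart q) z ∂(volume.prod volume) = _
  rw [integral_prod _ hfc]
  simp only [e3]

/-- The divergence theorem below the graph of a Lipschitz function. -/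
theorem setIntegral_subgraph_fderiv {φ : V → ℝ} (hφ : ContDiff ℝ 1 φ)
    (hc : HasCompactSupport φ) {γ : Plane → ℝ} {K : NNReal} (hγ : LipschitzWith K γ) (u : V) :
    ∫ x in subgraph q γ, fderiv ℝ φ x u =
      ∫ y : Plane, φ (graphMap q γ y) * ((q u).snd - fderiv ℝ γ y (q u).fst) := by
  -- `∫ φ (x + h u)` over the subgraph is differentiated at `h = 0` in two ways: under the integral
  -- sign, which gives the left-hand side, and through the moving upper limit of the vertical
  -- integrals, which gives the right-hand side.
  have hl := hasDerivAt_setIntegral_translate hφ hc (subgraph q γ) u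
  simp only [(setIntegral_subgraph_translate q hφ.continuous hc hγ.continuous u _).2] at hl
  refine hl.unique ?_
  obtain ⟨C, hC⟩ := hc.exists_bound_of_continuous hφ.continuous
  have hC0 : 0 ≤ C := (norm_nonneg _).trans (hC 0)
  let Y : Set Plane := (fun x : V => (q x).fst) '' tsupport φ
  have hY : IsCompact Y := IsCompact.image hc (continuous_coord_fst q)
  have hφY : ∀ y ∉ Y, ∀ s, φ (cart q (y, s)) = 0 := fun y hy s =>
    image_eq_zero_of_notMem_tsupport fun h => hy ⟨_, h, by simp [cart]⟩
  set z : ℝ → Plane → ℝ := fun h y => γ (y - h • (q u).fst) + h * (q u).snd with hz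
  have hmeas : AEStronglyMeasurable
      (fun y => φ (graphMap q γ y) * ((q u).snd - fderiv ℝ γ y (q u).fst)) volume := by
    refine ((hφ.continuous.comp (continuous_graphMap q hγ.continuous)).measurable.mul
      (measurable_const.sub ?_)).aestronglyMeasurable
    exact measurable_fderiv_apply_const ℝ γ _
  -- The version with a Lipschitz bound is needed: `γ` is differentiable only almost everywhere, so
  -- for a given `y` the height is known to be differentiable in `h` only at `h = 0`.
  refine (hasDerivAt_integral_of_dominated_loc_of_lip (x₀ := (0:ℝ))
    (F := fun h y => ∫ s in Iic (z h y), φ (cart q (y, s)))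
    (bound := Y.indicator fun _ => C * ((K + 1) * ‖u‖)) univ_mem
    (Eventually.of_forall fun h => (setIntegral_subgraph_translate q hφ.continuous hc
      hγ.continuous u h).1.aestronglyMeasurable)
    (setIntegral_subgraph_translate q hφ.continuous hc hγ.continuous u 0).1 hmeas
    (Eventually.of_forall fun y => ?_) ?_ ?_).2
  · refine LipschitzOnWith.of_dist_le_mul fun h _ h' _ => ?_
    rw [Real.dist_eq, integral_Iic_cart_sub q hφ.continuous hc, Real.coe_nnabs]
    by_cases hy : y ∈ Y
    · rw [indicator_of_mem hy, ← Real.norm_eq_abs]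
      refine (intervalIntegral.norm_integral_le_of_norm_le_const fun s _ => hC _).trans ?_
      have hK : (0:ℝ) ≤ K := K.2
      rw [abs_of_nonneg (show 0 ≤ C * ((K + 1) * ‖u‖) by positivity), mul_assoc C]
      gcongr
      exact lipschitzWith_translate q hγ y u h h'
    · simp only [hφY y hy, intervalIntegral.integral_zero, abs_zero]
      positivity
  · exact (integrable_indicator_iff hY.measurableSet).2 (integrableOn_const hY.measure_lt_top.ne)
  · filter_upwards [hγ.ae_differentiableAt (μ := volume)] with y hy
    have h1 : HasDerivAt (fun h : ℝ => z h y) ((q u).snd - fderiv ℝ γ y (q u).fst) 0 := by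
      have h2 : HasDerivAt (fun h : ℝ => y - h • (q u).fst) (-(q u).fst) 0 := by
        simpa using ((hasDerivAt_id (0:ℝ)).smul_const (q u).fst).const_sub y
      have h3 : HasFDerivAt γ (fderiv ℝ γ y) (y - (0:ℝ) • (q u).fst) := by
        simpa using hy.hasFDerivAt
      have h4 := (h3.comp_hasDerivAt (0:ℝ) h2).add ((hasDerivAt_id (0:ℝ)).mul_const (q u).snd)
      refine h4.congr_deriv ?_
      rw [map_neg]; ring
    have h5 : Continuous fun s : ℝ => φ (cart q (y, s)) :=
      hφ.continuous.comp (by fun_prop)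
    have h6 : HasDerivAt (fun r => ∫ s in Iic r, φ (cart q (y, s))) (φ (graphMap q γ y)) (z 0 y) := by
      have h7 := (h5.integral_hasStrictDerivAt 0 (z 0 y)).hasDerivAt
      have h8 : (fun r => ∫ s in Iic r, φ (cart q (y, s))) = fun r =>
          (∫ s in Iic (0:ℝ), φ (cart q (y, s))) + ∫ s in (0:ℝ)..r, φ (cart q (y, s)) := by
        ext r
        rw [← integral_Iic_cart_sub q hφ.continuous hc]; ring
      rw [h8]
      have h9 : cart q (y, z 0 y) = graphMap q γ y := by simp [cart, graphMap, z]
      rw [h9] at h7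
      exact h7.const_add _
    exact h6.comp (0:ℝ) h1

end Subgraph

end Poro

namespace Poro

/-! ### Outward normals and the local divergence theorem -/

/-- With `v = n₂ - n₁` and `c = 1 - n₁ · n₂ > 0` one has `v · n₂ = c` and `v · n₁ = -c`. For small
`s > 0` the point `x + s v` can neither belong to the set, because of `n₂`, nor lie outside it,
because of `n₁`. -/
theorem IsOuterNormal.unique {D : Set E} {x n₁ n₂ : E} (h₁ : IsOuterNormal D x n₁)
    (h₂ : IsOuterNormal D x n₂) : n₁ = n₂ := by
  by_contra hne
  set v := n₂ - n₁ with hv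
  set c := 1 - inner ℝ n₁ n₂ with hc
  have hvn : 0 < ‖v‖ := norm_pos_iff.2 (sub_ne_zero.2 (Ne.symm hne))
  have h11 : inner ℝ n₁ n₁ = (1:ℝ) := by rw [real_inner_self_eq_norm_sq, h₁.1]; norm_num
  have h22 : inner ℝ n₂ n₂ = (1:ℝ) := by rw [real_inner_self_eq_norm_sq, h₂.1]; norm_num
  have hv1 : inner ℝ v n₁ = -c := by
    rw [hv, inner_sub_left, h11, real_inner_comm, hc]; ring
  have hv2 : inner ℝ v n₂ = c := by
    rw [hv, inner_sub_left, h22, hc]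
  have hcpos : 0 < c := by
    have : ‖v‖ ^ 2 = 2 * c := by
      rw [← real_inner_self_eq_norm_sq]
      conv_lhs => rw [hv, inner_sub_right, ← hv, hv1, hv2]
      ring
    nlinarith [sq_pos_of_pos hvn]
  have hε : 0 < c / (2 * ‖v‖) := by positivity
  have ht : Tendsto (fun s : ℝ => x + s • v) (𝓝[>] 0) (𝓝 x) := by
    have : Continuous fun s : ℝ => x + s • v := by fun_prop
    have := this.tendsto 0
    simp only [zero_smul, add_zero] at this
    exact this.mono_left nhdsWithin_le_nhds
  obtain ⟨s, ⟨hs1, hs2⟩, hs⟩ := ((ht.eventually ((h₁.2 _ hε).and (h₂.2 _ hε))).and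
    self_mem_nhdsWithin).exists
  have hs : 0 < s := hs
  have hn : c / (2 * ‖v‖) * ‖x + s • v - x‖ = s * (c / 2) := by
    rw [add_sub_cancel_left, norm_smul, Real.norm_of_nonneg hs.le]
    field_simp
  rw [hn] at hs1 hs2
  have hc2 : 0 < s * c := by positivity
  by_cases hm : x + s • v ∈ D
  · have := hs2.1 hm
    rw [add_sub_cancel_left, inner_smul_left, hv2] at this
    simp at this
    nlinarith
  · have := hs1.2 hm
    rw [add_sub_cancel_left, inner_smul_left, hv1] at this
    simp at this
    nlinarith

theorem outerNormal_eq {D : Set E} {x n : E} (h : IsOuterNormal D x n) : outerNormal D x = n :=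
  (Classical.epsilon_spec (⟨n, h⟩ : ∃ n, IsOuterNormal D x n)).unique h

theorem IsOuterNormal.congr {D D' : Set E} {x n : E} (h : IsOuterNormal D x n)
    (hD : ∀ᶠ y in 𝓝 x, y ∈ D' ↔ y ∈ D) : IsOuterNormal D' x n := by
  refine ⟨h.1, fun ε hε => ?_⟩
  filter_upwards [h.2 ε hε, hD] with y hy hD
  rwa [hD]

section SubgraphNormal

variable (q : E ≃ₗᵢ[ℝ] WithLp 2 (Plane × ℝ))

/-- The unit normal of a graph with slope `l`, pointing upwards. -/
noncomputable def graphNormal (l : Plane →L[ℝ] ℝ) : E :=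
  (graphJac l)⁻¹ • cart q (-(InnerProductSpace.toDual ℝ Plane).symm l, 1)

theorem inner_cart (z : Plane × ℝ) (v : E) :
    inner ℝ (cart q z) v = inner ℝ z.1 (q v).fst + z.2 * (q v).snd := by
  rw [cart, ← q.inner_map_map, LinearIsometryEquiv.apply_symm_apply, WithLp.prod_inner_apply]
  simp [mul_comm]

theorem inner_graphNormal (l : Plane →L[ℝ] ℝ) (v : E) :
    inner ℝ (graphNormal q l) v = (graphJac l)⁻¹ * ((q v).snd - l (q v).fst) := by
  rw [graphNormal, inner_smul_left, inner_cart]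
  simp [inner_neg_left]
  left; ring

theorem norm_graphNormal (l : Plane →L[ℝ] ℝ) : ‖graphNormal q l‖ = 1 := by
  have h1 : ‖cart q (-(InnerProductSpace.toDual ℝ Plane).symm l, 1)‖ = graphJac l := by
    rw [cart, LinearIsometryEquiv.norm_map, WithLp.prod_norm_eq_of_L2, graphJac]
    simp [add_comm]
  have := one_le_graphJac l
  rw [graphNormal, norm_smul, h1, norm_inv, Real.norm_of_nonneg (by linarith)]
  exact inv_mul_cancel₀ (by linarith)

theorem continuous_graphNormal : Continuous (graphNormal q) := by
  unfold graphNormal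
  refine Continuous.smul (continuous_graphJac.inv₀ fun l => ?_) ?_
  · linarith [one_le_graphJac l]
  · exact (continuous_cart q).comp (Continuous.prodMk (by fun_prop) continuous_const)

/-- The signed distance to the tangent plane differs from `(q z).snd - γ (q z).fst`, up to the
factor `(graphJac l)⁻¹ ≤ 1`, only by the error of linearizing `γ`, which is at most `ε ‖z - x‖` near
`x`. -/
theorem isOuterNormal_subgraph {γ : Plane → ℝ} {y : Plane} (hγ : DifferentiableAt ℝ γ y) :
    IsOuterNormal (subgraph q γ) (graphMap q γ y) (graphNormal q (fderiv ℝ γ y)) := by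
  refine ⟨norm_graphNormal q _, fun ε hε => ?_⟩
  set l := fderiv ℝ γ y
  set x := graphMap q γ y with hx
  have hJ := one_le_graphJac l
  have hqx : q x = WithLp.toLp 2 (y, γ y) := by simp [hx, graphMap]
  have ht : Tendsto (fun z : E => (q z).fst) (𝓝 x) (𝓝 y) := by
    have := (continuous_coord_fst q).tendsto x
    rwa [hqx] at this
  filter_upwards [ht.eventually (hγ.hasFDerivAt.isLittleO.def hε)] with z hz
  have h1 : inner ℝ (z - x) (graphNormal q l) =
      (graphJac l)⁻¹ * ((q z).snd - γ y - l ((q z).fst - y)) := by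
    rw [real_inner_comm, inner_graphNormal, map_sub, hqx]
    simp
  have h2 : ‖(q z).fst - y‖ ≤ ‖z - x‖ := by
    have := norm_coord_fst_le q (z - x)
    rwa [map_sub, hqx] at this
  have h3 : |γ (q z).fst - γ y - l ((q z).fst - y)| ≤ ε * ‖z - x‖ := by
    rw [← Real.norm_eq_abs]
    exact hz.trans (by gcongr)
  have h4 : 0 ≤ ε * ‖z - x‖ := by positivity
  have h5 : 0 < (graphJac l)⁻¹ := by positivity
  have h6 : (graphJac l)⁻¹ ≤ 1 := inv_le_one_of_one_le₀ hJ
  rw [abs_le] at h3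
  rw [h1]
  constructor
  · intro hm
    have hm : (q z).snd < γ (q z).fst := hm
    nlinarith
  · intro hm
    have hm : ¬ (q z).snd < γ (q z).fst := hm
    nlinarith

theorem frontier_subgraph {γ : Plane → ℝ} (hγ : Continuous γ) :
    frontier (subgraph q γ) = range (graphMap q γ) := by
  have hr : range (graphMap q γ) = {x | (q x).snd = γ (q x).fst} := by
    ext x
    constructor
    · rintro ⟨y, rfl⟩; simp [graphMap]
    · intro h
      refine ⟨(q x).fst, ?_⟩
      rw [graphMap, ← h.out]
      exact q.symm_apply_apply x
  rw [hr]
  apply Subset.antisymm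
  · exact frontier_lt_subset_eq (continuous_coord_snd q) (hγ.comp (continuous_coord_fst q))
  · intro x hx
    rw [frontier, (isOpen_subgraph q hγ).interior_eq]
    refine ⟨?_, fun h => (ne_of_lt h) hx⟩
    have ht : Tendsto (fun s : ℝ => cart q ((q x).fst, (q x).snd - s)) (𝓝[>] 0) (𝓝 x) := by
      have hc : Continuous fun s : ℝ => cart q ((q x).fst, (q x).snd - s) := by fun_prop
      have := (hc.tendsto 0).mono_left (nhdsWithin_le_nhds (s := Ioi 0))
      simp only [sub_zero] at this
      convert this using 2
      exact (q.symm_apply_apply x).symm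
    refine mem_closure_of_tendsto ht ?_
    filter_upwards [self_mem_nhdsWithin] with s hs
    have hs : 0 < s := hs
    have : (q x).snd = γ (q x).fst := hx
    simp [subgraph, cart, ← this, hs]

end SubgraphNormal

/-- Near `x₀`, the set `D` is the region below the graph of a Lipschitz function. -/
def IsSubgraphNear (D : Set E) (x₀ : E) : Prop :=
  ∃ (q : E ≃ₗᵢ[ℝ] WithLp 2 (Plane × ℝ)) (γ : Plane → ℝ) (K : NNReal), LipschitzWith K γ ∧
    ∀ᶠ x in 𝓝 x₀, x ∈ D ↔ x ∈ subgraph q γ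

/-- The open set `U` is such that `D` has a boundary of finite area and an outward normal at almost
every boundary point in `U`, and satisfies the divergence theorem for functions supported in `U`. -/
structure IsGaussNhd (D U : Set E) : Prop where
  isOpen : IsOpen U
  area_lt : area (frontier D ∩ U) < ⊤
  normal : ∀ᵐ x ∂area.restrict (frontier D ∩ U), IsOuterNormal D x (outerNormal D x)
  meas : AEStronglyMeasurable (outerNormal D) (area.restrict (frontier D ∩ U))
  gauss : ∀ φ : E → ℝ, ContDiff ℝ 1 φ → HasCompactSupport φ → tsupport φ ⊆ U → ∀ u : E,
    ∫ x in D, fderiv ℝ φ x u = ∫ x in frontier D, φ x * inner ℝ (outerNormal D x) u ∂area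

theorem frontier_inter_eq_of_inter_eq {X : Type*} [TopologicalSpace X] {D D' U : Set X}
    (hU : IsOpen U) (h : D ∩ U = D' ∩ U) : frontier D ∩ U = frontier D' ∩ U := by
  rw [← frontier_inter_open_inter hU, h, frontier_inter_open_inter hU]

/-- Null sets of the plane have graphs of zero area, so almost-everywhere properties, such as
differentiability of `γ`, pass to the boundary. -/
theorem ae_restrict_range_graphMap (q : E ≃ₗᵢ[ℝ] WithLp 2 (Plane × ℝ)) {γ : Plane → ℝ}
    {K : NNReal} (hγ : LipschitzWith K γ) {p : Plane → Prop} (hp : ∀ᵐ y, p y) :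
    ∀ᵐ x ∂area.restrict (range (graphMap q γ)), p (q x).fst ∧ x = graphMap q γ (q x).fst := by
  have hm : MeasurableSet (range (graphMap q γ)) :=
    (isClosedEmbedding_graphMap q hγ.continuous).isClosed_range.measurableSet
  rw [ae_restrict_iff' hm]
  have h0 : area (graphMap q γ '' {y | ¬ p y}) = 0 := graphMap_area_eq_zero q hγ hp
  filter_upwards [measure_eq_zero_iff_ae_notMem.1 h0] with x hx hxr
  obtain ⟨y, rfl⟩ := hxr
  have hy : (q (graphMap q γ y)).fst = y := by simp [graphMap]
  rw [hy]
  refine ⟨?_, rfl⟩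
  by_contra hn
  exact hx ⟨y, hn, rfl⟩

theorem setIntegral_range_graphMap (q : E ≃ₗᵢ[ℝ] WithLp 2 (Plane × ℝ)) {γ : Plane → ℝ}
    {K : NNReal} (hγ : LipschitzWith K γ) (f : E → ℝ) :
    ∫ x in range (graphMap q γ), f x ∂area =
      ∫ y, graphJac (fderiv ℝ γ y) * f (graphMap q γ y) := by
  have hemb := (isClosedEmbedding_graphMap q hγ.continuous).measurableEmbedding
  have hjm : Measurable fun y => graphJac (fderiv ℝ γ y) :=
    continuous_graphJac.measurable.comp (measurable_fderiv ℝ γ)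
  rw [area, restrict_range_graphMap q hγ, hemb.integral_map,
    integral_withDensity_eq_integral_toReal_smul (by fun_prop) (by simp)]
  refine integral_congr_ae (Eventually.of_forall fun y => ?_)
  have := one_le_graphJac (fderiv ℝ γ y)
  simp only [smul_eq_mul]
  rw [ENNReal.toReal_ofReal (by linarith)]

theorem area_graphMap_inter_ball_lt (q : E ≃ₗᵢ[ℝ] WithLp 2 (Plane × ℝ)) {γ : Plane → ℝ}
    {K : NNReal} (hγ : LipschitzWith K γ) (x₀ : E) (r : ℝ) :
    area (range (graphMap q γ) ∩ Metric.ball x₀ r) < ⊤ := by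
  let s : Set Plane := Metric.closedBall (q x₀).fst r
  have h1 : range (graphMap q γ) ∩ Metric.ball x₀ r ⊆ graphMap q γ '' s := by
    rintro _ ⟨⟨y, rfl⟩, hy⟩
    refine ⟨y, ?_, rfl⟩
    rw [Metric.mem_ball, dist_eq_norm] at hy
    have := norm_coord_fst_le q (graphMap q γ y - x₀)
    rw [map_sub] at this
    rw [Metric.mem_closedBall, dist_eq_norm]
    refine le_trans (le_of_eq ?_) (this.trans hy.le)
    simp [graphMap]
  refine (measure_mono h1).trans_lt ?_
  have h := (graphMap_area_le_of_approximatesLinearOn q (γ := γ) (l := 0) (s := s) (δ := K)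
    (fun x _ y _ => by simpa [Real.dist_eq, dist_eq_norm] using hγ.dist_le_mul x y)).1
  refine h.trans_lt ?_
  refine ENNReal.mul_lt_top (by finiteness) (ENNReal.mul_lt_top (by finiteness) ?_)
  exact (isCompact_closedBall _ _).measure_lt_top

/-- In a ball where the set is a subgraph, both sides of the divergence theorem depend only on the
set in that ball. The factor `u₃ - γ'(u')` from the subgraph case is the area density times the
normal component of `u`, by `inner_graphNormal`. -/
theorem IsSubgraphNear.exists_isGaussNhd {D : Set E} {x₀ : E} (h : IsSubgraphNear D x₀) :
    ∃ U ∈ 𝓝 x₀, IsGaussNhd D U := by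
  obtain ⟨q, γ, K, hγ, hD⟩ := h
  obtain ⟨r, hr, hball⟩ := Metric.eventually_nhds_iff_ball.1 hD
  set U := Metric.ball x₀ r with hUdef
  have hU : IsOpen U := Metric.isOpen_ball
  have hDU : D ∩ U = subgraph q γ ∩ U := by
    ext x
    exact and_congr_left fun hx => hball x hx
  have hfr : frontier D ∩ U = range (graphMap q γ) ∩ U := by
    rw [frontier_inter_eq_of_inter_eq hU hDU, frontier_subgraph q hγ.continuous]
  have hdiff := hγ.ae_differentiableAt (μ := volume)
  have hnormal : ∀ y, DifferentiableAt ℝ γ y → graphMap q γ y ∈ U →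
      IsOuterNormal D (graphMap q γ y) (graphNormal q (fderiv ℝ γ y)) := fun y hy hyU =>
    (isOuterNormal_subgraph q hy).congr <| by
      filter_upwards [hU.mem_nhds hyU] with z hz using hball z hz
  have hae : ∀ᵐ x ∂area.restrict (frontier D ∩ U),
      IsOuterNormal D x (graphNormal q (fderiv ℝ γ (q x).fst)) := by
    rw [hfr, inter_comm, ← Measure.restrict_restrict hU.measurableSet,
      ae_restrict_iff' hU.measurableSet]
    filter_upwards [ae_restrict_range_graphMap q hγ hdiff] with x hx hxU
    have := hnormal _ hx.1 (hx.2 ▸ hxU)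
    rwa [← hx.2] at this
  refine ⟨U, Metric.ball_mem_nhds x₀ hr, hU, ?_, ?_, ?_, ?_⟩
  · rw [hfr]; exact area_graphMap_inter_ball_lt q hγ x₀ r
  · filter_upwards [hae] with x hx
    rwa [outerNormal_eq hx]
  · have hm : Measurable fun x => graphNormal q (fderiv ℝ γ (q x).fst) :=
      (continuous_graphNormal q).measurable.comp
        ((measurable_fderiv ℝ γ).comp (continuous_coord_fst q).measurable)
    refine hm.aestronglyMeasurable.congr ?_
    filter_upwards [hae] with x hx
    rw [outerNormal_eq hx]
  · intro φ hφ hc hφU u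
    have hφ0 : ∀ x ∉ U, φ x = 0 := fun x hx =>
      image_eq_zero_of_notMem_tsupport fun h => hx (hφU h)
    have e1 : ∫ x in D, fderiv ℝ φ x u = ∫ x in subgraph q γ, fderiv ℝ φ x u := by
      have hsupp : ∀ x ∉ U, fderiv ℝ φ x u = 0 := fun x hx => by
        have : fderiv ℝ φ x = 0 := image_eq_zero_of_notMem_tsupport fun h =>
          hx (hφU (tsupport_fderiv_subset ℝ h))
        simp [this]
      have h1 : ∀ A : Set E, ∫ x in A ∩ U, fderiv ℝ φ x u = ∫ x in A, fderiv ℝ φ x u :=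
        fun A => by
          rw [inter_comm, ← Measure.restrict_restrict hU.measurableSet]
          exact setIntegral_eq_integral_of_forall_compl_eq_zero hsupp
      rw [← h1, hDU, h1]
    have e2 : ∫ x in frontier D, φ x * inner ℝ (outerNormal D x) u ∂area =
        ∫ x in range (graphMap q γ), φ x * inner ℝ (outerNormal D x) u ∂area := by
      have h1 : ∀ A : Set E, ∫ x in A ∩ U, φ x * inner ℝ (outerNormal D x) u ∂area =
          ∫ x in A, φ x * inner ℝ (outerNormal D x) u ∂area := fun A => by
        rw [inter_comm, ← Measure.restrict_restrict hU.measurableSet]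
        exact setIntegral_eq_integral_of_forall_compl_eq_zero fun x hx => by simp [hφ0 x hx]
      rw [← h1, hfr, h1]
    rw [e1, e2, setIntegral_subgraph_fderiv q hφ hc hγ u, setIntegral_range_graphMap q hγ]
    refine integral_congr_ae ?_
    filter_upwards [hdiff] with y hy
    by_cases hyU : graphMap q γ y ∈ U
    · rw [outerNormal_eq (hnormal y hy hyU), inner_graphNormal]
      have := one_le_graphJac (fderiv ℝ γ y)
      field_simp
    · simp [hφ0 _ hyU]

/-- The splitting of `ℝ³` into a horizontal plane and a vertical axis. -/
noncomputable def splitVertical : EuclideanSpace ℝ (Fin 3) ≃ₗᵢ[ℝ] WithLp 2 (Plane × ℝ) where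
  toFun x := WithLp.toLp 2 (!₂[x 0, x 1], x 2)
  invFun z := !₂[z.fst 0, z.fst 1, z.snd]
  map_add' x y := by
    apply WithLp.ofLp_injective
    ext i <;> [fin_cases i; skip] <;> simp
  map_smul' c x := by
    apply WithLp.ofLp_injective
    ext i <;> [fin_cases i; skip] <;> simp
  left_inv x := by ext i; fin_cases i <;> simp
  right_inv z := by
    apply WithLp.ofLp_injective
    ext i <;> [fin_cases i; skip] <;> simp
  norm_map' x := by
    refine (sq_eq_sq₀ (norm_nonneg _) (norm_nonneg _)).1 ?_
    rw [WithLp.prod_norm_sq_eq_of_L2, EuclideanSpace.norm_sq_eq, EuclideanSpace.norm_sq_eq x]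
    simp [Fin.sum_univ_succ]
    ring

theorem IsLipschitzDomain.isSubgraphNear {Ω : Set E} (h : IsLipschitzDomain Ω) {x₀ : E}
    (hx : x₀ ∈ frontier Ω) : IsSubgraphNear Ω x₀ := by
  obtain ⟨r, γ, K, hγ, hD⟩ := h.2.2 x₀ hx
  exact ⟨r.trans splitVertical, γ, K, hγ, hD⟩

end Poro

namespace Poro

/-! ### From local to global -/

theorem exists_smooth_cutoff {K U : Set E} (hK : IsClosed K) (hU : IsOpen U) (h : K ⊆ U) :
    ∃ η : E → ℝ, ContDiff ℝ 1 η ∧ (∀ᶠ x in 𝓝ˢ K, η x = 1) ∧ tsupport η ⊆ U ∧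
      ∀ x, η x ∈ Icc (0 : ℝ) 1 := by
  obtain ⟨V, hV, hKV, hVU⟩ := normal_exists_closure_subset hK hU h
  obtain ⟨f, h1, h2, h3⟩ := exists_contMDiffMap_one_nhds_of_subset_interior
    (modelWithCornersSelf ℝ E) (n := 1) (s := K) (t := V) hK (by rwa [hV.interior_eq])
  refine ⟨f, f.contMDiff.contDiff, h1, ?_, h3⟩
  refine (closure_mono fun x hx => ?_).trans hVU
  by_contra hn
  exact hx (h2 x hn)

/-- A partition of unity in the form of an induction over compact sets: an additive property of test
functions that holds for all small enough supports around each point of `K` holds for every test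
function supported in `K`. -/
theorem contDiff_local_induction {P : (E → ℝ) → Prop} (h0 : P 0)
    (hadd : ∀ φ ψ : E → ℝ, P φ → P ψ → P (φ + ψ)) {K : Set E} (hK : IsCompact K)
    (hloc : ∀ x ∈ K, ∃ U ∈ 𝓝 x, ∀ φ : E → ℝ, ContDiff ℝ 1 φ → HasCompactSupport φ →
      tsupport φ ⊆ U → P φ) {φ : E → ℝ} (hφ : ContDiff ℝ 1 φ) (hφK : tsupport φ ⊆ K) : P φ := by
  have key : ∃ U : Set E, IsOpen U ∧ K ⊆ U ∧ ∀ φ : E → ℝ, ContDiff ℝ 1 φ → HasCompactSupport φ →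
      tsupport φ ⊆ U → P φ := by
    refine hK.induction_on (p := fun s => ∃ U : Set E, IsOpen U ∧ s ⊆ U ∧ ∀ φ : E → ℝ,
      ContDiff ℝ 1 φ → HasCompactSupport φ → tsupport φ ⊆ U → P φ) ?_ ?_ ?_ ?_
    · refine ⟨∅, isOpen_empty, Subset.rfl, fun φ _ _ h => ?_⟩
      rw [subset_empty_iff, tsupport_eq_empty_iff] at h
      rwa [h]
    · rintro s t hst ⟨U, h1, h2, h3⟩
      exact ⟨U, h1, hst.trans h2, h3⟩
    · rintro s t ⟨U₁, h1, h2, h3⟩ ⟨U₂, h1', h2', h3'⟩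
      refine ⟨U₁ ∪ U₂, h1.union h1', union_subset_union h2 h2', fun φ hφ hc hsupp => ?_⟩
      -- The part of the support outside `U₂` is closed and lies in `U₁`. A cutoff `η` supported in
      -- `U₁` and equal to one near it puts `η φ` in `U₁` and `(1 - η) φ` in `U₂`.
      have hC : IsClosed (tsupport φ \ U₂) := (isClosed_tsupport φ).sdiff h1'
      obtain ⟨η, e1, e2, e3, -⟩ := exists_smooth_cutoff hC h1 fun x hx =>
        (hsupp hx.1).resolve_right hx.2
      have hsplit : φ = (fun x => η x * φ x) + fun x => (1 - η x) * φ x := by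
        ext x; simp only [Pi.add_apply]; ring
      rw [hsplit]
      refine hadd _ _ (h3 _ (e1.mul hφ) hc.mul_left ?_) (h3' _ ((contDiff_const.sub e1).mul hφ)
        hc.mul_left ?_)
      · exact (tsupport_mul_subset_left).trans e3
      · intro x hx
        by_contra hxU
        have hxφ : x ∈ tsupport φ := tsupport_mul_subset_right hx
        have hev : ∀ᶠ y in 𝓝 x, η y = 1 := e2.filter_mono (nhds_le_nhdsSet (show x ∈ tsupport φ \ U₂ from ⟨hxφ, hxU⟩))
        refine (notMem_tsupport_iff_eventuallyEq.2 ?_) hx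
        filter_upwards [hev] with y hy
        simp [hy]
    · intro x hx
      obtain ⟨U, hU, h⟩ := hloc x hx
      exact ⟨interior U, nhdsWithin_le_nhds (interior_mem_nhds.2 hU), interior U, isOpen_interior,
        Subset.rfl, fun φ h1 h2 h3 => h φ h1 h2 (h3.trans interior_subset)⟩
  obtain ⟨U, -, hKU, hU⟩ := key
  exact hU φ hφ (hK.of_isClosed_subset (isClosed_tsupport φ) hφK) (hφK.trans hKU)

theorem integrableOn_of_ae_zero_compl {μ : Measure E} {s : Set E} {f : E → ℝ}
    (h : ∀ x ∈ s, f x = 0) (hs : MeasurableSet s) : IntegrableOn f s μ :=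
  (integrableOn_zero (ε' := ℝ)).congr_fun (fun x hx => (h x hx).symm) hs

theorem IsGaussNhd.integrableOn {D U : Set E} (h : IsGaussNhd D U) {φ : E → ℝ} (hφ : Continuous φ)
    (hc : HasCompactSupport φ) (hU : tsupport φ ⊆ U) (u : E) :
    IntegrableOn (fun x => φ x * inner ℝ (outerNormal D x) u) (frontier D) area := by
  have h1 : IntegrableOn (fun x => φ x * inner ℝ (outerNormal D x) u) (frontier D ∩ U) area := by
    obtain ⟨C, hC⟩ := hc.exists_bound_of_continuous hφ
    have : IsFiniteMeasure (area.restrict (frontier D ∩ U)) :=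
      ⟨by rw [Measure.restrict_apply_univ]; exact h.area_lt⟩
    refine Integrable.of_bound
      (hφ.aestronglyMeasurable.mul (h.meas.inner aestronglyMeasurable_const)) (C * ‖u‖) ?_
    filter_upwards [h.normal] with x hx
    rw [norm_mul]
    gcongr
    · exact (norm_nonneg _).trans (hC x)
    · exact hC x
    · exact (norm_inner_le_norm _ _).trans (by rw [hx.1, one_mul])
  have h2 : IntegrableOn (fun x => φ x * inner ℝ (outerNormal D x) u) (frontier D ∩ Uᶜ) area :=
    integrableOn_of_ae_zero_compl (fun x hx => by
      rw [image_eq_zero_of_notMem_tsupport fun h => hx.2 (hU h), zero_mul])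
      (isClosed_frontier.measurableSet.inter h.isOpen.measurableSet.compl)
  have := h1.union h2
  rwa [inter_union_compl] at this

/-- The integral of a translate over the whole space does not depend on the translation, so its
derivative vanishes. -/
theorem integral_fderiv_eq_zero {φ : E → ℝ} (hφ : ContDiff ℝ 1 φ) (hc : HasCompactSupport φ) (u : E) :
    ∫ x, fderiv ℝ φ x u = 0 := by
  have h1 := hasDerivAt_setIntegral_translate hφ hc univ u
  simp only [Measure.restrict_univ, integral_add_right_eq_self] at h1
  exact h1.unique (hasDerivAt_const _ _)

/-- The divergence theorem on a Lipschitz domain. -/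
theorem IsLipschitzDomain.isGaussNhd {Ω : Set E} (hΩ : IsLipschitzDomain Ω) :
    IsGaussNhd Ω univ := by
  have hloc : ∀ x : frontier Ω, ∃ U ∈ 𝓝 (x : E), IsGaussNhd Ω U := fun x =>
    (hΩ.isSubgraphNear x.2).exists_isGaussNhd
  choose U hUx hU using hloc
  have hcpt : IsCompact (frontier Ω) :=
    (hΩ.2.1.isCompact_closure).of_isClosed_subset isClosed_frontier frontier_subset_closure
  obtain ⟨s, hs⟩ := hcpt.elim_nhds_subcover' (fun x hx => U ⟨x, hx⟩) fun x hx => hUx ⟨x, hx⟩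
  have hcov : frontier Ω ∩ univ = ⋃ x : s, frontier Ω ∩ U x := by
    rw [inter_univ, ← inter_iUnion]
    refine (inter_eq_left.2 fun x hx => ?_).symm
    obtain ⟨i, hi, hxi⟩ := mem_iUnion₂.1 (hs hx)
    exact mem_iUnion.2 ⟨⟨i, hi⟩, hxi⟩
  refine ⟨isOpen_univ, ?_, ?_, ?_, ?_⟩
  · rw [hcov]
    refine (measure_iUnion_le _).trans_lt ?_
    rw [tsum_fintype]
    exact ENNReal.sum_lt_top.2 fun i _ => (hU i).area_lt
  · rw [hcov]
    exact (ae_restrict_iUnion_iff _ _).2 fun i => (hU i).normal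
  · rw [hcov]
    exact aestronglyMeasurable_iUnion_iff.2 fun i => (hU i).meas
  · intro φ hφ hc _ u
    refine (contDiff_local_induction (K := tsupport φ) (P := fun φ =>
      IntegrableOn (fun x => fderiv ℝ φ x u) Ω ∧ Differentiable ℝ φ ∧
      IntegrableOn (fun x => φ x * inner ℝ (outerNormal Ω x) u) (frontier Ω) area ∧
      ∫ x in Ω, fderiv ℝ φ x u = ∫ x in frontier Ω, φ x * inner ℝ (outerNormal Ω x) u ∂area)
      ?_ ?_ hc ?_ hφ Subset.rfl).2.2.2
    · simp
    · rintro φ ψ ⟨h1, h2, h3, h4⟩ ⟨h1', h2', h3', h4'⟩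
      have e1 : ∀ x, fderiv ℝ (φ + ψ) x u = fderiv ℝ φ x u + fderiv ℝ ψ x u := fun x => by
        rw [fderiv_add (h2 x) (h2' x)]; rfl
      have e2 : ∀ x, (φ + ψ) x * inner ℝ (outerNormal Ω x) u =
          φ x * inner ℝ (outerNormal Ω x) u + ψ x * inner ℝ (outerNormal Ω x) u := fun x => by
        rw [Pi.add_apply]; ring
      simp only [e1, e2]
      refine ⟨h1.add h1', h2.add h2', h3.add h3', ?_⟩
      rw [integral_add h1 h1', integral_add h3 h3', h4, h4']
    · intro x _
      have hint : ∀ φ : E → ℝ, ContDiff ℝ 1 φ → HasCompactSupport φ →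
          Integrable (fun x => fderiv ℝ φ x u) := fun φ hφ hc => by
        have h1 : Continuous fun x => fderiv ℝ φ x u := by
          have := hφ.continuous_fderiv one_ne_zero
          fun_prop
        exact h1.integrable_of_hasCompactSupport (hc.fderiv_apply ℝ u)
      by_cases hx : x ∈ frontier Ω
      · exact ⟨U ⟨x, hx⟩, hUx ⟨x, hx⟩, fun φ hφ hc hs => ⟨(hint φ hφ hc).integrableOn,
          hφ.differentiable one_ne_zero, (hU _).integrableOn hφ.continuous hc hs u,
          (hU ⟨x, hx⟩).gauss φ hφ hc hs u⟩⟩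
      · refine ⟨(frontier Ω)ᶜ, isClosed_frontier.isOpen_compl.mem_nhds hx,
          fun φ hφ hc hs => ⟨(hint φ hφ hc).integrableOn, hφ.differentiable one_ne_zero, ?_, ?_⟩⟩
        · exact integrableOn_of_ae_zero_compl (fun x hx => by
            rw [image_eq_zero_of_notMem_tsupport fun h => hs h hx, zero_mul])
            isClosed_frontier.measurableSet
        · rw [setIntegral_eq_zero_of_forall_eq_zero (t := frontier Ω) fun x hx => by
            rw [image_eq_zero_of_notMem_tsupport fun h => hs h hx, zero_mul]]
          have hfr : ∀ x ∈ tsupport φ, x ∈ closure Ω → x ∈ Ω := fun x hx hxΩ => by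
            have := hs hx
            rw [mem_compl_iff, frontier, hΩ.1.interior_eq] at this
            by_contra hn
            exact this ⟨hxΩ, hn⟩
          -- The support of `φ` avoids the frontier, so its part in `Ω` is closed. Cutting off near
          -- it turns `φ` restricted to `Ω` into a compactly supported `C¹` function on the whole
          -- space, whose derivatives integrate to zero.
          have hcl : IsClosed (tsupport φ ∩ Ω) := by
            have : tsupport φ ∩ Ω = tsupport φ ∩ closure Ω :=
              Subset.antisymm (inter_subset_inter_right _ subset_closure)
                fun x hx => ⟨hx.1, hfr x hx.1 hx.2⟩
            rw [this]
            exact (isClosed_tsupport φ).inter isClosed_closure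
          obtain ⟨η, e1, e2, e3, -⟩ := exists_smooth_cutoff hcl hΩ.1 inter_subset_right
          have hη := integral_fderiv_eq_zero (e1.mul hφ) hc.mul_left u
          rw [← hη, ← integral_indicator hΩ.1.measurableSet]
          congr 1
          ext x
          by_cases hx : x ∈ Ω
          · rw [indicator_of_mem hx]
            by_cases hxφ : x ∈ tsupport φ
            · have : (fun y => η y * φ y) =ᶠ[𝓝 x] φ := by
                filter_upwards [e2.filter_mono (nhds_le_nhdsSet
                  (show x ∈ tsupport φ ∩ Ω from ⟨hxφ, hx⟩))] with y hy
                simp [hy]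
              rw [this.fderiv_eq]
            · have h1 : fderiv ℝ φ x = 0 := image_eq_zero_of_notMem_tsupport fun h =>
                hxφ (tsupport_fderiv_subset ℝ h)
              have h2 : fderiv ℝ (fun y => η y * φ y) x = 0 :=
                image_eq_zero_of_notMem_tsupport fun h =>
                  hxφ (tsupport_mul_subset_right (tsupport_fderiv_subset ℝ h))
              rw [h1, h2]
          · rw [indicator_of_notMem hx]
            have h2 : fderiv ℝ (fun y => η y * φ y) x = 0 :=
              image_eq_zero_of_notMem_tsupport fun h =>
                hx (e3 (tsupport_mul_subset_left (tsupport_fderiv_subset ℝ h)))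
            rw [h2]; rfl

/-- A set of finite two-dimensional Hausdorff measure has zero three-dimensional measure. -/
theorem IsGaussNhd.volume_frontier {D U : Set E} (h : IsGaussNhd D U) :
    volume (frontier D ∩ U) = 0 := by
  rcases Measure.euclideanHausdorffMeasure_zero_or_top (show 2 < 3 by norm_num) (frontier D ∩ U)
    with h0 | h0
  · have h3 : Module.finrank ℝ E = 3 := finrank_euclideanSpace_fin (𝕜 := ℝ) (n := 3)
    rw [← InnerProductSpace.euclideanHausdorffMeasure_eq_volume (V := E), h3]
    exact h0
  · exact absurd h0 h.area_lt.ne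

end Poro

namespace Poro

/-! ### Mollified indicators -/

open scoped Convolution

/-- A bump function of radius `1 / (n + 1)`. -/
noncomputable def bump (n : ℕ) : ContDiffBump (0 : E) where
  rIn := 1 / (n + 1) / 2
  rOut := 1 / (n + 1)
  rIn_pos := by positivity
  rIn_lt_rOut := half_lt_self (by positivity)

/-- The mollifier of radius `1 / (n + 1)`. -/
noncomputable def moll (n : ℕ) : E → ℝ := (bump n).normed volume

/-- The convolution with the mollifier. -/
noncomputable def smoothing {F : Type*} [NormedAddCommGroup F] [NormedSpace ℝ F] (n : ℕ) (f : E → F) :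
    E → F :=
  moll n ⋆[ContinuousLinearMap.lsmul ℝ ℝ, volume] f

theorem tendsto_bump_rOut : Tendsto (fun n => (bump n).rOut) atTop (𝓝 0) :=
  tendsto_one_div_add_atTop_nhds_zero_nat

theorem contDiff_moll (n : ℕ) : ContDiff ℝ 1 (moll n) := (bump n).contDiff_normed (n := 1)

theorem hasCompactSupport_moll (n : ℕ) : HasCompactSupport (moll n) :=
  (bump n).hasCompactSupport_normed

theorem moll_sub_comm (n : ℕ) (x y : E) : moll n (x - y) = moll n (y - x) := by
  rw [← neg_sub, moll, ContDiffBump.normed_neg]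

theorem moll_nonneg (n : ℕ) (x : E) : 0 ≤ moll n x := (bump n).nonneg_normed x

theorem smoothing_eq {F : Type*} [NormedAddCommGroup F] [NormedSpace ℝ F] (n : ℕ) (f : E → F)
    (y : E) : smoothing n f y = ∫ x, moll n (x - y) • f x := by
  rw [smoothing, convolution_eq_swap]
  simp only [moll_sub_comm n y]
  rfl

theorem contDiff_smoothing {F : Type*} [NormedAddCommGroup F] [NormedSpace ℝ F] (n : ℕ) {f : E → F}
    (hf : LocallyIntegrable f) : ContDiff ℝ 1 (smoothing n f) :=
  (hasCompactSupport_moll n).contDiff_convolution_left (n := 1) _ (contDiff_moll n) hf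

theorem norm_smoothing_le {F : Type*} [NormedAddCommGroup F] [NormedSpace ℝ F] [CompleteSpace F]
    (n : ℕ) {f : E → F} {C : ℝ} (hC : ∀ x, ‖f x‖ ≤ C) (y : E) : ‖smoothing n f y‖ ≤ C := by
  have h1 : Integrable (moll n) := (bump n).integrable_normed
  have h2 : ∫ x, moll n (x - y) = 1 := by
    rw [integral_sub_right_eq_self (moll n) y]
    exact (bump n).integral_normed
  rw [smoothing_eq]
  calc _ ≤ ∫ x, moll n (x - y) * C := by
        refine norm_integral_le_of_norm_le ((h1.comp_sub_right y).mul_const C)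
          (Eventually.of_forall fun x => ?_)
        rw [norm_smul, Real.norm_of_nonneg (moll_nonneg n _)]
        exact mul_le_mul_of_nonneg_left (hC x) (moll_nonneg n _)
    _ = C := by rw [integral_mul_const, h2, one_mul]

/-- The mollified indicator function of `Ω`. -/
noncomputable def smoothInd (Ω : Set E) (n : ℕ) : E → ℝ := smoothing n (Ω.indicator fun _ => 1)

section SmoothInd

variable {Ω : Set E}

theorem locallyIntegrable_ind (hΩ : IsOpen Ω) : LocallyIntegrable (Ω.indicator fun _ : E => (1 : ℝ)) :=
  (locallyIntegrable_const (1 : ℝ)).indicator hΩ.measurableSet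

theorem contDiff_smoothInd (hΩ : IsOpen Ω) (n : ℕ) : ContDiff ℝ 1 (smoothInd Ω n) :=
  contDiff_smoothing n (locallyIntegrable_ind hΩ)

theorem abs_smoothInd_le (n : ℕ) (x : E) : |smoothInd Ω n x| ≤ 1 := by
  refine norm_smoothing_le (F := ℝ) n (fun y => ?_) x
  by_cases hy : y ∈ Ω <;> simp [hy]

theorem tsupport_smoothInd_subset (n : ℕ) :
    tsupport (smoothInd Ω n) ⊆ Metric.cthickening (1 / (n + 1)) Ω := by
  refine closure_minimal (fun x hx => ?_) Metric.isClosed_cthickening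
  by_contra hn
  refine hx ?_
  rw [smoothInd, smoothing_eq]
  refine integral_eq_zero_of_ae (Eventually.of_forall fun y => ?_)
  by_cases hy : y ∈ Ω
  · have : y - x ∉ Function.support (moll n) := by
      rw [moll, ContDiffBump.support_normed_eq, Metric.mem_ball, dist_zero_right]
      intro hlt
      refine hn (Metric.mem_cthickening_of_dist_le x y _ _ hy ?_)
      rw [dist_eq_norm, norm_sub_rev]
      exact hlt.le
    simp [Function.notMem_support.1 this]
  · simp [hy]

theorem hasCompactSupport_smoothInd (hΩ : Bornology.IsBounded Ω) (n : ℕ) :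
    HasCompactSupport (smoothInd Ω n) := by
  refine IsCompact.of_isClosed_subset ?_ (isClosed_tsupport _) (tsupport_smoothInd_subset n)
  exact Metric.isCompact_of_isClosed_isBounded Metric.isClosed_cthickening hΩ.cthickening

theorem eventually_tsupport_smoothInd_subset (hΩ : Bornology.IsBounded Ω) {U : Set E}
    (hU : IsOpen U) (h : closure Ω ⊆ U) : ∀ᶠ n in atTop, tsupport (smoothInd Ω n) ⊆ U := by
  obtain ⟨δ, hδ, hsub⟩ := hΩ.isCompact_closure.exists_cthickening_subset_open hU h
  have hev : ∀ᶠ n : ℕ in atTop, (1 : ℝ) / (n + 1) < δ :=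
    tendsto_one_div_add_atTop_nhds_zero_nat.eventually (gt_mem_nhds hδ)
  filter_upwards [hev] with n hn
  refine (tsupport_smoothInd_subset n).trans ?_
  rw [← Metric.cthickening_closure]
  exact (Metric.cthickening_mono hn.le _).trans hsub

theorem tendsto_smoothInd (hΩ : IsOpen Ω) {x : E} (hx : x ∉ frontier Ω) :
    Tendsto (fun n => smoothInd Ω n x) atTop (𝓝 (Ω.indicator (fun _ => 1) x)) := by
  refine ContDiffBump.convolution_tendsto_right (φ := bump) (g := fun _ => Ω.indicator fun _ => 1)
    tendsto_bump_rOut (Eventually.of_forall fun _ => ?_) ?_ tendsto_const_nhds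
  · exact (measurable_const.indicator hΩ.measurableSet).aestronglyMeasurable
  · have : Function.uncurry (fun (_ : ℕ) => Ω.indicator fun _ : E => (1 : ℝ)) =
      (Ω.indicator fun _ => 1) ∘ Prod.snd := rfl
    rw [this]
    refine Tendsto.comp ?_ tendsto_snd
    have h1 : ∀ᶠ y in 𝓝 x, Ω.indicator (fun _ => (1 : ℝ)) y = Ω.indicator (fun _ => 1) x := by
      by_cases hxΩ : x ∈ Ω
      · filter_upwards [hΩ.mem_nhds hxΩ] with y hy
        simp [hy, hxΩ]
      · have : x ∉ closure Ω := fun h => hx ⟨h, by rwa [hΩ.interior_eq]⟩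
        filter_upwards [isClosed_closure.isOpen_compl.mem_nhds this] with y hy
        have : y ∉ Ω := fun h => hy (subset_closure h)
        simp [this, hxΩ]
    exact tendsto_const_nhds.congr' (h1.mono fun y hy => hy.symm)

/-- The derivative falls on the mollifier, and the divergence theorem on `Ω` for `y ↦ moll n (x -
y)` moves it to the boundary: the gradient of the mollified indicator is minus the mollified normal
measure of `∂Ω`. -/
theorem fderiv_smoothInd (hΩ : IsLipschitzDomain Ω) (n : ℕ) (x u : E) :
    fderiv ℝ (smoothInd Ω n) x u =
      -∫ y in frontier Ω, moll n (x - y) * inner ℝ (outerNormal Ω y) u ∂area := by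
  have h1 := (hasCompactSupport_moll n).hasFDerivAt_convolution_left (μ := volume)
    (ContinuousLinearMap.lsmul ℝ ℝ) (contDiff_moll n) (locallyIntegrable_ind hΩ.1) x
  have h2 : fderiv ℝ (smoothInd Ω n) x u = ∫ y in Ω, fderiv ℝ (moll n) (x - y) u := by
    rw [smoothInd, smoothing, h1.fderiv, convolution_eq_swap,
      ContinuousLinearMap.integral_apply]
    · rw [← integral_indicator hΩ.1.measurableSet]
      congr 1
      ext y
      by_cases hy : y ∈ Ω <;> simp [hy]
    · have h3 := (((hasCompactSupport_moll n).fderiv ℝ).convolutionExists_left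
        ((ContinuousLinearMap.lsmul ℝ ℝ : ℝ →L[ℝ] ℝ →L[ℝ] ℝ).precompL E) (μ := volume)
        ((contDiff_moll n).continuous_fderiv one_ne_zero) (locallyIntegrable_ind hΩ.1) x)
      exact h3.integrable_swap
  have hφ : ContDiff ℝ 1 fun y => moll n (x - y) :=
    (contDiff_moll n).comp (contDiff_const.sub contDiff_id)
  have hc : HasCompactSupport fun y => moll n (x - y) :=
    (hasCompactSupport_moll n).comp_homeomorph (Homeomorph.subLeft x)
  have h4 := hΩ.isGaussNhd.gauss _ hφ hc (subset_univ _) u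
  rw [h2, ← h4, ← integral_neg]
  congr 1
  ext y
  have h5 : HasFDerivAt (fun y => moll n (x - y)) (-(fderiv ℝ (moll n) (x - y))) y := by
    have := ((contDiff_moll n).differentiable one_ne_zero (x - y)).hasFDerivAt.comp y
      ((hasFDerivAt_id y).const_sub x)
    refine this.congr_fderiv ?_
    ext v; simp
  rw [h5.fderiv]
  simp

/-- By Fubini the mollification passes from the normal measure to the field `W`, for which
integrability is enough; no smoothness of `W` is used. -/
theorem integral_fderiv_smoothInd (hΩ : IsLipschitzDomain Ω) (n : ℕ) {W : E → E}
    (hW : Integrable W) :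
    ∫ x, fderiv ℝ (smoothInd Ω n) x (W x) =
      -∫ y in frontier Ω, inner ℝ (outerNormal Ω y) (smoothing n W y) ∂area := by
  have hG := hΩ.isGaussNhd
  have hmeas := hG.meas
  have hnormal := hG.normal
  have hlt := hG.area_lt
  rw [inter_univ] at hmeas hnormal hlt
  have : IsFiniteMeasure (area.restrict (frontier Ω)) :=
    ⟨by rw [Measure.restrict_apply_univ]; exact hlt⟩
  obtain ⟨C, hC⟩ := (hasCompactSupport_moll n).exists_bound_of_continuous (contDiff_moll n).continuous
  have hint : Integrable (Function.uncurry fun x y => moll n (x - y) * inner ℝ (outerNormal Ω y) (W x))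
      (volume.prod (area.restrict (frontier Ω))) := by
    have h1 : Integrable (fun p : E × E => C * (‖W p.1‖ * 1))
        (volume.prod (area.restrict (frontier Ω))) :=
      (hW.norm.mul_prod (integrable_const (1 : ℝ))).const_mul C
    refine h1.mono' ?_ ?_
    · refine AEStronglyMeasurable.mul ?_ ?_
      · exact ((contDiff_moll n).continuous.comp (by fun_prop)).aestronglyMeasurable
      · exact (hmeas.comp_snd).inner hW.aestronglyMeasurable.comp_fst
    · have : ∀ᵐ p ∂(volume : Measure E).prod (area.restrict (frontier Ω)), ‖outerNormal Ω p.2‖ = 1 :=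
        Measure.quasiMeasurePreserving_snd.ae (hnormal.mono fun y hy => hy.1)
      filter_upwards [this] with p hp
      simp only [Function.uncurry]
      rw [norm_mul]
      refine mul_le_mul (hC _) ?_ (norm_nonneg _) ((norm_nonneg _).trans (hC 0))
      refine (norm_inner_le_norm _ _).trans ?_
      rw [hp]; linarith
  have e1 : ∀ x, fderiv ℝ (smoothInd Ω n) x (W x) =
      -∫ y in frontier Ω, moll n (x - y) * inner ℝ (outerNormal Ω y) (W x) ∂area := fun x =>
    fderiv_smoothInd hΩ n x (W x)
  simp only [e1]
  rw [integral_neg, integral_integral_swap hint]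
  congr 1
  refine integral_congr_ae (Eventually.of_forall fun y => ?_)
  have hWi : Integrable fun x => moll n (x - y) • W x := by
    refine hW.bdd_smul (C := C) ?_ (Eventually.of_forall fun x => hC _)
    exact ((contDiff_moll n).continuous.comp (by fun_prop)).aestronglyMeasurable
  simp only
  rw [smoothing_eq, ← integral_inner hWi]
  simp only [inner_smul_right]

/-- Dominated convergence on the boundary. The field may vary with the index `i`, and convergence is
required only jointly in `i` and the point, at almost every boundary point. So an interface that
moves with time, and meets the boundary in a set of zero area, is allowed. -/
theorem tendsto_integral_fderiv_smoothInd (hΩ : IsLipschitzDomain Ω) {ι : Type*} {l : Filter ι}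
    [l.IsCountablyGenerated] {k : ι → ℕ} (hk : Tendsto k l atTop) {W : ι → E → E} {W₀ : E → E} {C : ℝ}
    (hW : ∀ᶠ i in l, Integrable (W i) ∧ ∀ x, ‖W i x‖ ≤ C)
    (hlim : ∀ᵐ y ∂area.restrict (frontier Ω),
      Tendsto (Function.uncurry W) (l ×ˢ 𝓝 y) (𝓝 (W₀ y))) :
    Tendsto (fun i => ∫ x, fderiv ℝ (smoothInd Ω (k i)) x (W i x)) l
      (𝓝 (-∫ y in frontier Ω, inner ℝ (outerNormal Ω y) (W₀ y) ∂area)) := by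
  have hG := hΩ.isGaussNhd
  have hmeas := hG.meas
  have hnormal := hG.normal
  have hlt := hG.area_lt
  rw [inter_univ] at hmeas hnormal hlt
  have : IsFiniteMeasure (area.restrict (frontier Ω)) :=
    ⟨by rw [Measure.restrict_apply_univ]; exact hlt⟩
  have h1 : (fun i => ∫ x, fderiv ℝ (smoothInd Ω (k i)) x (W i x)) =ᶠ[l]
      fun i => -∫ y in frontier Ω, inner ℝ (outerNormal Ω y) (smoothing (k i) (W i) y) ∂area := by
    filter_upwards [hW] with i hi
    exact integral_fderiv_smoothInd hΩ (k i) hi.1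
  refine Tendsto.congr' h1.symm (Tendsto.neg ?_)
  refine tendsto_integral_filter_of_dominated_convergence (fun _ => C) ?_ ?_ (integrable_const _) ?_
  · filter_upwards [hW] with i hi
    exact hmeas.inner (contDiff_smoothing (k i) hi.1.locallyIntegrable).continuous.aestronglyMeasurable
  · filter_upwards [hW] with i hi
    filter_upwards [hnormal] with y hy
    refine (norm_inner_le_norm _ _).trans ?_
    rw [hy.1, one_mul]
    exact norm_smoothing_le (k i) hi.2 y
  · filter_upwards [hlim] with y hy
    refine Tendsto.inner tendsto_const_nhds ?_
    exact ContDiffBump.convolution_tendsto_right (φ := fun i => bump (k i)) (g := W)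
      (tendsto_bump_rOut.comp hk) (hW.mono fun i hi => hi.1.aestronglyMeasurable) hy
      tendsto_const_nhds

end SmoothInd

end Poro

namespace Poro

/-! ### Level sets of `C¹` functions -/

/-- Any splitting into a plane and an axis is composed with the reflection that exchanges `ν` and
the unit vector of that axis. -/
theorem exists_split (ν : E) (hν : ‖ν‖ = 1) :
    ∃ q : E ≃ₗᵢ[ℝ] WithLp 2 (Plane × ℝ), ∀ x, (q x).snd = inner ℝ ν x := by
  let q₀ : E ≃ₗᵢ[ℝ] WithLp 2 (Plane × ℝ) := coords.trans splitVertical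
  let n : E := cart q₀ (0, 1)
  have hn : ‖n‖ = 1 := by
    simp [n, cart]
  let R := (Submodule.span ℝ {ν - n})ᗮ.reflection
  have hR : R ν = n := Submodule.reflection_sub (hν.trans hn.symm)
  refine ⟨R.trans q₀, fun x => ?_⟩
  rw [← R.inner_map_map ν x, hR, inner_cart]
  simp

/-- In coordinates whose vertical axis is the gradient direction, strict differentiability shows
that the zero set projects injectively and is a 1-Lipschitz graph over its projection. The Lipschitz
function is extended to the whole plane, and the intermediate value theorem shows that each vertical
line near `x₀` meets the zero set, so the extension plays no role near `x₀`. -/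
theorem isSubgraphNear_sublevel {G : E → ℝ} {x₀ : E} (hG : ContDiffAt ℝ 1 G x₀) (h0 : G x₀ = 0)
    (hd : fderiv ℝ G x₀ ≠ 0) : IsSubgraphNear {x | G x < 0} x₀ := by
  set L := fderiv ℝ G x₀ with hL
  set a : E := (InnerProductSpace.toDual ℝ E).symm L with ha
  set α := ‖a‖ with hα
  have hα0 : 0 < α := by
    rw [hα, ha, LinearIsometryEquiv.norm_map]
    exact norm_pos_iff.2 hd
  obtain ⟨q, hq⟩ := exists_split (α⁻¹ • a) (by
    rw [norm_smul, norm_inv, norm_norm, ← hα, inv_mul_cancel₀ hα0.ne'])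
  have hLq : ∀ v, L v = α * (q v).snd := fun v => by
    rw [hq, inner_smul_left, ha, InnerProductSpace.toDual_symm_apply]
    simp only [conj_trivial]
    rw [mul_inv_cancel_left₀ hα0.ne']
  have hst := hG.hasStrictFDerivAt one_ne_zero
  -- With the error constant `α / 4`, two zeros satisfy `|Δ vertical| ≤ (|Δ horizontal| + |Δ
  -- vertical|) / 4`, hence slope below one; and `α / 4 * (3 r / 4) < α * (r / 2)` fixes the signs
  -- of `G` at the ends of the vertical segments used below.
  obtain ⟨s, hs, happ⟩ := hst.approximates_deriv_on_nhds (c := (α / 4).toNNReal)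
    (Or.inr (by simpa using hα0))
  obtain ⟨r, hr, hrs⟩ := Metric.mem_nhds_iff.1 hs
  have happ' : ∀ x ∈ Metric.ball x₀ r, ∀ z ∈ Metric.ball x₀ r,
      |G x - G z - α * ((q x).snd - (q z).snd)| ≤ α / 4 * ‖x - z‖ := fun x hx z hz => by
    have := happ x (hrs hx) z (hrs hz)
    rw [← hL, hLq, Real.coe_toNNReal _ (by positivity), map_sub, Real.norm_eq_abs] at this
    exact this
  have hnorm : ∀ x z : E, ‖x - z‖ ≤ ‖(q x).fst - (q z).fst‖ + |(q x).snd - (q z).snd| := by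
    intro x z
    rw [← q.norm_map, map_sub, WithLp.prod_norm_eq_of_L2, Real.sqrt_le_left (by positivity)]
    simp only [WithLp.sub_fst, WithLp.sub_snd, Real.norm_eq_abs]
    nlinarith [norm_nonneg ((q x).fst - (q z).fst), abs_nonneg ((q x).snd - (q z).snd)]
  let Z : Set E := {z | z ∈ Metric.ball x₀ r ∧ G z = 0}
  have hZ : ∀ z ∈ Z, ∀ z' ∈ Z, |(q z).snd - (q z').snd| ≤ ‖(q z).fst - (q z').fst‖ := by
    rintro z ⟨hz, hGz⟩ z' ⟨hz', hGz'⟩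
    have h1 := happ' z hz z' hz'
    rw [hGz, hGz', sub_self, zero_sub, abs_neg, abs_mul, abs_of_pos hα0] at h1
    have h2 := hnorm z z'
    have h3 : |(q z).snd - (q z').snd| ≤ 1 / 4 * ‖z - z'‖ := by
      have : α * |(q z).snd - (q z').snd| ≤ α * (1 / 4 * ‖z - z'‖) := by linarith
      exact le_of_mul_le_mul_left this hα0
    linarith [norm_nonneg ((q z).fst - (q z').fst)]
  let π : E → Plane := fun x => (q x).fst
  let γ₀ : Plane → ℝ := fun y => (q (Function.invFunOn π Z y)).snd
  have hinv : ∀ y ∈ π '' Z, Function.invFunOn π Z y ∈ Z ∧ π (Function.invFunOn π Z y) = y :=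
    fun y hy => ⟨Function.invFunOn_mem hy, Function.invFunOn_eq hy⟩
  have hγ₀ : LipschitzOnWith 1 γ₀ (π '' Z) := by
    refine LipschitzOnWith.of_dist_le_mul fun y hy y' hy' => ?_
    have := hZ _ (hinv y hy).1 _ (hinv y' hy').1
    have e1 := (hinv y hy).2
    have e2 := (hinv y' hy').2
    simp only [π] at e1 e2
    rw [e1, e2] at this
    simpa [Real.dist_eq, dist_eq_norm] using this
  -- `γ₀` is known only on the projection of the zero set; its Lipschitz extension is the global
  -- function required by `IsSubgraphNear`.
  obtain ⟨γ, hγ, hγeq⟩ := hγ₀.extend_real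
  have hγZ : ∀ z ∈ Z, γ (q z).fst = (q z).snd := by
    intro z hz
    have hm : π z ∈ π '' Z := mem_image_of_mem _ hz
    have h1 := hZ _ (hinv _ hm).1 _ hz
    have e1 := (hinv _ hm).2
    simp only [π] at e1
    rw [e1, sub_self, norm_zero] at h1
    have h2 := hγeq hm
    simp only [γ₀, π] at h2
    rw [← h2]
    exact sub_eq_zero.1 (abs_nonpos_iff.1 h1)
  refine ⟨q, γ, 1, hγ, ?_⟩
  -- A vertical segment of half-length `r / 2` above and below the level of `x₀`, over a point
  -- within `r / 4` of `x₀`, stays within `3 r / 4` and hence inside the ball.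
  filter_upwards [Metric.ball_mem_nhds x₀ (show 0 < r / 4 by positivity)] with x hx
  rw [Metric.mem_ball, dist_eq_norm] at hx
  have hxr : x ∈ Metric.ball x₀ r := by rw [Metric.mem_ball, dist_eq_norm]; linarith
  have hcoord : ∀ c, (q (cart q ((q x).fst, c))).fst = (q x).fst ∧
      (q (cart q ((q x).fst, c))).snd = c := fun c => by simp [cart]
  have hball : ∀ c ∈ Icc ((q x₀).snd - r / 2) ((q x₀).snd + r / 2),
      ‖cart q ((q x).fst, c) - x₀‖ ≤ 3 * r / 4 := by
    intro c hc
    have h1 := hnorm (cart q ((q x).fst, c)) x₀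
    rw [(hcoord c).1, (hcoord c).2] at h1
    have h2 : ‖(q x).fst - (q x₀).fst‖ ≤ ‖x - x₀‖ := by
      have := norm_coord_fst_le q (x - x₀)
      rwa [map_sub] at this
    have h3 : |c - (q x₀).snd| ≤ r / 2 := by
      rw [abs_le]; constructor <;> linarith [hc.1, hc.2]
    linarith
  have hball' : ∀ c ∈ Icc ((q x₀).snd - r / 2) ((q x₀).snd + r / 2),
      cart q ((q x).fst, c) ∈ Metric.ball x₀ r := fun c hc => by
    rw [Metric.mem_ball, dist_eq_norm]; linarith [hball c hc]
  have hest : ∀ c ∈ Icc ((q x₀).snd - r / 2) ((q x₀).snd + r / 2),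
      |G (cart q ((q x).fst, c)) - α * (c - (q x₀).snd)| ≤ α / 4 * (3 * r / 4) := fun c hc => by
    have := happ' _ (hball' c hc) x₀ (Metric.mem_ball_self hr)
    rw [h0, sub_zero, (hcoord c).2] at this
    refine this.trans ?_
    gcongr
    exact hball c hc
  have hle : (q x₀).snd - r / 2 ≤ (q x₀).snd + r / 2 := by linarith
  have hcont : ContinuousOn (fun c => G (cart q ((q x).fst, c)))
      (Icc ((q x₀).snd - r / 2) ((q x₀).snd + r / 2)) := by
    refine (happ.continuousOn.mono hrs).comp (by fun_prop) fun c hc => hball' c hc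
  have hαr : 0 < α * r := by positivity
  obtain ⟨c, hc, hGc⟩ := intermediate_value_Icc hle hcont (show (0:ℝ) ∈ Icc _ _ by
    have h1 := abs_le.1 (hest _ (left_mem_Icc.2 hle))
    have h2 := abs_le.1 (hest _ (right_mem_Icc.2 hle))
    constructor
    · nlinarith [h1.2]
    · nlinarith [h2.1])
  have hγc : γ (q x).fst = c := by
    have := hγZ (cart q ((q x).fst, c)) ⟨hball' c hc, hGc⟩
    rwa [(hcoord c).1, (hcoord c).2] at this
  have h1 := happ' x hxr _ (hball' c hc)
  have h2 := hnorm x (cart q ((q x).fst, c))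
  simp only at hGc
  rw [(hcoord c).1, (hcoord c).2, sub_self, norm_zero, zero_add] at h2
  rw [hGc, sub_zero, (hcoord c).2] at h1
  -- Along the vertical line through `x`, `G` differs from `α` times the height above the zero `c`
  -- by at most a quarter of that quantity, so it has the sign of that height.
  have h3 : |G x - α * ((q x).snd - c)| ≤ α / 4 * |(q x).snd - c| :=
    h1.trans (by gcongr)
  change G x < 0 ↔ (q x).snd < γ (q x).fst
  rw [hγc]
  rw [abs_le] at h3
  constructor
  · intro hlt
    by_contra hge
    push Not at hge
    rw [abs_of_nonneg (by linarith)] at h3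
    nlinarith [h3.1]
  · intro hlt
    rw [abs_of_neg (by linarith)] at h3
    nlinarith [h3.2]

theorem gradient_ne_zero {G : E → ℝ} {x : E} (h : fderiv ℝ G x ≠ 0) : gradient G x ≠ 0 := fun h0 =>
  h ((InnerProductSpace.toDual ℝ E).symm.map_eq_zero_iff.1 h0)

theorem inner_gradient {G : E → ℝ} (x v : E) : inner ℝ (gradient G x) v = fderiv ℝ G x v :=
  InnerProductSpace.toDual_symm_apply

theorem eventually_pos_of_hasDerivAt {f : ℝ → ℝ} {c : ℝ} (hf : HasDerivAt f c 0) (h0 : f 0 = 0)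
    (hc : 0 < c) : ∀ᶠ s in 𝓝[>] (0 : ℝ), 0 < f s := by
  have h1 := hf.tendsto_slope_zero_right
  simp only [zero_add, h0, sub_zero, smul_eq_mul] at h1
  filter_upwards [h1.eventually (lt_mem_nhds hc), self_mem_nhdsWithin] with s hs hs0
  have hs0 : 0 < s := hs0
  exact (pos_iff_pos_of_mul_pos hs).1 (inv_pos.2 hs0)

theorem hasDerivAt_comp_ray {G : E → ℝ} {x : E} (hG : DifferentiableAt ℝ G x) (v : E) :
    HasDerivAt (fun s : ℝ => G (x + s • v)) (inner ℝ (gradient G x) v) 0 := by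
  have h1 : HasDerivAt (fun s : ℝ => x + s • v) v 0 := by
    simpa using ((hasDerivAt_id (0:ℝ)).smul_const v).const_add x
  have h2 : HasFDerivAt G (fderiv ℝ G x) (x + (0:ℝ) • v) := by simpa using hG.hasFDerivAt
  rw [inner_gradient]
  exact h2.comp_hasDerivAt (0:ℝ) h1

theorem tendsto_ray (x v : E) : Tendsto (fun s : ℝ => x + s • v) (𝓝[>] 0) (𝓝 x) := by
  have : Continuous fun s : ℝ => x + s • v := by fun_prop
  have := this.tendsto 0
  simp only [zero_smul, add_zero] at this
  exact this.mono_left nhdsWithin_le_nhds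

theorem eventually_pos_ray {G : E → ℝ} {x v : E} (hG : DifferentiableAt ℝ G x) (h0 : G x = 0)
    (hv : 0 < inner ℝ (gradient G x) v) : ∀ᶠ s in 𝓝[>] (0 : ℝ), 0 < G (x + s • v) :=
  eventually_pos_of_hasDerivAt (hasDerivAt_comp_ray hG v) (by simpa using h0) hv

theorem eventually_neg_ray {G : E → ℝ} {x v : E} (hG : DifferentiableAt ℝ G x) (h0 : G x = 0)
    (hv : 0 < inner ℝ (gradient G x) v) : ∀ᶠ s in 𝓝[>] (0 : ℝ), G (x - s • v) < 0 := by
  have h1 := (hasDerivAt_comp_ray hG (-v)).neg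
  rw [inner_neg_right, neg_neg] at h1
  filter_upwards [eventually_pos_of_hasDerivAt h1 (by simpa using h0) hv] with s hs
  have : 0 < -G (x + s • (-v)) := hs
  rw [smul_neg, ← sub_eq_add_neg] at this
  linarith

theorem isOuterNormal_sublevel {G : E → ℝ} {x : E} {D : Set E} (hG : DifferentiableAt ℝ G x)
    (h0 : G x = 0) (hd : fderiv ℝ G x ≠ 0) (hD : ∀ᶠ y in 𝓝 x, y ∈ D ↔ G y < 0) :
    IsOuterNormal D x (‖gradient G x‖⁻¹ • gradient G x) := by
  set a := gradient G x with ha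
  have ha0 : 0 < ‖a‖ := norm_pos_iff.2 (gradient_ne_zero hd)
  refine ⟨by rw [norm_smul, norm_inv, norm_norm, inv_mul_cancel₀ ha0.ne'], fun ε hε => ?_⟩
  filter_upwards [hD, hG.hasFDerivAt.isLittleO.def (show 0 < ε * ‖a‖ by positivity)] with y hy h1
  rw [h0, sub_zero, Real.norm_eq_abs, ← inner_gradient, ← ha, real_inner_comm, abs_le] at h1
  rw [inner_smul_right, hy]
  constructor
  · intro h
    rw [inv_mul_le_iff₀ ha0]
    nlinarith
  · intro h
    rw [le_inv_mul_iff₀ ha0]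
    nlinarith

/-- At a zero of `G` the ray against the nonzero gradient enters the set, so the zero lies in its
closure, but not in the set itself. Where `G` is nonzero, continuity makes membership locally
constant. -/
theorem mem_frontier_sublevel_iff {G : E → ℝ} {x : E} {D : Set E} (hG : DifferentiableAt ℝ G x)
    (hd : fderiv ℝ G x ≠ 0) (hD : ∀ᶠ y in 𝓝 x, y ∈ D ↔ G y < 0) :
    x ∈ frontier D ↔ G x = 0 := by
  have ha0 : 0 < ‖gradient G x‖ := norm_pos_iff.2 (gradient_ne_zero hd)
  constructor
  · intro hx
    by_contra hne
    rcases lt_or_gt_of_ne hne with h | h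
    · refine hx.2 (mem_interior_iff_mem_nhds.2 ?_)
      filter_upwards [hD, hG.continuousAt.eventually (gt_mem_nhds h)] with y h1 h2
      exact h1.2 h2
    · have : ∀ᶠ y in 𝓝 x, y ∉ D := by
        filter_upwards [hD, hG.continuousAt.eventually (lt_mem_nhds h)] with y h1 h2 h3
        exact absurd (h1.1 h3) (not_lt.2 h2.le)
      exact (mem_closure_iff_frequently.1 hx.1) this
  · intro h0
    refine ⟨?_, fun h => ?_⟩
    · have h1 := eventually_neg_ray (v := gradient G x) hG h0 (by
        rw [real_inner_self_eq_norm_sq]; positivity)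
      have h2 : Tendsto (fun s : ℝ => x - s • gradient G x) (𝓝[>] 0) (𝓝 x) := by
        have := tendsto_ray x (-gradient G x)
        simpa only [smul_neg, ← sub_eq_add_neg] using this
      refine mem_closure_of_tendsto h2 ?_
      filter_upwards [h1, h2.eventually hD] with s hs hs2
      exact hs2.2 hs
    · have := hD.self_of_nhds.1 (interior_subset h)
      linarith

theorem IsGaussNhd.mono {D U U' : Set E} (h : IsGaussNhd D U) (hU' : IsOpen U') (hs : U' ⊆ U) :
    IsGaussNhd D U' where
  isOpen := hU'
  area_lt := (measure_mono (inter_subset_inter_right _ hs)).trans_lt h.area_lt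
  normal := ae_restrict_of_ae_restrict_of_subset (inter_subset_inter_right _ hs) h.normal
  meas := h.meas.mono_set (inter_subset_inter_right _ hs)
  gauss φ h1 h2 h3 u := h.gauss φ h1 h2 (h3.trans hs) u

/-! ### Divergence of vector fields -/

/-- The standard orthonormal basis, as a basis. -/
noncomputable def eBasis : OrthonormalBasis (Fin 3) ℝ E :=
  (EuclideanSpace.basisFun (Fin 3) ℝ).map coords.symm

theorem eBasis_apply (i : Fin 3) : eBasis i = e i := by
  simp [eBasis, e]

theorem tr_eq_sum (A : Tensor) : tr A = ∑ i, inner ℝ (e i) (A (e i)) := by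
  rw [tr, LinearMap.trace_eq_sum_inner _ eBasis]
  simp [eBasis_apply]

theorem tr_smulRight (l : E →L[ℝ] ℝ) (v : E) : tr (l.smulRight v) = l v := by
  rw [tr_eq_sum]
  conv_rhs => rw [← eBasis.sum_repr' v, map_sum]
  refine Finset.sum_congr rfl fun i _ => ?_
  rw [ContinuousLinearMap.smulRight_apply, inner_smul_right, map_smul, eBasis_apply, smul_eq_mul,
    mul_comm]

theorem tr_add (A B : Tensor) : tr (A + B) = tr A + tr B := by
  simp [tr]

theorem tr_smul (c : ℝ) (A : Tensor) : tr (c • A) = c * tr A := by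
  simp [tr]

theorem continuous_tr : Continuous tr := by
  have : tr = fun A : Tensor => ∑ i, inner ℝ (e i) (A (e i)) := funext tr_eq_sum
  rw [this]
  fun_prop

theorem divVec_smul {φ : E → ℝ} {V : E → E} {x : E} (hφ : DifferentiableAt ℝ φ x)
    (hV : DifferentiableAt ℝ V x) :
    divVec (fun y => φ y • V y) x = fderiv ℝ φ x (V x) + φ x * divVec V x := by
  rw [divVec, fderiv_fun_smul hφ hV, tr_add, tr_smul, tr_smulRight, divVec]
  ring

/-- The scalar divergence theorem is applied to the component along each basis vector, in the
direction of that vector, and the results are summed. -/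
theorem IsGaussNhd.gauss_vec {D U : Set E} (h : IsGaussNhd D U) {W : E → E} (hW : ContDiff ℝ 1 W)
    (hc : HasCompactSupport W) (hU : tsupport W ⊆ U) :
    Integrable (divVec W) ∧
    IntegrableOn (fun x => inner ℝ (outerNormal D x) (W x)) (frontier D) area ∧
    ∫ x in D, divVec W x = ∫ x in frontier D, inner ℝ (outerNormal D x) (W x) ∂area := by
  let f : Fin 3 → E → ℝ := fun i x => inner ℝ (e i) (W x)
  have hf : ∀ i, ContDiff ℝ 1 (f i) := fun i => contDiff_const.inner ℝ hW
  have hts : ∀ i, tsupport (f i) ⊆ tsupport W := fun i => closure_mono fun x hx hWx => hx (by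
    simp only [f]
    rw [hWx, inner_zero_right])
  have hfc : ∀ i, HasCompactSupport (f i) := fun i => hc.of_isClosed_subset
    (isClosed_tsupport _) (hts i)
  have e1 : ∀ x, divVec W x = ∑ i, fderiv ℝ (f i) x (e i) := fun x => by
    rw [divVec, tr_eq_sum]
    refine Finset.sum_congr rfl fun i _ => ?_
    have := (hW.differentiable one_ne_zero x).hasFDerivAt
    have h2 : HasFDerivAt (f i) ((innerSL ℝ (e i)).comp (fderiv ℝ W x)) x :=
      (innerSL ℝ (e i)).hasFDerivAt.comp x this
    rw [h2.fderiv]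
    rfl
  have e2 : ∀ x, inner ℝ (outerNormal D x) (W x) = ∑ i, f i x * inner ℝ (outerNormal D x) (e i) :=
    fun x => by
      rw [← eBasis.sum_inner_mul_inner]
      refine Finset.sum_congr rfl fun i _ => ?_
      rw [eBasis_apply, mul_comm]
  have hint : ∀ i, Integrable fun x => fderiv ℝ (f i) x (e i) := fun i => by
    have h1 : Continuous fun x => fderiv ℝ (f i) x (e i) := by
      have := (hf i).continuous_fderiv one_ne_zero
      fun_prop
    exact h1.integrable_of_hasCompactSupport ((hfc i).fderiv_apply ℝ (e i))
  have hint2 := fun i => h.integrableOn (hf i).continuous (hfc i) ((hts i).trans hU) (e i)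
  have e1' : divVec W = fun x => ∑ i, fderiv ℝ (f i) x (e i) := funext e1
  rw [e1']
  simp only [e2]
  refine ⟨integrable_finsetSum _ fun i _ => hint i, integrable_finsetSum _ fun i _ => hint2 i, ?_⟩
  rw [integral_finsetSum _ fun i _ => (hint i).integrableOn,
    integral_finsetSum _ fun i _ => hint2 i]
  exact Finset.sum_congr rfl fun i _ => h.gauss _ (hf i) (hfc i) ((hts i).trans hU) (e i)

end Poro

namespace Poro

/-! ### Piecewise continuous fields -/

/-- The field `f` is continuous on `B` off `S` and locally bounded off `S`. -/
structure IsPwCont {F : Type*} [NormedAddCommGroup F] (B S : Set E) (f : E → F) : Prop where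
  isOpen : IsOpen B
  isOpen_diff : IsOpen (B \ S)
  null : volume S = 0
  cont : ContinuousOn f (B \ S)
  bdd : ∀ x ∈ B, ∃ C : ℝ, ∀ᶠ y in 𝓝 x, y ∉ S → ‖f y‖ ≤ C

/-- Local bounds on a compact set are finitely many. The restriction `P` lets the field be arbitrary
on the interface. -/
theorem exists_bound_of_locally {X F : Type*} [TopologicalSpace X] [NormedAddCommGroup F] {K : Set X}
    (hK : IsCompact K) {P : X → Prop} {f : X → F}
    (h : ∀ x ∈ K, ∃ C : ℝ, ∀ᶠ y in 𝓝 x, P y → ‖f y‖ ≤ C) :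
    ∃ C : ℝ, 0 ≤ C ∧ ∀ᶠ y in 𝓝ˢ K, P y → ‖f y‖ ≤ C := by
  refine hK.induction_on (p := fun s => ∃ C : ℝ, 0 ≤ C ∧ ∀ᶠ y in 𝓝ˢ s, P y → ‖f y‖ ≤ C)
    ⟨0, le_rfl, by simp⟩ (fun s t hst ⟨C, h0, hC⟩ => ⟨C, h0, hC.filter_mono (nhdsSet_mono hst)⟩) ?_ ?_
  · rintro s t ⟨C, h0, hC⟩ ⟨C', h0', hC'⟩
    refine ⟨max C C', le_max_of_le_left h0, ?_⟩
    rw [nhdsSet_union, eventually_sup]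
    exact ⟨hC.mono fun y hy hP => (hy hP).trans (le_max_left _ _),
      hC'.mono fun y hy hP => (hy hP).trans (le_max_right _ _)⟩
  · intro x hx
    obtain ⟨C, hC⟩ := h x hx
    obtain ⟨U, hU, hUo, hxU⟩ := eventually_nhds_iff.1 hC
    refine ⟨U, nhdsWithin_le_nhds (hUo.mem_nhds hxU), max C 0, le_max_right _ _, ?_⟩
    rw [hUo.nhdsSet_eq]
    exact fun y hy hP => (hU y hy hP).trans (le_max_left _ _)

section PwCont

variable {F : Type*} [NormedAddCommGroup F] {B S : Set E} {f : E → F}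

theorem IsPwCont.exists_bound (h : IsPwCont B S f) {K : Set E} (hK : IsCompact K) (hKB : K ⊆ B) :
    ∃ C : ℝ, 0 ≤ C ∧ ∀ y ∈ K, y ∉ S → ‖f y‖ ≤ C := by
  obtain ⟨C, h0, hC⟩ := exists_bound_of_locally (P := fun y => y ∉ S) hK fun x hx => h.bdd x (hKB hx)
  exact ⟨C, h0, fun y hy => (eventually_nhdsSet_iff_forall.1 hC y hy).self_of_nhds⟩

/-- A bounded, compactly supported and measurable field that agrees with a piecewise continuous
one near a compact set, off the interface. -/
theorem IsPwCont.exists_truncation [MeasurableSpace F] [BorelSpace F] [SecondCountableTopology F]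
    (h : IsPwCont B S f) {U : Set E} (hU : IsOpen U) (hUc : IsCompact (closure U))
    (hUB : closure U ⊆ B) :
    ∃ C : ℝ, 0 ≤ C ∧ (∀ x, ‖(U \ S).indicator f x‖ ≤ C) ∧ Measurable ((U \ S).indicator f) ∧
      Integrable ((U \ S).indicator f) := by
  obtain ⟨C, h0, hC⟩ := h.exists_bound hUc hUB
  have hUS : IsOpen (U \ S) := by
    have : U \ S = U ∩ (B \ S) := by
      ext x; exact ⟨fun hx => ⟨hx.1, hUB (subset_closure hx.1), hx.2⟩, fun hx => ⟨hx.1, hx.2.2⟩⟩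
    rw [this]; exact hU.inter h.isOpen_diff
  have hb : ∀ x, ‖(U \ S).indicator f x‖ ≤ C := fun x => by
    by_cases hx : x ∈ U \ S
    · rw [indicator_of_mem hx]; exact hC x (subset_closure hx.1) hx.2
    · rwa [indicator_of_notMem hx, norm_zero]
  have hm : Measurable ((U \ S).indicator f) := by
    have hc : ContinuousOn f (U \ S) := h.cont.mono fun x hx => ⟨hUB (subset_closure hx.1), hx.2⟩
    classical
    have := hc.measurable_piecewise (g := (0 : E → F)) continuous_zero.continuousOn hUS.measurableSet
    rwa [piecewise_eq_indicator] at this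
  refine ⟨C, h0, hb, hm, ?_⟩
  have h1 : IntegrableOn ((U \ S).indicator f) (closure U) :=
    Measure.integrableOn_of_bounded hUc.measure_lt_top.ne hm.aestronglyMeasurable
      (Eventually.of_forall hb)
  refine (integrableOn_iff_integrable_of_support_subset fun x hx => ?_).1 h1
  by_contra hn
  exact hx (indicator_of_notMem (fun h => hn (subset_closure h.1)) _)

theorem IsPwCont.integrableOn [MeasurableSpace F] [BorelSpace F] [SecondCountableTopology F]
    (h : IsPwCont B S f) {Ω : Set E} (hΩ : IsOpen Ω) (hb : Bornology.IsBounded Ω)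
    (hΩB : closure Ω ⊆ B) : IntegrableOn f Ω := by
  obtain ⟨C, -, -, -, hi⟩ := h.exists_truncation hΩ hb.isCompact_closure hΩB
  refine (hi.integrableOn (s := Ω)).congr ?_
  rw [EventuallyEq, ae_restrict_iff' hΩ.measurableSet]
  filter_upwards [measure_eq_zero_iff_ae_notMem.1 h.null] with x hx hxΩ
  exact indicator_of_mem (show x ∈ Ω \ S from ⟨hxΩ, hx⟩) f

/-- The boundary has finite area and the field is bounded there off `S`; the part of the boundary on
`S` has zero area. -/
theorem IsPwCont.integrableOn_frontier {f : E → E}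
    (h : IsPwCont B S f) {Ω : Set E} (hΩ : IsLipschitzDomain Ω)
    (hΩB : closure Ω ⊆ B) (hcross : area (frontier Ω ∩ S) = 0) :
    IntegrableOn (fun x => inner ℝ (outerNormal Ω x) (f x)) (frontier Ω) area := by
  obtain ⟨U, hU, hΩU, hUB, hUc⟩ := exists_open_between_and_isCompact_closure
    hΩ.2.1.isCompact_closure h.isOpen hΩB
  obtain ⟨C, h0, hC, hm, -⟩ := h.exists_truncation hU hUc hUB
  have hG := hΩ.isGaussNhd
  have hmeas := hG.meas
  have hnormal := hG.normal
  have hlt := hG.area_lt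
  rw [inter_univ] at hmeas hnormal hlt
  have : IsFiniteMeasure (area.restrict (frontier Ω)) :=
    ⟨by rw [Measure.restrict_apply_univ]; exact hlt⟩
  have h1 : IntegrableOn (fun x => inner ℝ (outerNormal Ω x) ((U \ S).indicator f x))
      (frontier Ω) area := by
    refine Integrable.of_bound (hmeas.inner hm.aestronglyMeasurable) C ?_
    filter_upwards [hnormal] with x hx
    refine (norm_inner_le_norm _ _).trans ?_
    rw [hx.1, one_mul]
    exact hC x
  refine h1.congr ?_
  rw [EventuallyEq, ae_restrict_iff' isClosed_frontier.measurableSet]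
  filter_upwards [measure_eq_zero_iff_ae_notMem.1 hcross] with x hx hxΩ
  rw [indicator_of_mem (show x ∈ U \ S from
    ⟨hΩU (frontier_subset_closure hxΩ), fun hS => hx ⟨hxΩ, hS⟩⟩)]

end PwCont

/-! ### Piecewise smooth fields and the divergence theorem across a surface -/

/-- In the open set `U`, the surface `S` is the zero set of `G`, oriented by the gradient. -/
structure IsSurfaceChart (S : Set E) (m : E → E) (G : E → ℝ) (U : Set E) : Prop where
  isOpen : IsOpen U
  contDiffOn : ContDiffOn ℝ 1 G U
  fderiv_ne : ∀ x ∈ U, fderiv ℝ G x ≠ 0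
  mem_iff : ∀ x ∈ U, x ∈ S ↔ G x = 0
  normal : ∀ x ∈ U, x ∈ S → m x = ‖gradient G x‖⁻¹ • gradient G x

namespace IsSurfaceChart

variable {S : Set E} {m : E → E} {G : E → ℝ} {U : Set E}

theorem contDiffAt (h : IsSurfaceChart S m G U) {x : E} (hx : x ∈ U) : ContDiffAt ℝ 1 G x :=
  h.contDiffOn.contDiffAt (h.isOpen.mem_nhds hx)

theorem differentiableAt (h : IsSurfaceChart S m G U) {x : E} (hx : x ∈ U) :
    DifferentiableAt ℝ G x := (h.contDiffAt hx).differentiableAt one_ne_zero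

theorem inner_normal_pos (h : IsSurfaceChart S m G U) {x : E} (hx : x ∈ U) (hxS : x ∈ S) :
    0 < inner ℝ (gradient G x) (m x) := by
  have h0 : 0 < ‖gradient G x‖ := norm_pos_iff.2 (gradient_ne_zero (h.fderiv_ne x hx))
  rw [h.normal x hx hxS, inner_smul_right, real_inner_self_eq_norm_sq]
  positivity

theorem tracePlus_eq {F : Type*} [TopologicalSpace F] [T2Space F] [Nonempty F]
    (h : IsSurfaceChart S m G U) {x : E} (hx : x ∈ U) (hxS : x ∈ S) {f : E → F} {a : F}
    (hf : Tendsto f (𝓝[{y | 0 < G y}] x) (𝓝 a)) :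
    Tendsto (fun s : ℝ => f (x + s • m x)) (𝓝[>] 0) (𝓝 a) := by
  refine hf.comp (tendsto_nhdsWithin_iff.2 ⟨tendsto_ray x (m x), ?_⟩)
  exact eventually_pos_ray (h.differentiableAt hx) ((h.mem_iff x hx).1 hxS)
    (h.inner_normal_pos hx hxS)

theorem traceMinus_eq {F : Type*} [TopologicalSpace F] [T2Space F] [Nonempty F]
    (h : IsSurfaceChart S m G U) {x : E} (hx : x ∈ U) (hxS : x ∈ S) {f : E → F} {a : F}
    (hf : Tendsto f (𝓝[{y | G y < 0}] x) (𝓝 a)) :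
    Tendsto (fun s : ℝ => f (x - s • m x)) (𝓝[>] 0) (𝓝 a) := by
  have h2 : Tendsto (fun s : ℝ => x - s • m x) (𝓝[>] 0) (𝓝 x) := by
    have := tendsto_ray x (-m x)
    simpa only [smul_neg, ← sub_eq_add_neg] using this
  refine hf.comp (tendsto_nhdsWithin_iff.2 ⟨h2, ?_⟩)
  exact eventually_neg_ray (h.differentiableAt hx) ((h.mem_iff x hx).1 hxS)
    (h.inner_normal_pos hx hxS)

end IsSurfaceChart

/-- `V` is a `C¹` field on `B` off the surface `S`, and up to it from either side. -/
structure IsPwC1 (B S : Set E) (m V : E → E) : Prop where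
  isOpen : IsOpen B
  isOpen_diff : IsOpen (B \ S)
  subset : S ⊆ B
  smooth : ∀ x ∈ B \ S, ContDiffAt ℝ 1 V x
  sides : ∀ x ∈ S, ∃ (G : E → ℝ) (U : Set E) (Vp Vm : E → E), x ∈ U ∧ IsSurfaceChart S m G U ∧
    ContDiffOn ℝ 1 Vp U ∧ ContDiffOn ℝ 1 Vm U ∧
    ∀ y ∈ U, (0 < G y → V y = Vp y) ∧ (G y < 0 → V y = Vm y)

/-- The normal component of the jump. -/
noncomputable def normalJump (m V : E → E) (x : E) : ℝ := inner ℝ (jump (m x) V x) (m x)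

theorem contDiff_smul_of_tsupport {φ : E → ℝ} {V : E → E} {U : Set E} (hφ : ContDiff ℝ 1 φ)
    (hU : IsOpen U) (hV : ContDiffOn ℝ 1 V U) (hs : tsupport φ ⊆ U) :
    ContDiff ℝ 1 fun x => φ x • V x := by
  rw [contDiff_iff_contDiffAt]
  intro x
  by_cases hx : x ∈ tsupport φ
  · exact hφ.contDiffAt.smul (hV.contDiffAt (hU.mem_nhds (hs hx)))
  · refine (contDiffAt_const (c := (0 : E))).congr_of_eventuallyEq ?_
    filter_upwards [notMem_tsupport_iff_eventuallyEq.1 hx] with y hy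
    simp [hy]

theorem divVec_congr {V V' : E → E} {x : E} (h : V =ᶠ[𝓝 x] V') : divVec V x = divVec V' x := by
  rw [divVec, divVec, h.fderiv_eq]

theorem divVec_eq_zero_of_notMem_tsupport {φ : E → ℝ} {V : E → E} {x : E} (hx : x ∉ tsupport φ) :
    divVec (fun y => φ y • V y) x = 0 := by
  have : (fun y => φ y • V y) =ᶠ[𝓝 x] fun _ => 0 := by
    filter_upwards [notMem_tsupport_iff_eventuallyEq.1 hx] with y hy
    simp [hy]
  rw [divVec_congr this]
  simp [divVec, tr]

/-- The weak divergence theorem across a surface, for the test function `φ`. -/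
def WeakGauss (S : Set E) (m V : E → E) (φ : E → ℝ) : Prop :=
  Differentiable ℝ φ ∧
  Integrable (fun x => fderiv ℝ φ x (V x) + φ x * divVec V x) ∧
  IntegrableOn (fun x => φ x * normalJump m V x) S area ∧
  ∫ x, (fderiv ℝ φ x (V x) + φ x * divVec V x) = -∫ x in S, φ x * normalJump m V x ∂area

theorem WeakGauss.add {S : Set E} {m V : E → E} {φ ψ : E → ℝ} (h : WeakGauss S m V φ)
    (h' : WeakGauss S m V ψ) : WeakGauss S m V (φ + ψ) := by
  obtain ⟨h1, h2, h3, h4⟩ := h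
  obtain ⟨h1', h2', h3', h4'⟩ := h'
  have e1 : ∀ x, fderiv ℝ (φ + ψ) x (V x) + (φ + ψ) x * divVec V x =
      (fderiv ℝ φ x (V x) + φ x * divVec V x) + (fderiv ℝ ψ x (V x) + ψ x * divVec V x) :=
    fun x => by
      rw [fderiv_add (h1 x) (h1' x), Pi.add_apply, add_apply]; ring
  have e2 : ∀ x, (φ + ψ) x * normalJump m V x =
      φ x * normalJump m V x + ψ x * normalJump m V x := fun x => by
    rw [Pi.add_apply]; ring
  unfold WeakGauss
  simp only [e1, e2]
  refine ⟨h1.add h1', h2.add h2', h3.add h3', ?_⟩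
  rw [integral_add h2 h2', integral_add h3 h3', h4, h4']
  ring

/-- Away from `S` the product of `φ` and `V` is a compactly supported `C¹` field, and the integral
of its divergence over the whole space is zero. -/
theorem IsPwC1.weakGauss_off {B S : Set E} {m V : E → E} (h : IsPwC1 B S m V) {φ : E → ℝ}
    (hφ : ContDiff ℝ 1 φ) (hc : HasCompactSupport φ) (hs : tsupport φ ⊆ B \ S) :
    WeakGauss S m V φ := by
  have hφ0 : ∀ x ∉ tsupport φ, φ x = 0 := fun x hx => image_eq_zero_of_notMem_tsupport hx
  have hV : ContDiffOn ℝ 1 V (B \ S) := fun x hx => (h.smooth x hx).contDiffWithinAt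
  have hW := contDiff_smul_of_tsupport hφ h.isOpen_diff hV hs
  have hWc : HasCompactSupport fun x => φ x • V x := hc.smul_right
  have e1 : ∀ x, fderiv ℝ φ x (V x) + φ x * divVec V x = divVec (fun y => φ y • V y) x := by
    intro x
    by_cases hx : x ∈ tsupport φ
    · rw [divVec_smul (hφ.differentiable one_ne_zero x)
        ((h.smooth x (hs hx)).differentiableAt one_ne_zero)]
    · rw [divVec_eq_zero_of_notMem_tsupport hx, hφ0 x hx]
      have : fderiv ℝ φ x = 0 := image_eq_zero_of_notMem_tsupport fun h =>
        hx (tsupport_fderiv_subset ℝ h)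
      simp [this]
  have hS : ∀ x ∈ S, φ x * normalJump m V x = 0 := fun x hx => by
    rw [hφ0 x fun h => (hs h).2 hx, zero_mul]
  have hg : IsGaussNhd (univ : Set E) univ := by
    refine ⟨isOpen_univ, by simp, by simp, by simp, fun φ hφ hc _ u => ?_⟩
    simp [integral_fderiv_eq_zero hφ hc u]
  obtain ⟨g1, -, g3⟩ := hg.gauss_vec hW hWc (subset_univ _)
  unfold WeakGauss
  simp only [e1]
  refine ⟨hφ.differentiable one_ne_zero, g1, ?_, ?_⟩
  · refine (integrableOn_zero (ε' := ℝ) (μ := area) (s := S)).congr ?_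
    have : ∀ᵐ x ∂area.restrict S, x ∉ tsupport φ := by
      rw [ae_iff]
      simp only [not_not, ofPred_mem_eq]
      rw [Measure.restrict_apply (isClosed_tsupport φ).measurableSet,
        (disjoint_left.2 fun x hx hxS => (hs hx).2 hxS).inter_eq, measure_empty]
    filter_upwards [this] with x hx
    rw [hφ0 x hx, zero_mul]
  · rw [setIntegral_eq_zero_of_forall_eq_zero hS]
    simpa using g3

/-- Near a point of `S` the sides `{G < 0}` and `{G > 0}` are Lipschitz subgraphs with boundary `S`.
The divergence theorem is applied on each side to `φ` times the smooth extension from that side. The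
outward normals are `m` and `-m`, so the boundary terms add up to minus the jump. -/
theorem IsPwC1.weakGauss_at {B S : Set E} {m V : E → E} (h : IsPwC1 B S m V) {x₀ : E} (hx₀ : x₀ ∈ S) :
    ∃ U ∈ 𝓝 x₀, volume (S ∩ U) = 0 ∧ ∀ φ : E → ℝ, ContDiff ℝ 1 φ → HasCompactSupport φ →
      tsupport φ ⊆ U → WeakGauss S m V φ := by
  obtain ⟨G, U₀, Vp, Vm, hx₀U, hch, hVp, hVm, hV⟩ := h.sides x₀ hx₀
  have hU₀ := hch.isOpen
  set Dm : Set E := {y | y ∈ U₀ ∧ G y < 0} with hDm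
  set Dp : Set E := {y | y ∈ U₀ ∧ -G y < 0} with hDp
  have hDmo : IsOpen Dm := hch.contDiffOn.continuousOn.isOpen_inter_preimage hU₀ isOpen_Iio
  have hDpo : IsOpen Dp := hch.contDiffOn.continuousOn.neg.isOpen_inter_preimage hU₀ isOpen_Iio
  have hG0 := (hch.mem_iff x₀ hx₀U).1 hx₀
  have hevm : ∀ x ∈ U₀, ∀ᶠ y in 𝓝 x, y ∈ Dm ↔ G y < 0 := fun x hx => by
    filter_upwards [hU₀.mem_nhds hx] with y hy using and_iff_right hy
  have hevp : ∀ x ∈ U₀, ∀ᶠ y in 𝓝 x, y ∈ Dp ↔ -G y < 0 := fun x hx => by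
    filter_upwards [hU₀.mem_nhds hx] with y hy using and_iff_right hy
  have hnegd : ∀ x, fderiv ℝ (fun y => -G y) x = -fderiv ℝ G x := fun x => fderiv_fun_neg
  have hnegg : ∀ x, gradient (fun y => -G y) x = -gradient G x := fun x => by
    rw [gradient, hnegd, map_neg]; rfl
  have hnear : ∀ {D : Set E} {H : E → ℝ}, (∀ᶠ y in 𝓝 x₀, y ∈ D ↔ H y < 0) →
      IsSubgraphNear {y | H y < 0} x₀ → IsSubgraphNear D x₀ := by
    rintro D H hD ⟨q, γ, K, h1, h2⟩
    refine ⟨q, γ, K, h1, ?_⟩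
    filter_upwards [hD, h2] with y hy hy2
    rw [hy, ← hy2]
  obtain ⟨U₁, hU₁, hg₁⟩ := (hnear (hevm x₀ hx₀U) (isSubgraphNear_sublevel (hch.contDiffAt hx₀U) hG0
    (hch.fderiv_ne x₀ hx₀U))).exists_isGaussNhd
  obtain ⟨U₂, hU₂, hg₂⟩ := (hnear (hevp x₀ hx₀U) (isSubgraphNear_sublevel (G := fun y => -G y)
    (hch.contDiffAt hx₀U).neg (by simp [hG0]) (by
      rw [hnegd]; exact neg_ne_zero.2 (hch.fderiv_ne x₀ hx₀U)))).exists_isGaussNhd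
  let U : Set E := U₀ ∩ (U₁ ∩ U₂)
  have hU : IsOpen U := hU₀.inter (hg₁.isOpen.inter hg₂.isOpen)
  have hgm : IsGaussNhd Dm U := hg₁.mono hU fun x hx => hx.2.1
  have hgp : IsGaussNhd Dp U := hg₂.mono hU fun x hx => hx.2.2
  have hfrm : ∀ x ∈ U₀, x ∈ frontier Dm ↔ x ∈ S := fun x hx => by
    rw [mem_frontier_sublevel_iff (hch.differentiableAt hx) (hch.fderiv_ne x hx) (hevm x hx),
      hch.mem_iff x hx]
  have hfrp : ∀ x ∈ U₀, x ∈ frontier Dp ↔ x ∈ S := fun x hx => by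
    rw [mem_frontier_sublevel_iff (G := fun y => -G y) (hch.differentiableAt hx).neg
      (by rw [hnegd]; exact neg_ne_zero.2 (hch.fderiv_ne x hx)) (hevp x hx),
      hch.mem_iff x hx, neg_eq_zero]
  have hSm : S ∩ U = frontier Dm ∩ U := by
    ext x; exact and_congr_left fun hx => (hfrm x hx.1).symm
  have hSp : S ∩ U = frontier Dp ∩ U := by
    ext x; exact and_congr_left fun hx => (hfrp x hx.1).symm
  have hnm : ∀ x ∈ S ∩ U, outerNormal Dm x = m x := fun x hx => by
    rw [outerNormal_eq (isOuterNormal_sublevel (hch.differentiableAt hx.2.1)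
      ((hch.mem_iff x hx.2.1).1 hx.1) (hch.fderiv_ne x hx.2.1) (hevm x hx.2.1)),
      hch.normal x hx.2.1 hx.1]
  have hnp : ∀ x ∈ S ∩ U, outerNormal Dp x = -m x := fun x hx => by
    rw [outerNormal_eq (isOuterNormal_sublevel (G := fun y => -G y)
      (hch.differentiableAt hx.2.1).neg (by simp [(hch.mem_iff x hx.2.1).1 hx.1])
      (by rw [hnegd]; exact neg_ne_zero.2 (hch.fderiv_ne x hx.2.1)) (hevp x hx.2.1)),
      hch.normal x hx.2.1 hx.1, hnegg, norm_neg, smul_neg]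
  have hjump : ∀ x ∈ S ∩ U, jump (m x) V x = Vp x - Vm x := fun x hx => by
    have hxU := hx.2.1
    have hn := hU₀.mem_nhds hxU
    have t1 : Tendsto V (𝓝[{y | 0 < G y}] x) (𝓝 (Vp x)) := by
      refine (((hVp.contDiffAt hn).continuousAt.tendsto).mono_left nhdsWithin_le_nhds).congr' ?_
      filter_upwards [self_mem_nhdsWithin, mem_nhdsWithin_of_mem_nhds hn] with y hy hyU
      exact ((hV y hyU).1 hy).symm
    have t2 : Tendsto V (𝓝[{y | G y < 0}] x) (𝓝 (Vm x)) := by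
      refine (((hVm.contDiffAt hn).continuousAt.tendsto).mono_left nhdsWithin_le_nhds).congr' ?_
      filter_upwards [self_mem_nhdsWithin, mem_nhdsWithin_of_mem_nhds hn] with y hy hyU
      exact ((hV y hyU).2 hy).symm
    rw [jump, tracePlus, traceMinus, (hch.tracePlus_eq hxU hx.1 t1).limUnder_eq,
      (hch.traceMinus_eq hxU hx.1 t2).limUnder_eq]
  have hnull : volume (S ∩ U) = 0 := hSm ▸ hgm.volume_frontier
  refine ⟨U, hU.mem_nhds ⟨hx₀U, mem_of_mem_nhds hU₁, mem_of_mem_nhds hU₂⟩, hnull,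
    fun φ hφ hc hs => ?_⟩
  have hs₀ : tsupport φ ⊆ U₀ := hs.trans inter_subset_left
  have hφ0 : ∀ x ∉ tsupport φ, φ x = 0 := fun x hx => image_eq_zero_of_notMem_tsupport hx
  have hφU : ∀ x ∉ U, φ x = 0 := fun x hx => hφ0 x fun h => hx (hs h)
  obtain ⟨m1, m2, m3⟩ := hgm.gauss_vec (contDiff_smul_of_tsupport hφ hU₀ hVm hs₀)
    hc.smul_right ((tsupport_smul_subset_left φ Vm).trans hs)
  obtain ⟨p1, p2, p3⟩ := hgp.gauss_vec (contDiff_smul_of_tsupport hφ hU₀ hVp hs₀)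
    hc.smul_right ((tsupport_smul_subset_left φ Vp).trans hs)
  -- Off the null set `S`, on each side the field agrees near the point with the extension from that
  -- side, so the product rule identifies the integrand with a divergence.
  have key : (fun x => fderiv ℝ φ x (V x) + φ x * divVec V x) =ᵐ[volume] fun x =>
      Dm.indicator (divVec fun y => φ y • Vm y) x + Dp.indicator (divVec fun y => φ y • Vp y) x := by
    filter_upwards [measure_eq_zero_iff_ae_notMem.1 hnull] with x hx
    by_cases hxs : x ∈ tsupport φ
    · have hxU := hs hxs
      have hxS : x ∉ S := fun h => hx ⟨h, hxU⟩
      have hG : G x ≠ 0 := fun h => hxS ((hch.mem_iff x hxU.1).2 h)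
      have hd : ∀ V', ContDiffOn ℝ 1 V' U₀ → V =ᶠ[𝓝 x] V' →
          fderiv ℝ φ x (V x) + φ x * divVec V x = divVec (fun y => φ y • V' y) x := by
        intro V' hV' he
        rw [divVec_smul (hφ.differentiable one_ne_zero x)
          ((hV'.contDiffAt (hU₀.mem_nhds hxU.1)).differentiableAt one_ne_zero), divVec_congr he,
          he.self_of_nhds]
      rcases lt_or_gt_of_ne hG with hlt | hgt
      · have hxm : x ∈ Dm := ⟨hxU.1, hlt⟩
        have hxp : x ∉ Dp := fun h => by linarith [h.2]
        rw [indicator_of_mem hxm, indicator_of_notMem hxp, add_zero]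
        refine hd Vm hVm ?_
        filter_upwards [hDmo.mem_nhds hxm] with y hy
        exact (hV y hy.1).2 hy.2
      · have hxp : x ∈ Dp := ⟨hxU.1, by linarith⟩
        have hxm : x ∉ Dm := fun h => by linarith [h.2]
        rw [indicator_of_notMem hxm, indicator_of_mem hxp, zero_add]
        refine hd Vp hVp ?_
        filter_upwards [hDpo.mem_nhds hxp] with y hy
        exact (hV y hy.1).1 (by linarith [hy.2])
    · have h1 : fderiv ℝ φ x = 0 := image_eq_zero_of_notMem_tsupport fun h =>
        hxs (tsupport_fderiv_subset ℝ h)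
      have h2 : ∀ (D : Set E) (V' : E → E), D.indicator (divVec fun y => φ y • V' y) x = 0 :=
        fun D V' => by
          by_cases hxD : x ∈ D
          · rw [indicator_of_mem hxD, divVec_eq_zero_of_notMem_tsupport hxs]
          · exact indicator_of_notMem hxD _
      rw [h1, hφ0 x hxs, h2, h2]
      simp
  have i1 : Integrable (Dm.indicator (divVec fun y => φ y • Vm y)) := m1.indicator hDmo.measurableSet
  have i2 : Integrable (Dp.indicator (divVec fun y => φ y • Vp y)) := p1.indicator hDpo.measurableSet
  have hloc : ∀ {A : Set E} {f : E → ℝ}, (∀ x ∉ U, f x = 0) →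
      ∫ x in A, f x ∂area = ∫ x in A ∩ U, f x ∂area := fun {A f} hf => by
    rw [inter_comm, ← Measure.restrict_restrict hU.measurableSet]
    exact (setIntegral_eq_integral_of_forall_compl_eq_zero hf).symm
  have hlocI : ∀ {A : Set E} {f : E → ℝ}, (∀ x ∉ U, f x = 0) →
      (IntegrableOn f A area ↔ IntegrableOn f (A ∩ U) area) := fun {A f} hf => by
    rw [IntegrableOn, IntegrableOn, inter_comm, ← Measure.restrict_restrict hU.measurableSet]
    exact (integrableOn_iff_integrable_of_support_subset fun x hx => by
      by_contra hn; exact hx (hf x hn)).symm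
  have z1 : ∀ x ∉ U, inner ℝ (outerNormal Dm x) (φ x • Vm x) = 0 := fun x hx => by simp [hφU x hx]
  have z2 : ∀ x ∉ U, inner ℝ (outerNormal Dp x) (φ x • Vp x) = 0 := fun x hx => by simp [hφU x hx]
  have z3 : ∀ x ∉ U, φ x * normalJump m V x = 0 := fun x hx => by simp [hφU x hx]
  have hSmeas : MeasurableSet (S ∩ U) := by
    rw [hSm]; exact isClosed_frontier.measurableSet.inter hU.measurableSet
  have m2' : IntegrableOn (fun x => inner ℝ (m x) (φ x • Vm x)) (S ∩ U) area := by
    rw [hlocI z1, ← hSm] at m2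
    exact m2.congr_fun (fun x hx => by simp only [hnm x hx]) hSmeas
  have p2' : IntegrableOn (fun x => -inner ℝ (m x) (φ x • Vp x)) (S ∩ U) area := by
    rw [hlocI z2, ← hSp] at p2
    exact p2.congr_fun (fun x hx => by simp only [hnp x hx, inner_neg_left]) hSmeas
  have hj : ∀ x ∈ S ∩ U, inner ℝ (m x) (φ x • Vm x) + -inner ℝ (m x) (φ x • Vp x) =
      -(φ x * normalJump m V x) := fun x hx => by
    rw [normalJump, hjump x hx, inner_smul_right, inner_smul_right, inner_sub_left,
      real_inner_comm (m x) (Vp x), real_inner_comm (m x) (Vm x)]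
    ring
  refine ⟨hφ.differentiable one_ne_zero, (i1.add i2).congr key.symm, ?_, ?_⟩
  · rw [hlocI z3]
    refine (m2'.add p2').neg.congr_fun (fun x hx => ?_) hSmeas
    simp only [Pi.neg_apply, Pi.add_apply]
    rw [hj x hx, neg_neg]
  · rw [integral_congr_ae key, integral_add i1 i2, integral_indicator hDmo.measurableSet,
      integral_indicator hDpo.measurableSet, m3, p3, hloc z1, hloc z2, hloc z3, ← hSm, ← hSp,
      ← integral_neg, ← setIntegral_congr_fun hSmeas hj, integral_add m2' p2']
    congr 1
    · exact setIntegral_congr_fun hSmeas fun x hx => by simp only [hnm x hx]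
    · exact setIntegral_congr_fun hSmeas fun x hx => by simp only [hnp x hx, inner_neg_left]

end Poro

/-! ### The divergence theorem on a Lipschitz domain cut by a surface. -/

namespace Poro

theorem continuousAt_divVec {V : E → E} {x : E} (h : ContDiffAt ℝ 1 V x) :
    ContinuousAt (divVec V) x :=
  continuous_tr.continuousAt.comp (h.continuousAt_fderiv one_ne_zero)

/-- Locally `S` is part of the boundary of a sublevel set and has finite area; being null is a local
property. -/
theorem IsPwC1.null {B S : Set E} {m V : E → E} (h : IsPwC1 B S m V) : volume S = 0 :=
  measure_null_of_locally_null S fun x hx => by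
    obtain ⟨U, hU, h0, -⟩ := h.weakGauss_at hx
    exact ⟨S ∩ U, inter_mem self_mem_nhdsWithin (mem_nhdsWithin_of_mem_nhds hU), h0⟩

theorem eventually_norm_le_of_continuousAt {X F : Type*} [TopologicalSpace X] [NormedAddCommGroup F]
    {f : X → F} {x : X} (h : ContinuousAt f x) : ∀ᶠ y in 𝓝 x, ‖f y‖ ≤ ‖f x‖ + 1 :=
  (h.norm.eventually (gt_mem_nhds (lt_add_one _))).mono fun _ hy => hy.le

/-- A field that is continuous off `S` and has a continuous extension from either side is locally
bounded: near a point of `S` every point off `S` is on one of the two sides. The lemma is stated for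
any quantity derived from `V`, to cover `V` and its divergence alike. -/
theorem IsPwC1.isPwCont_of_sides {B S : Set E} {m V : E → E} (h : IsPwC1 B S m V) {F : Type*}
    [NormedAddCommGroup F] {f : E → F} (hf : ∀ x ∈ B \ S, ContinuousAt f x)
    (hs : ∀ x ∈ S, ∀ (G : E → ℝ) (U : Set E) (Vp Vm : E → E), x ∈ U → IsSurfaceChart S m G U →
      ContDiffOn ℝ 1 Vp U → ContDiffOn ℝ 1 Vm U →
      (∀ y ∈ U, (0 < G y → V y = Vp y) ∧ (G y < 0 → V y = Vm y)) →
      ∃ fp fm : E → F, ContinuousAt fp x ∧ ContinuousAt fm x ∧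
        ∀ y ∈ U, (0 < G y → f y = fp y) ∧ (G y < 0 → f y = fm y)) : IsPwCont B S f where
  isOpen := h.isOpen
  isOpen_diff := h.isOpen_diff
  null := h.null
  cont := fun x hx => (hf x hx).continuousWithinAt
  bdd x hx := by
    by_cases hxS : x ∈ S
    · obtain ⟨G, U, Vp, Vm, hxU, hch, hVp, hVm, hV⟩ := h.sides x hxS
      obtain ⟨fp, fm, h1, h2, h3⟩ := hs x hxS G U Vp Vm hxU hch hVp hVm hV
      refine ⟨max (‖fp x‖ + 1) (‖fm x‖ + 1), ?_⟩
      filter_upwards [hch.isOpen.mem_nhds hxU, eventually_norm_le_of_continuousAt h1,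
        eventually_norm_le_of_continuousAt h2]
        with y hyU hy1 hy2 hyS
      have hG : G y ≠ 0 := fun h => hyS ((hch.mem_iff y hyU).2 h)
      rcases lt_or_gt_of_ne hG with hlt | hgt
      · rw [(h3 y hyU).2 hlt]; exact hy2.trans (le_max_right _ _)
      · rw [(h3 y hyU).1 hgt]; exact hy1.trans (le_max_left _ _)
    · exact ⟨‖f x‖ + 1, (eventually_norm_le_of_continuousAt (hf x ⟨hx, hxS⟩)).mono fun _ hy _ => hy⟩

theorem IsPwC1.isPwCont {B S : Set E} {m V : E → E} (h : IsPwC1 B S m V) : IsPwCont B S V :=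
  h.isPwCont_of_sides (fun x hx => (h.smooth x hx).continuousAt)
    fun _ _ _ _ Vp Vm hxU hch hVp hVm hV =>
      ⟨Vp, Vm, (hVp.contDiffAt (hch.isOpen.mem_nhds hxU)).continuousAt,
        (hVm.contDiffAt (hch.isOpen.mem_nhds hxU)).continuousAt, hV⟩

theorem IsPwC1.isPwCont_divVec {B S : Set E} {m V : E → E} (h : IsPwC1 B S m V) :
    IsPwCont B S (divVec V) := by
  refine h.isPwCont_of_sides (fun x hx => continuousAt_divVec (h.smooth x hx)) ?_
  intro x hx G U Vp Vm hxU hch hVp hVm hV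
  refine ⟨divVec Vp, divVec Vm, continuousAt_divVec (hVp.contDiffAt (hch.isOpen.mem_nhds hxU)),
    continuousAt_divVec (hVm.contDiffAt (hch.isOpen.mem_nhds hxU)), fun y hy => ⟨fun hG => ?_,
    fun hG => ?_⟩⟩
  · refine divVec_congr ?_
    filter_upwards [hch.isOpen.mem_nhds hy,
      (hch.contDiffAt hy).continuousAt.eventually (lt_mem_nhds hG)] with z hz hGz
    exact (hV z hz).1 hGz
  · refine divVec_congr ?_
    filter_upwards [hch.isOpen.mem_nhds hy,
      (hch.contDiffAt hy).continuousAt.eventually (gt_mem_nhds hG)] with z hz hGz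
    exact (hV z hz).2 hGz

/-- The weak divergence theorem across a surface. -/
theorem IsPwC1.weakGauss {B S : Set E} {m V : E → E} (h : IsPwC1 B S m V) {φ : E → ℝ}
    (hφ : ContDiff ℝ 1 φ) (hc : HasCompactSupport φ) (hs : tsupport φ ⊆ B) :
    WeakGauss S m V φ := by
  refine contDiff_local_induction (K := tsupport φ) (P := WeakGauss S m V) ?_
    (fun φ ψ h1 h2 => h1.add h2) hc (fun x hx => ?_) hφ Subset.rfl
  · have h0 : ∀ x, fderiv ℝ (0 : E → ℝ) x = 0 := fun x => fderiv_const_apply (0 : ℝ)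
    exact ⟨differentiable_const 0, by simp [h0], by simp, by simp [h0]⟩
  · by_cases hxS : x ∈ S
    · obtain ⟨U, hU, -, h1⟩ := h.weakGauss_at hxS
      exact ⟨U, hU, h1⟩
    · exact ⟨B \ S, h.isOpen_diff.mem_nhds ⟨hs hx, hxS⟩,
        fun φ h1 h2 h3 => h.weakGauss_off h1 h2 h3⟩

theorem contDiff_fderiv_bound {φ : E → ℝ} (hφ : ContDiff ℝ 1 φ) (hc : HasCompactSupport φ) :
    ∃ C, ∀ x, ‖fderiv ℝ φ x‖ ≤ C :=
  (hc.fderiv (𝕜 := ℝ)).exists_bound_of_continuous (hφ.continuous_fderiv one_ne_zero)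

theorem fderiv_eq_zero_of_tsupport_subset {φ : E → ℝ} {U : Set E} (h : tsupport φ ⊆ U) {x : E}
    (hx : x ∉ U) : fderiv ℝ φ x = 0 :=
  image_eq_zero_of_notMem_tsupport fun h' => hx (h (tsupport_fderiv_subset ℝ h'))

theorem integrable_fderiv_apply {φ : E → ℝ} (hφ : ContDiff ℝ 1 φ) (hc : HasCompactSupport φ)
    {W : E → E} (hW : Integrable W) : Integrable fun x => fderiv ℝ φ x (W x) := by
  obtain ⟨C, hC⟩ := contDiff_fderiv_bound hφ hc
  refine (hW.norm.const_mul C).mono' ?_ (Eventually.of_forall fun x => ?_)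
  · have h1 : Continuous fun p : E × E => fderiv ℝ φ p.1 p.2 := by
      have := hφ.continuous_fderiv one_ne_zero
      fun_prop
    exact h1.comp_aestronglyMeasurable (aestronglyMeasurable_id.prodMk hW.aestronglyMeasurable)
  · exact (ContinuousLinearMap.le_opNorm _ _).trans (by gcongr; exact hC x)

/-- The divergence theorem on a Lipschitz domain, for a field that is smooth on either side of a
surface. -/
theorem IsPwC1.divergence {B S : Set E} {m V : E → E} (h : IsPwC1 B S m V) {Ω : Set E}
    (hΩ : IsLipschitzDomain Ω) (hΩB : closure Ω ⊆ B) (hcross : area (frontier Ω ∩ S) = 0) :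
    IntegrableOn (normalJump m V) (Ω ∩ S) area ∧
    ∫ x in frontier Ω, inner ℝ (outerNormal Ω x) (V x) ∂area =
      (∫ x in Ω, divVec V x) + ∫ x in Ω ∩ S, normalJump m V x ∂area := by
  obtain ⟨U, hU, hΩU, hUB, hUc⟩ := exists_open_between_and_isCompact_closure
    hΩ.2.1.isCompact_closure h.isOpen hΩB
  obtain ⟨U', hU', hUU', hUB', hUc'⟩ := exists_open_between_and_isCompact_closure hUc h.isOpen hUB
  -- A fixed test function equal to one on a neighbourhood `U` of `closure Ω`. The weak theorem for
  -- `η` supplies an integrable majorant `η j` for the jump on `S`, which serves all the mollified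
  -- indicators at once.
  obtain ⟨η, e1, e2, e3, -⟩ := exists_smooth_cutoff isClosed_closure hU' hUU'
  have hηc : HasCompactSupport η :=
    hUc'.of_isClosed_subset (isClosed_tsupport _) (e3.trans subset_closure)
  have hη : ∀ x ∈ U, η x = 1 := fun x hx =>
    (eventually_nhdsSet_iff_forall.1 e2 x (subset_closure hx)).self_of_nhds
  obtain ⟨-, -, hηI, -⟩ := h.weakGauss e1 hηc (e3.trans (subset_closure.trans hUB'))
  obtain ⟨CW, hCW0, hCW, hWm, hWi⟩ := h.isPwCont.exists_truncation hU hUc hUB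
  obtain ⟨Cq, hCq0, hCq, hqm, hqi⟩ := h.isPwCont_divVec.exists_truncation hU hUc hUB
  set W := (U \ S).indicator V with hW
  set qd := (U \ S).indicator (divVec V) with hqd
  set j := normalJump m V with hj
  have hUS : IsOpen (U \ S) := by
    have : U \ S = U ∩ (B \ S) := by
      ext x; exact ⟨fun hx => ⟨hx.1, hUB (subset_closure hx.1), hx.2⟩, fun hx => ⟨hx.1, hx.2.2⟩⟩
    rw [this]; exact hU.inter h.isOpen_diff
  have hSvol := measure_eq_zero_iff_ae_notMem.1 h.null
  have hSfr : ∀ᵐ y ∂area.restrict (frontier Ω), y ∉ S := by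
    rw [ae_restrict_iff' isClosed_frontier.measurableSet]
    filter_upwards [measure_eq_zero_iff_ae_notMem.1 hcross] with x hx hxΩ hxS using hx ⟨hxΩ, hxS⟩
  have hfrS : ∀ᵐ y ∂area.restrict S, y ∉ frontier Ω := by
    rw [ae_iff]
    simp only [not_not, ofPred_mem_eq]
    rw [Measure.restrict_apply isClosed_frontier.measurableSet, hcross]
  have hfrv : ∀ᵐ y : E, y ∉ frontier Ω := by
    have := hΩ.isGaussNhd.volume_frontier
    rw [inter_univ] at this
    exact measure_eq_zero_iff_ae_notMem.1 this
  have hWV : ∀ x ∈ U, x ∉ S → W x = V x := fun x h1 h2 => indicator_of_mem (show x ∈ U \ S from ⟨h1, h2⟩) _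
  have hqV : ∀ x ∈ U, x ∉ S → qd x = divVec V x := fun x h1 h2 =>
    indicator_of_mem (show x ∈ U \ S from ⟨h1, h2⟩) _
  have hev := eventually_tsupport_smoothInd_subset hΩ.2.1 hU hΩU
  have hjI : IntegrableOn j (Ω ∩ S) area := by
    have h1 : IntegrableOn (fun x => η x * j x) (Ω ∩ S) area := hηI.mono_set inter_subset_right
    rw [IntegrableOn, ← Measure.restrict_restrict hΩ.1.measurableSet] at h1 ⊢
    refine h1.congr ?_
    filter_upwards [ae_restrict_mem hΩ.1.measurableSet] with x hx
    rw [hη x (hΩU (subset_closure hx)), one_mul]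
  refine ⟨hjI, ?_⟩
  -- The limit in which the gradients of the mollified indicators become the boundary flux. The
  -- field is continuous at almost every boundary point because `∂Ω ∩ S` has zero area.
  have L1 : Tendsto (fun n => ∫ x, fderiv ℝ (smoothInd Ω n) x (W x)) atTop
      (𝓝 (-∫ y in frontier Ω, inner ℝ (outerNormal Ω y) (V y) ∂area)) := by
    refine tendsto_integral_fderiv_smoothInd hΩ tendsto_id (W := fun _ => W) (W₀ := V)
      (Eventually.of_forall fun _ => ⟨hWi, hCW⟩) ?_
    filter_upwards [hSfr, ae_restrict_mem isClosed_frontier.measurableSet] with y hyS hy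
    have hyU : y ∈ U \ S := ⟨hΩU (frontier_subset_closure hy), hyS⟩
    have h1 : Tendsto W (𝓝 y) (𝓝 (V y)) := by
      refine ((h.smooth y ⟨hUB (subset_closure hyU.1), hyS⟩).continuousAt.tendsto).congr' ?_
      filter_upwards [hUS.mem_nhds hyU] with z hz
      exact (hWV z hz.1 hz.2).symm
    exact h1.comp tendsto_snd
  have L2 : Tendsto (fun n => ∫ x, smoothInd Ω n x * qd x) atTop (𝓝 (∫ x in Ω, divVec V x)) := by
    have h0 : ∫ x in Ω, divVec V x = ∫ x, Ω.indicator (fun _ => (1:ℝ)) x * qd x := by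
      rw [← integral_indicator hΩ.1.measurableSet]
      refine integral_congr_ae ?_
      filter_upwards [hSvol] with x hx
      by_cases hxΩ : x ∈ Ω
      · rw [indicator_of_mem hxΩ, indicator_of_mem hxΩ, one_mul,
          hqV x (hΩU (subset_closure hxΩ)) hx]
      · rw [indicator_of_notMem hxΩ, indicator_of_notMem hxΩ, zero_mul]
    rw [h0]
    refine tendsto_integral_of_dominated_convergence (fun x => ‖qd x‖) (fun n => ?_) hqi.norm
      (fun n => Eventually.of_forall fun x => ?_) ?_
    · exact (contDiff_smoothInd hΩ.1 n).continuous.aestronglyMeasurable.mul hqi.aestronglyMeasurable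
    · rw [norm_mul]
      exact mul_le_of_le_one_left (norm_nonneg _) (abs_smoothInd_le n x)
    · filter_upwards [hfrv] with x hx
      exact (tendsto_smoothInd hΩ.1 hx).mul_const _
  -- Mollified indicators converge off `∂Ω`, hence almost everywhere on `S` for the area; again this
  -- is the hypothesis that `∂Ω ∩ S` has zero area.
  have L3 : Tendsto (fun n => ∫ x in S, smoothInd Ω n x * j x ∂area) atTop
      (𝓝 (∫ x in Ω ∩ S, j x ∂area)) := by
    have h0 : ∫ x in Ω ∩ S, j x ∂area = ∫ x in S, Ω.indicator (fun _ => (1:ℝ)) x * j x ∂area := by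
      rw [← Measure.restrict_restrict hΩ.1.measurableSet, ← integral_indicator hΩ.1.measurableSet]
      congr 1
      ext x
      by_cases hxΩ : x ∈ Ω <;> simp [hxΩ]
    rw [h0]
    refine tendsto_integral_filter_of_dominated_convergence (fun x => ‖η x * j x‖) ?_ ?_ hηI.norm ?_
    · filter_upwards [hev] with n hn
      have : (fun x => smoothInd Ω n x * j x) = fun x => smoothInd Ω n x * (η x * j x) := by
        ext x
        by_cases hx : x ∈ U
        · rw [hη x hx, one_mul]
        · rw [image_eq_zero_of_notMem_tsupport fun h => hx (hn h), zero_mul, zero_mul]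
      rw [this]
      exact (contDiff_smoothInd hΩ.1 n).continuous.aestronglyMeasurable.mul hηI.aestronglyMeasurable
    · filter_upwards [hev] with n hn
      refine Eventually.of_forall fun x => ?_
      by_cases hx : x ∈ U
      · rw [hη x hx, one_mul, norm_mul]
        exact mul_le_of_le_one_left (norm_nonneg _) (abs_smoothInd_le n x)
      · rw [image_eq_zero_of_notMem_tsupport fun h => hx (hn h), zero_mul, norm_zero]
        exact norm_nonneg _
    · filter_upwards [hfrS] with x hx
      exact (tendsto_smoothInd hΩ.1 hx).mul_const _
  -- For large `n` the mollified indicator is supported in `U`, and the weak divergence theorem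
  -- applies to it; truncation to `U \ S` changes nothing almost everywhere.
  have heq : ∀ᶠ n in atTop, (∫ x, fderiv ℝ (smoothInd Ω n) x (W x)) + ∫ x, smoothInd Ω n x * qd x =
      -∫ x in S, smoothInd Ω n x * j x ∂area := by
    filter_upwards [hev] with n hn
    have hψ := contDiff_smoothInd hΩ.1 n
    have hψc := hasCompactSupport_smoothInd hΩ.2.1 n
    have hi2 : Integrable fun x => smoothInd Ω n x * qd x := by
      refine hqi.norm.mono' (hψ.continuous.aestronglyMeasurable.mul hqi.aestronglyMeasurable)
        (Eventually.of_forall fun x => ?_)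
      rw [norm_mul]
      exact mul_le_of_le_one_left (norm_nonneg _) (abs_smoothInd_le n x)
    rw [← (h.weakGauss hψ hψc (hn.trans (subset_closure.trans hUB))).2.2.2,
      ← integral_add (integrable_fderiv_apply hψ hψc hWi) hi2]
    refine integral_congr_ae ?_
    filter_upwards [hSvol] with x hx
    by_cases hxU : x ∈ U
    · rw [hWV x hxU hx, hqV x hxU hx]
    · rw [fderiv_eq_zero_of_tsupport_subset hn hxU,
        image_eq_zero_of_notMem_tsupport fun h => hxU (hn h)]
      simp
  have := tendsto_nhds_unique ((L1.add L2).congr' heq) L3.neg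
  linarith

end Poro

/-! ### One-sided smooth extensions. -/

namespace Poro

section HasExt

variable {H V V' : Type*} [NormedAddCommGroup H] [NormedSpace ℝ H] [NormedAddCommGroup V]
  [NormedSpace ℝ V] [NormedAddCommGroup V'] [NormedSpace ℝ V']

/-- Near `z`, the function `f` coincides on `Z` with a function that is `C^k` at `z`. -/
def HasExt (k : ℕ) (Z : Set H) (z : H) (f : H → V) : Prop :=
  ∃ F : H → V, ContDiffAt ℝ k F z ∧ f =ᶠ[𝓝[Z] z] F

variable {k : ℕ} {Z : Set H} {z : H} {f f' : H → V}

theorem hasExt_univ : HasExt k univ z f ↔ ContDiffAt ℝ k f z := by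
  constructor
  · rintro ⟨F, hF, h⟩
    rw [nhdsWithin_univ] at h
    exact hF.congr_of_eventuallyEq h
  · exact fun h => ⟨f, h, EventuallyEq.rfl⟩

theorem _root_.ContDiffAt.hasExt (h : ContDiffAt ℝ k f z) : HasExt k Z z f :=
  ⟨f, h, EventuallyEq.rfl⟩

theorem HasExt.congr (h : HasExt k Z z f) (hf : f' =ᶠ[𝓝[Z] z] f) : HasExt k Z z f' := by
  obtain ⟨F, h1, h2⟩ := h
  exact ⟨F, h1, hf.trans h2⟩

theorem HasExt.exists_tendsto (h : HasExt k Z z f) : ∃ a, Tendsto f (𝓝[Z] z) (𝓝 a) := by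
  obtain ⟨F, h1, h2⟩ := h
  exact ⟨F z, (h1.continuousAt.tendsto.mono_left nhdsWithin_le_nhds).congr' h2.symm⟩

theorem HasExt.of_le {l : ℕ} (h : HasExt k Z z f) (hl : l ≤ k) : HasExt l Z z f := by
  obtain ⟨F, h1, h2⟩ := h
  exact ⟨F, h1.of_le (by exact_mod_cast hl), h2⟩

theorem HasExt.prodMk {g : H → V'} (hf : HasExt k Z z f) (hg : HasExt k Z z g) :
    HasExt k Z z fun x => (f x, g x) := by
  obtain ⟨F, h1, h2⟩ := hf
  obtain ⟨G, h3, h4⟩ := hg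
  refine ⟨fun x => (F x, G x), h1.prodMk h3, ?_⟩
  filter_upwards [h2, h4] with x h5 h6
  rw [h5, h6]

/-- The extension of `f` takes at `z` the limit of `f` along `Z`, provided that `Z` accumulates at
`z`; this identifies the point at which `Φ` must be extended. -/
theorem HasExt.comp {Φ : V → V'} {Z' : Set V} {a : V} (hΦ : HasExt k Z' a Φ)
    (hf : HasExt k Z z f) [(𝓝[Z] z).NeBot] (ht : Tendsto f (𝓝[Z] z) (𝓝[Z'] a)) :
    HasExt k Z z fun x => Φ (f x) := by
  obtain ⟨F, h1, h2⟩ := hf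
  obtain ⟨G, h3, h4⟩ := hΦ
  have h5 : F z = a := tendsto_nhds_unique
    (h1.continuousAt.tendsto.mono_left nhdsWithin_le_nhds)
    ((tendsto_nhds_of_tendsto_nhdsWithin ht).congr' h2)
  refine ⟨fun x => G (F x), ContDiffAt.comp z (by rw [h5]; exact h3) h1, ?_⟩
  filter_upwards [h2, ht.eventually h4] with x h6 h7
  rw [h7, h6]

theorem HasExt.comp_contDiffAt {Φ : V → V'} {a : V} (hf : HasExt k Z z f)
    [(𝓝[Z] z).NeBot] (ht : Tendsto f (𝓝[Z] z) (𝓝 a)) (hΦ : ContDiffAt ℝ k Φ a) :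
    HasExt k Z z fun x => Φ (f x) :=
  HasExt.comp (Z' := univ) (hasExt_univ.2 hΦ) hf (by rwa [nhdsWithin_univ])

theorem HasExt.comp_contDiff {Φ : V → V'} (hf : HasExt k Z z f) (hΦ : ContDiff ℝ k Φ) :
    HasExt k Z z fun x => Φ (f x) := by
  obtain ⟨F, h1, h2⟩ := hf
  refine ⟨fun x => Φ (F x), hΦ.contDiffAt.comp z h1, ?_⟩
  filter_upwards [h2] with x h6
  rw [h6]

/-- At points near `z` of a set `Z` that is open there, `f` and its extension agree on a full
neighbourhood, so their derivatives agree; no derivative of `f` on the boundary of `Z` is involved.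
-/
theorem HasExt.fderiv_of (h : HasExt (k + 1) Z z f) (hZ : ∀ᶠ y in 𝓝[Z] z, Z ∈ 𝓝 y) :
    HasExt k Z z (fderiv ℝ f) := by
  obtain ⟨F, h1, h2⟩ := h
  refine ⟨fderiv ℝ F, h1.fderiv_right (by norm_cast), ?_⟩
  have := eventually_eventually_nhdsWithin.2 h2
  filter_upwards [this, hZ] with y h3 h4
  refine Filter.EventuallyEq.fderiv_eq ?_
  rwa [nhdsWithin_eq_nhds.2 h4] at h3

theorem HasExt.eventually_differentiableAt (h : HasExt (k + 1) Z z f)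
    (hZ : ∀ᶠ y in 𝓝[Z] z, Z ∈ 𝓝 y) : ∀ᶠ y in 𝓝[Z] z, DifferentiableAt ℝ f y := by
  obtain ⟨F, h1, h2⟩ := h
  have h5 : ∀ᶠ y in 𝓝 z, DifferentiableAt ℝ F y := by
    have : ContDiffAt ℝ 1 F z := h1.of_le (by norm_cast; omega)
    exact (this.eventually (by simp)).mono fun y hy => hy.differentiableAt one_ne_zero
  filter_upwards [eventually_eventually_nhdsWithin.2 h2, hZ, h5.filter_mono nhdsWithin_le_nhds]
    with y h3 h4 h5
  rw [nhdsWithin_eq_nhds.2 h4] at h3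
  exact h5.congr_of_eventuallyEq h3

end HasExt

section Sides

variable {V : Type*} [NormedAddCommGroup V] [NormedSpace ℝ V] {k : ℕ}

theorem deriv_slice {f : ℝ × E → V} {q : ℝ × E} (h : DifferentiableAt ℝ f q) :
    HasDerivAt (fun τ => f (τ, q.2)) (fderiv ℝ f q (1, 0)) q.1 := by
  have h1 : HasFDerivAt f (fderiv ℝ f q) (q.1, q.2) := h.hasFDerivAt
  exact h1.comp_hasDerivAt q.1 ((hasDerivAt_id q.1).prodMk (hasDerivAt_const q.1 q.2))

theorem fderiv_slice {f : ℝ × E → V} {q : ℝ × E} (h : DifferentiableAt ℝ f q) :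
    HasFDerivAt (fun X => f (q.1, X)) (fderiv ℝ f q ∘L ContinuousLinearMap.inr ℝ ℝ E) q.2 := by
  have h1 : HasFDerivAt f (fderiv ℝ f q) (q.1, q.2) := h.hasFDerivAt
  exact h1.comp q.2 (hasFDerivAt_prodMk_right q.1 q.2)

theorem HasExt.deriv_time {f : ℝ × E → V} {Z : Set (ℝ × E)} {z : ℝ × E}
    (h : HasExt (k + 1) Z z f) (hZ : ∀ᶠ y in 𝓝[Z] z, Z ∈ 𝓝 y) :
    HasExt k Z z fun q => deriv (fun τ => f (τ, q.2)) q.1 := by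
  refine ((h.fderiv_of hZ).comp_contDiff (Φ := fun A : ℝ × E →L[ℝ] V => A (1, 0))
    (by fun_prop)).congr ?_
  filter_upwards [h.eventually_differentiableAt hZ] with q hq
  exact (deriv_slice hq).deriv

theorem HasExt.fderiv_space {f : ℝ × E → V} {Z : Set (ℝ × E)} {z : ℝ × E}
    (h : HasExt (k + 1) Z z f) (hZ : ∀ᶠ y in 𝓝[Z] z, Z ∈ 𝓝 y) :
    HasExt k Z z fun q => _root_.fderiv ℝ (fun X => f (q.1, X)) q.2 := by
  refine ((h.fderiv_of hZ).comp_contDiff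
    (Φ := fun A : ℝ × E →L[ℝ] V => A ∘L ContinuousLinearMap.inr ℝ ℝ E) (by fun_prop)).congr ?_
  filter_upwards [h.eventually_differentiableAt hZ] with q hq
  exact (fderiv_slice hq).fderiv

theorem nhdsWithin_snd_preimage {P : Type*} [TopologicalSpace P] (p : P) (X : E) (Y : Set E) :
    𝓝[Prod.snd ⁻¹' Y] (p, X) = 𝓝 p ×ˢ 𝓝[Y] X := by
  rw [← univ_prod, nhdsWithin_prod_eq, nhdsWithin_univ]

theorem tendsto_slice (t : ℝ) (X : E) (Y : Set E) :
    Tendsto (fun y => (t, y)) (𝓝[Y] X) (𝓝[Prod.snd ⁻¹' Y] (t, X)) := by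
  rw [nhdsWithin_snd_preimage]
  exact tendsto_const_nhds.prodMk tendsto_id

theorem HasExt.slice {f : ℝ × E → V} {t : ℝ} {X : E} {Y : Set E}
    (h : HasExt k (Prod.snd ⁻¹' Y) (t, X) f) : HasExt k Y X fun y => f (t, y) := by
  obtain ⟨F, h1, h2⟩ := h
  refine ⟨fun y => F (t, y), h1.comp X (contDiffAt_const.prodMk contDiffAt_id), ?_⟩
  exact (tendsto_slice t X Y).eventually h2

/-- `Y` is a full neighbourhood of a point `X` of `B \ S`, or one of the two sides of `S` at a point
`X` of `S`. -/
def IsSide (B S : Set E) (m : E → E) (Y : Set E) (X : E) : Prop :=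
  (X ∈ B \ S ∧ Y = univ) ∨
    (X ∈ S ∧ ∃ g, IsLocalDefining S m g X ∧ (Y = {y | 0 < g y} ∨ Y = {y | g y < 0}))

variable {B S Y : Set E} {m : E → E} {X : E}

/-- The local conditions at `X` persist nearby. The equation `∇g = ‖∇g‖ m` with `∇g ≠ 0` forces `‖m‖
= 1`, so `m` is the normalized gradient. -/
theorem IsLocalDefining.exists_chart {g : E → ℝ} (h : IsLocalDefining S m g X) :
    ∃ U, X ∈ U ∧ IsSurfaceChart S m g U := by
  obtain ⟨h1, h2, h3⟩ := h
  have h4 : ∀ᶠ y in 𝓝 X, ContDiffAt ℝ 1 g y := h1.eventually (by simp)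
  have h5 : ∀ᶠ y in 𝓝 X, fderiv ℝ g y ≠ 0 :=
    (h1.continuousAt_fderiv one_ne_zero).eventually_ne h2
  obtain ⟨U, hU, hUo, hX⟩ := eventually_nhds_iff.1 (h4.and (h5.and h3))
  refine ⟨U, hX, hUo, fun y hy => (hU y hy).1.contDiffWithinAt, fun y hy => (hU y hy).2.1,
    fun y hy => (hU y hy).2.2.1, fun y hy hyS => ?_⟩
  rw [(hU y hy).2.2.2 hyS, norm_smul, norm_norm]
  have h6 : ‖gradient g y‖ ≠ 0 := norm_ne_zero_iff.2 (gradient_ne_zero (hU y hy).2.1)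
  have h7 := congrArg norm ((hU y hy).2.2.2 hyS)
  rw [norm_smul, norm_norm] at h7
  have h8 : ‖m y‖ = 1 := by
    have : ‖gradient g y‖ * ‖m y‖ = ‖gradient g y‖ * 1 := by rw [← h7, mul_one]
    exact mul_left_cancel₀ h6 this
  rw [h8, mul_one, smul_smul, inv_mul_cancel₀ h6, one_smul]

namespace IsSurfaceChart

variable {G : E → ℝ} {U : Set E}

theorem neBot_pos (h : IsSurfaceChart S m G U) (hX : X ∈ U) (hS : X ∈ S) :
    (𝓝[{y | 0 < G y}] X).NeBot := by
  have h1 : Tendsto (fun s : ℝ => X + s • m X) (𝓝[>] 0) (𝓝[{y | 0 < G y}] X) :=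
    tendsto_nhdsWithin_iff.2 ⟨tendsto_ray X (m X), eventually_pos_ray (h.differentiableAt hX)
      ((h.mem_iff X hX).1 hS) (h.inner_normal_pos hX hS)⟩
  exact h1.neBot

theorem neBot_neg (h : IsSurfaceChart S m G U) (hX : X ∈ U) (hS : X ∈ S) :
    (𝓝[{y | G y < 0}] X).NeBot := by
  have h1 : Tendsto (fun s : ℝ => X - s • m X) (𝓝[>] 0) (𝓝[{y | G y < 0}] X) := by
    refine tendsto_nhdsWithin_iff.2 ⟨?_, eventually_neg_ray (h.differentiableAt hX)
      ((h.mem_iff X hX).1 hS) (h.inner_normal_pos hX hS)⟩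
    simpa only [smul_neg, ← sub_eq_add_neg] using tendsto_ray X (-m X)
  exact h1.neBot

theorem tracePlus_eq_of_tendsto (h : IsSurfaceChart S m G U) (hX : X ∈ U) (hS : X ∈ S)
    {F : Type*} [TopologicalSpace F] [T2Space F] [Nonempty F] {f : E → F} {a : F}
    (hf : Tendsto f (𝓝[{y | 0 < G y}] X) (𝓝 a)) : tracePlus (m X) f X = a :=
  (h.tracePlus_eq hX hS hf).limUnder_eq

theorem traceMinus_eq_of_tendsto (h : IsSurfaceChart S m G U) (hX : X ∈ U) (hS : X ∈ S)
    {F : Type*} [TopologicalSpace F] [T2Space F] [Nonempty F] {f : E → F} {a : F}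
    (hf : Tendsto f (𝓝[{y | G y < 0}] X) (𝓝 a)) : traceMinus (m X) f X = a :=
  (h.traceMinus_eq hX hS hf).limUnder_eq

end IsSurfaceChart

theorem IsSide.neBot (h : IsSide B S m Y X) : (𝓝[Y] X).NeBot := by
  rcases h with ⟨-, rfl⟩ | ⟨hS, g, hg, rfl | rfl⟩
  · rw [nhdsWithin_univ]; infer_instance
  · obtain ⟨U, hX, hU⟩ := hg.exists_chart
    exact hU.neBot_pos hX hS
  · obtain ⟨U, hX, hU⟩ := hg.exists_chart
    exact hU.neBot_neg hX hS

theorem IsSide.eventually_mem_nhds (h : IsSide B S m Y X) : ∀ᶠ y in 𝓝[Y] X, Y ∈ 𝓝 y := by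
  rcases h with ⟨-, rfl⟩ | ⟨hS, g, hg, rfl | rfl⟩
  · exact Eventually.of_forall fun _ => univ_mem
  · obtain ⟨U, hX, hU⟩ := hg.exists_chart
    filter_upwards [self_mem_nhdsWithin, mem_nhdsWithin_of_mem_nhds (hU.isOpen.mem_nhds hX)]
      with y hy hyU
    exact (hU.contDiffAt hyU).continuousAt.eventually (lt_mem_nhds hy)
  · obtain ⟨U, hX, hU⟩ := hg.exists_chart
    filter_upwards [self_mem_nhdsWithin, mem_nhdsWithin_of_mem_nhds (hU.isOpen.mem_nhds hX)]
      with y hy hyU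
    exact (hU.contDiffAt hyU).continuousAt.eventually (gt_mem_nhds hy)

theorem IsSide.eventually_mem (h : IsSide B S m Y X) (hB : IsOpen B) (hBS : IsOpen (B \ S))
    (hS : S ⊆ B) : ∀ᶠ y in 𝓝[Y] X, y ∈ B \ S := by
  rcases h with ⟨hX, rfl⟩ | ⟨hS', g, hg, hY⟩
  · rw [nhdsWithin_univ]
    exact hBS.mem_nhds hX
  · obtain ⟨U, hX, hU⟩ := hg.exists_chart
    filter_upwards [self_mem_nhdsWithin, mem_nhdsWithin_of_mem_nhds (hU.isOpen.mem_nhds hX),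
      mem_nhdsWithin_of_mem_nhds (hB.mem_nhds (hS hS'))] with y hy hyU hyB
    refine ⟨hyB, fun hyS => ?_⟩
    have := (hU.mem_iff y hyU).1 hyS
    rcases hY with rfl | rfl
    · exact (ne_of_gt (show 0 < g y from hy)) this
    · exact (ne_of_lt (show g y < 0 from hy)) this

theorem PwContDiff.hasExt {P : Type*} [NormedAddCommGroup P] [NormedSpace ℝ P] {T : Set P}
    {f : P → E → V} (hf : PwContDiff k T B S m f) (h : IsSide B S m Y X) {p : P} (hp : p ∈ T) :
    HasExt k (Prod.snd ⁻¹' Y) (p, X) fun q : P × E => f q.1 q.2 := by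
  rcases h with ⟨hX, rfl⟩ | ⟨hS, g, hg, rfl | rfl⟩
  · exact (hf.1 p hp X hX).hasExt
  · obtain ⟨F, _, h1, _, h2⟩ := hf.2 p hp X hS
    exact ⟨F, h1, eventually_nhdsWithin_iff.2 ((h2 g hg).mono fun q hq => hq.1)⟩
  · obtain ⟨_, F, _, h1, h2⟩ := hf.2 p hp X hS
    exact ⟨F, h1, eventually_nhdsWithin_iff.2 ((h2 g hg).mono fun q hq => hq.2)⟩

theorem IsSide.neBot_prod {P : Type*} [TopologicalSpace P] (h : IsSide B S m Y X) (p : P) :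
    (𝓝[Prod.snd ⁻¹' Y] (p, X)).NeBot := by
  have := h.neBot
  rw [nhdsWithin_snd_preimage]
  infer_instance

theorem IsSide.eventually_mem_nhds_prod {P : Type*} [TopologicalSpace P] (h : IsSide B S m Y X)
    (p : P) : ∀ᶠ q in 𝓝[Prod.snd ⁻¹' Y] (p, X), Prod.snd ⁻¹' Y ∈ 𝓝 q := by
  rw [nhdsWithin_snd_preimage]
  filter_upwards [tendsto_snd.eventually h.eventually_mem_nhds] with q hq
  exact continuous_snd.continuousAt.preimage_mem_nhds hq

end Sides

end Poro

/-! ### Inverse motions off the interface. -/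

namespace Poro

/-- The inverse function theorem for a time-dependent map. -/
theorem exists_local_inverse {f : ℝ × E → E} {t : ℝ} {X : E} {n : ℕ} (hn : n ≠ 0)
    (hf : ContDiffAt ℝ n f (t, X)) (hdet : (fderiv ℝ (fun Y => f (t, Y)) X).det ≠ 0) :
    ∃ ι : ℝ × E → E, ContDiffAt ℝ n ι (t, f (t, X)) ∧ ι (t, f (t, X)) = X ∧
      (∀ᶠ q in 𝓝 (t, f (t, X)), f (q.1, ι q) = q.2) ∧
      ∀ᶠ q in 𝓝 (t, X), ι (q.1, f q) = q.2 := by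
  have hn' : (n : WithTop ℕ∞) ≠ 0 := by exact_mod_cast hn
  have hd : DifferentiableAt ℝ f (t, X) := hf.differentiableAt hn'
  set Θ : ℝ × E → ℝ × E := fun q => (q.1, f q) with hΘ
  have hΘc : ContDiffAt ℝ n Θ (t, X) := contDiffAt_fst.prodMk hf
  -- The derivative of `(t, X) ↦ (t, f (t, X))` is block triangular: its kernel lies in the spatial
  -- directions, where it is the invertible spatial derivative.
  set A : ℝ × E →L[ℝ] ℝ × E := (ContinuousLinearMap.fst ℝ ℝ E).prod (fderiv ℝ f (t, X)) with hA
  have hΘd : HasFDerivAt Θ A (t, X) := hasFDerivAt_fst.prodMk hd.hasFDerivAt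
  have hinj : Function.Injective (A : ℝ × E →ₗ[ℝ] ℝ × E) := by
    rw [← LinearMap.ker_eq_bot, LinearMap.ker_eq_bot']
    rintro ⟨a, u⟩ h
    obtain ⟨h1, h2⟩ := Prod.mk.inj (show (a, fderiv ℝ f (t, X) (a, u)) = (0, 0) from h)
    subst h1
    have h3 := (fderiv_slice hd).fderiv
    have h4 : fderiv ℝ (fun Y => f (t, Y)) X u = 0 := by
      rw [h3]; exact h2
    have h5 : u = 0 := by
      have h6 := ContinuousLinearMap.toContinuousLinearEquivOfDetNeZero_apply _ hdet u
      rw [h4] at h6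
      exact (ContinuousLinearEquiv.map_eq_zero_iff _).1 h6
    rw [h5]; rfl
  let eq := (LinearEquiv.ofInjectiveEndo _ hinj).toContinuousLinearEquiv
  have heq : (eq : ℝ × E →L[ℝ] ℝ × E) = A := by
    ext q <;> rfl
  have hΘe : HasFDerivAt Θ (eq : ℝ × E →L[ℝ] ℝ × E) (t, X) := by rw [heq]; exact hΘd
  have hs := hΘc.hasStrictFDerivAt' hΘe hn'
  have h1 : ContDiffAt ℝ n (hs.localInverse Θ eq (t, X)) (Θ (t, X)) := hΘc.to_localInverse hΘe hn'
  refine ⟨fun q => (hs.localInverse Θ eq (t, X) q).2, h1.snd, ?_, ?_, ?_⟩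
  · exact congrArg Prod.snd hs.localInverse_apply_image
  · filter_upwards [hs.eventually_right_inverse] with q hq
    obtain ⟨h2, h3⟩ := Prod.ext_iff.1 hq
    have h2 : (hs.localInverse Θ eq (t, X) q).1 = q.1 := h2
    rw [← h2]
    exact h3
  · filter_upwards [hs.eventually_left_inverse] with q hq
    exact congrArg Prod.snd hq

namespace Mixture

open Phase

variable {M : Mixture} {I : Set ℝ} {t : ℝ}

/-- The reference configuration without the inverse image of the interface. -/
def offRef (M : Mixture) (a : Phase) (t : ℝ) : Set E := M.ref a \ M.refInterface a t

/-- The space-time region off the interface. -/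
def off (M : Mixture) (I : Set ℝ) : Set (ℝ × E) :=
  {q | q.1 ∈ I ∧ q.2 ∈ M.body q.1 \ M.interface q.1}

theorem inv_solid_mem {x : E} (hx : x ∈ M.body t) : M.inv solid t x ∈ M.ref solid :=
  Function.invFunOn_mem hx

theorem χ_inv_solid {x : E} (hx : x ∈ M.body t) : M.χ solid t (M.inv solid t x) = x :=
  Function.invFunOn_eq hx

namespace IsKinematic

variable (h : M.IsKinematic I) (ht : t ∈ I)

include h

theorem Ss_subset : M.Ss ⊆ M.ref solid := h.surface.1

theorem isOpen_ref_diff : IsOpen (M.ref solid \ M.Ss) := h.surface.2.1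

theorem interface_subset : M.interface t ⊆ M.body t := image_mono h.Ss_subset

include ht

theorem inv_solid_χ {X : E} (hX : X ∈ M.ref solid) : M.inv solid t (M.χ solid t X) = X :=
  (h.solid_inj t ht).leftInvOn_invFunOn hX

theorem χ_mem_interface_iff {X : E} (hX : X ∈ M.ref solid) :
    M.χ solid t X ∈ M.interface t ↔ X ∈ M.Ss := by
  constructor
  · rintro ⟨Y, hY, hYX⟩
    rwa [← h.solid_inj t ht (h.Ss_subset hY) hX hYX]
  · exact fun hX => mem_image_of_mem _ hX

theorem mem_interface_iff {x : E} (hx : x ∈ M.body t) :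
    x ∈ M.interface t ↔ M.inv solid t x ∈ M.Ss := by
  rw [← h.χ_mem_interface_iff ht (inv_solid_mem hx), χ_inv_solid hx]

theorem offRef_solid : M.offRef solid t = M.ref solid \ M.Ss := by
  ext X
  constructor
  · rintro ⟨h1, h2⟩
    exact ⟨h1, fun h3 => h2 ⟨h1, mem_image_of_mem _ h3⟩⟩
  · rintro ⟨h1, h2⟩
    exact ⟨h1, fun h3 => h2 ((h.χ_mem_interface_iff ht h1).1 h3.2)⟩

theorem bijOn (a : Phase) : BijOn (M.χ a t) (M.offRef a t) (M.body t \ M.interface t) := by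
  cases a
  · rw [h.offRef_solid ht]
    refine ⟨fun X hX => ⟨mem_image_of_mem _ hX.1, fun h1 =>
      hX.2 ((h.χ_mem_interface_iff ht hX.1).1 h1)⟩, (h.solid_inj t ht).mono sdiff_subset, ?_⟩
    rintro x ⟨⟨X, hX, rfl⟩, hx⟩
    exact ⟨X, ⟨hX, fun h1 => hx (mem_image_of_mem _ h1)⟩, rfl⟩
  · exact h.fluid_bij t ht

theorem contDiffAt_χ (a : Phase) {X : E} (hX : X ∈ M.offRef a t) :
    ContDiffAt ℝ 2 (fun q : ℝ × E => M.χ a q.1 q.2) (t, X) := by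
  cases a
  · rw [h.offRef_solid ht] at hX
    exact h.solid_smooth.1 t ht X hX
  · exact h.fluid_smooth t ht X hX

theorem J_pos (a : Phase) {X : E} (hX : X ∈ M.offRef a t) : 0 < M.J a t X := by
  cases a
  · rw [h.offRef_solid ht] at hX
    exact h.solid_det t ht X hX
  · exact h.fluid_det t ht X hX

theorem χ_inv (a : Phase) {x : E} (hx : x ∈ M.body t \ M.interface t) :
    M.χ a t (M.inv a t x) = x := by
  obtain ⟨X, hX, rfl⟩ := (h.bijOn ht a).surjOn hx
  exact Function.invFunOn_eq ⟨X, hX.1, rfl⟩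

theorem inv_mem (a : Phase) {x : E} (hx : x ∈ M.body t \ M.interface t) :
    M.inv a t x ∈ M.offRef a t := by
  obtain ⟨X, hX, hXx⟩ := (h.bijOn ht a).surjOn hx
  refine ⟨Function.invFunOn_mem ⟨X, hX.1, hXx⟩, fun h1 => hx.2 ?_⟩
  rw [← h.χ_inv ht a hx]
  exact h1.2

/-- The fluid motion is injective only off the preimage of the interface; a point mapped off the
interface lies in that set, so its preimage is unique. -/
theorem inv_eq (a : Phase) {X x : E} (hX : X ∈ M.ref a) (hx : x ∈ M.body t \ M.interface t)
    (hXx : M.χ a t X = x) : M.inv a t x = X := by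
  refine (h.bijOn ht a).injOn (h.inv_mem ht a hx) ⟨hX, fun h1 => hx.2 ?_⟩ ?_
  · rw [← hXx]; exact h1.2
  · rw [h.χ_inv ht a hx, hXx]

omit ht in
-- The space-time region is the preimage of the fixed open set `B_s \ S_s` under the inverse solid
-- motion, which is jointly continuous.
theorem isOpen_off : IsOpen (M.off I) := by
  have h1 := h.solid_inv_cont.isOpen_inter_preimage h.solid_open h.isOpen_ref_diff
  convert h1 using 1
  ext q
  constructor
  · rintro ⟨h2, h3, h4⟩
    exact ⟨⟨h2, h3⟩, inv_solid_mem h3, fun h5 => h4 ((h.mem_interface_iff h2 h3).2 h5)⟩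
  · rintro ⟨⟨h2, h3⟩, h4⟩
    exact ⟨h2, h3, fun h5 => h4.2 ((h.mem_interface_iff h2 h3).1 h5)⟩

theorem isOpen_body : IsOpen (M.body t) := by
  have : M.body t = (fun x => (t, x)) ⁻¹' {q : ℝ × E | q.1 ∈ I ∧ q.2 ∈ M.body q.1} := by
    ext x; exact ⟨fun hx => ⟨ht, hx⟩, fun hx => hx.2⟩
  rw [this]
  exact h.solid_open.preimage (by fun_prop)

theorem isOpen_body_diff : IsOpen (M.body t \ M.interface t) := by
  have : M.body t \ M.interface t = (fun x => (t, x)) ⁻¹' M.off I := by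
    ext x; exact ⟨fun hx => ⟨ht, hx⟩, fun hx => hx.2⟩
  rw [this]
  exact h.isOpen_off.preimage (by fun_prop)

omit h in
theorem mem_off {x : E} (hx : x ∈ M.body t \ M.interface t) : (t, x) ∈ M.off I := ⟨ht, hx⟩

/-- The inverse function theorem gives a smooth local right inverse; by uniqueness of preimages off
the interface it coincides with the globally chosen inverse. -/
theorem contDiffAt_inv (a : Phase) {x : E} (hx : x ∈ M.body t \ M.interface t) :
    ContDiffAt ℝ 2 (fun q : ℝ × E => M.inv a q.1 q.2) (t, x) := by
  have hX := h.inv_mem ht a hx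
  obtain ⟨ι, h1, h2, h3, -⟩ := exists_local_inverse (n := 2) two_ne_zero (h.contDiffAt_χ ht a hX)
    (h.J_pos ht a hX).ne'
  simp only [h.χ_inv ht a hx] at h1 h2 h3
  have h4 : ∀ᶠ q in 𝓝 (t, x), ι q ∈ M.ref a :=
    h1.continuousAt.eventually (by rw [h2]; exact (h.open_ref a).mem_nhds hX.1)
  refine h1.congr_of_eventuallyEq ?_
  filter_upwards [h3, h4, h.isOpen_off.mem_nhds (mem_off ht hx)] with q h5 h6 h7
  exact h.inv_eq h7.1 a h6 h7.2 h5

/-- A field that is smooth on the reference configuration is smooth on the current one, off the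
interface. -/
theorem contDiffAt_spatial (a : Phase) {V : Type*} [NormedAddCommGroup V] [NormedSpace ℝ V]
    {f : ℝ → E → V} {k : ℕ} (hk : k ≤ 2) {x : E} (hx : x ∈ M.body t \ M.interface t)
    (hf : ContDiffAt ℝ k (fun q : ℝ × E => f q.1 q.2) (t, M.inv a t x)) :
    ContDiffAt ℝ k (fun q : ℝ × E => f q.1 (M.inv a q.1 q.2)) (t, x) := by
  have h1 : ContDiffAt ℝ k (fun q : ℝ × E => (q.1, M.inv a q.1 q.2)) (t, x) :=
    contDiffAt_fst.prodMk ((h.contDiffAt_inv ht a hx).of_le (by exact_mod_cast hk))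
  exact ContDiffAt.comp (t, x) (g := fun q : ℝ × E => f q.1 q.2)
    (f := fun q : ℝ × E => (q.1, M.inv a q.1 q.2)) hf h1

end IsKinematic

end Mixture

end Poro

/-! ### Determinants, and the convected interface as an oriented surface. -/

namespace Poro

theorem det_eq (A : Tensor) : A.det = Matrix.det (Matrix.of fun i j => inner ℝ (e i) (A (e j))) := by
  rw [ContinuousLinearMap.det, ← LinearMap.det_toMatrix eBasis.toBasis]
  congr 1
  ext i j
  rw [LinearMap.toMatrix_apply]
  simp only [OrthonormalBasis.coe_toBasis, ContinuousLinearMap.coe_coe, Matrix.of_apply,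
    OrthonormalBasis.coe_toBasis_repr_apply, OrthonormalBasis.repr_apply_apply, eBasis_apply]

theorem contDiff_det {n : WithTop ℕ∞} : ContDiff ℝ n (fun A : Tensor => A.det) := by
  have : (fun A : Tensor => A.det) =
      fun A => Matrix.det (Matrix.of fun i j => inner ℝ (e i) (A (e j))) := funext det_eq
  rw [this]
  simp only [Matrix.det_fin_three, Matrix.of_apply]
  have h : ∀ i j, ContDiff ℝ n fun A : Tensor => (inner ℝ (e i) (A (e j)) : ℝ) := fun i j =>
    contDiff_const.inner ℝ (by fun_prop)
  have h' := h
  fun_prop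

theorem transp_comp_inner (A : Tensor) (u v : E) : inner ℝ (transp A u) v = inner ℝ u (A v) :=
  ContinuousLinearMap.adjoint_inner_left A v u

theorem gradient_comp {G : E → ℝ} {F : E → E} {X : E} (hG : DifferentiableAt ℝ G (F X))
    (hF : DifferentiableAt ℝ F X) :
    gradient (fun Y => G (F Y)) X = transp (fderiv ℝ F X) (gradient G (F X)) := by
  refine ext_inner_right ℝ fun v => ?_
  rw [transp_comp_inner, inner_gradient, inner_gradient]
  rw [show (fun Y => G (F Y)) = G ∘ F from rfl, fderiv_comp X hG hF]
  rfl

theorem transp_inverse_transp {A : Tensor} (hA : A.det ≠ 0) (u : E) :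
    transp (ContinuousLinearMap.inverse A) (transp A u) = u := by
  refine ext_inner_right ℝ fun v => ?_
  rw [transp_comp_inner, transp_comp_inner]
  congr 1
  have := ContinuousLinearMap.coe_toContinuousLinearEquivOfDetNeZero A hA
  rw [← this, ContinuousLinearMap.inverse_equiv]
  exact ContinuousLinearEquiv.apply_symm_apply _ v

theorem continuousAt_inverse {A : Tensor} (hA : A.det ≠ 0) :
    ContinuousAt (ContinuousLinearMap.inverse : Tensor → Tensor) A := by
  have := contDiffAt_map_inverse (𝕜 := ℝ) (n := 0)
    (ContinuousLinearMap.toContinuousLinearEquivOfDetNeZero A hA)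
  rw [ContinuousLinearMap.coe_toContinuousLinearEquivOfDetNeZero] at this
  exact this.continuousAt

theorem continuous_transp : Continuous transp :=
  (ContinuousLinearMap.adjoint (𝕜 := ℝ) (E := E) (F := E)).continuous

theorem exists_local_inverse_space {F : E → E} {X : E} {n : ℕ} (hn : n ≠ 0)
    (hF : ContDiffAt ℝ n F X) (hdet : (fderiv ℝ F X).det ≠ 0) :
    ∃ ι : E → E, ContDiffAt ℝ n ι (F X) ∧ ι (F X) = X ∧ (∀ᶠ y in 𝓝 (F X), F (ι y) = y) ∧
      ∀ᶠ Y in 𝓝 X, ι (F Y) = Y := by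
  obtain ⟨ι, h1, h2, h3, h4⟩ := exists_local_inverse (f := fun q : ℝ × E => F q.2) (t := 0) hn
    (hF.comp ((0 : ℝ), X) contDiffAt_snd) hdet
  have hc : ∀ z : E, Tendsto (fun y : E => ((0 : ℝ), y)) (𝓝 z) (𝓝 (0, z)) := fun z =>
    tendsto_const_nhds.prodMk_nhds tendsto_id
  exact ⟨fun y => ι (0, y), h1.comp (F X) (contDiffAt_const.prodMk contDiffAt_id), h2,
    (hc _).eventually h3, (hc _).eventually h4⟩

namespace Mixture

open Phase

variable {M : Mixture} {I : Set ℝ} {t : ℝ}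

/-- `Y` is one side, in the solid reference configuration, of a point `X`. -/
abbrev RefSide (M : Mixture) (Y : Set E) (X : E) : Prop := IsSide (M.ref solid) M.Ss M.ms Y X

namespace IsKinematic

variable (h : M.IsKinematic I) (ht : t ∈ I)

include h

theorem eventually_mem_of_side {Y : Set E} {X : E} (hs : M.RefSide Y X) :
    ∀ᶠ y in 𝓝[Y] X, y ∈ M.ref solid \ M.Ss :=
  hs.eventually_mem (h.open_ref solid) h.isOpen_ref_diff h.Ss_subset

include ht

theorem continuousAt_χ_solid {X : E} (hX : X ∈ M.ref solid) : ContinuousAt (M.χ solid t) X := by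
  have h1 : ContinuousOn (M.χ solid t) (M.ref solid) :=
    h.solid_cont.comp (f := fun Y => (t, Y)) (by fun_prop) fun Y hY => ⟨ht, hY⟩
  exact h1.continuousAt ((h.open_ref solid).mem_nhds hX)

theorem continuousAt_inv_solid_joint {x : E} (hx : x ∈ M.body t) :
    ContinuousAt (fun q : ℝ × E => M.inv solid q.1 q.2) (t, x) :=
  h.solid_inv_cont.continuousAt (h.solid_open.mem_nhds ⟨ht, hx⟩)

theorem continuousAt_inv_solid {x : E} (hx : x ∈ M.body t) : ContinuousAt (M.inv solid t) x :=
  ContinuousAt.comp (f := fun y => (t, y)) (g := fun q : ℝ × E => M.inv solid q.1 q.2)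
    (h.continuousAt_inv_solid_joint ht hx) (by fun_prop)

theorem hasExt_χ {Y : Set E} {X : E} (hs : M.RefSide Y X) :
    HasExt 2 (Prod.snd ⁻¹' Y) (t, X) fun q : ℝ × E => M.χ solid q.1 q.2 :=
  h.solid_smooth.hasExt hs ht

theorem hasExt_velRef {Y : Set E} {X : E} (hs : M.RefSide Y X) :
    HasExt 1 (Prod.snd ⁻¹' Y) (t, X) fun q : ℝ × E => M.velRef solid q.1 q.2 :=
  (h.hasExt_χ ht hs).deriv_time (hs.eventually_mem_nhds_prod t)

theorem hasExt_F {Y : Set E} {X : E} (hs : M.RefSide Y X) :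
    HasExt 1 (Prod.snd ⁻¹' Y) (t, X) fun q : ℝ × E => M.F solid q.1 q.2 :=
  (h.hasExt_χ ht hs).fderiv_space (hs.eventually_mem_nhds_prod t)

theorem hasExt_J {Y : Set E} {X : E} (hs : M.RefSide Y X) :
    HasExt 1 (Prod.snd ⁻¹' Y) (t, X) fun q : ℝ × E => M.J solid q.1 q.2 :=
  (h.hasExt_F ht hs).comp_contDiff (Φ := fun A : Tensor => A.det) contDiff_det

/-- The Jacobian has positive one-sided limits. -/
theorem exists_tendsto_J {Y : Set E} {X : E} (hs : M.RefSide Y X) :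
    ∃ a > 0, Tendsto (fun q : ℝ × E => M.J solid q.1 q.2) (𝓝[Prod.snd ⁻¹' Y] (t, X)) (𝓝 a) := by
  obtain ⟨a, ha⟩ := (h.hasExt_J ht hs).exists_tendsto
  refine ⟨a, ?_, ha⟩
  have h1 : Tendsto (M.J solid t) (𝓝[Y] X) (𝓝 a) := ha.comp (tendsto_slice t X Y)
  rcases hs with ⟨hX, rfl⟩ | ⟨hS, g, hg, rfl | rfl⟩
  · rw [nhdsWithin_univ] at h1
    rw [← tendsto_nhds_unique (tendsto_pure_nhds (M.J solid t) X) (h1.mono_left (pure_le_nhds X))]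
    exact h.solid_det t ht X hX
  · obtain ⟨U, hX, hU⟩ := hg.exists_chart
    rw [← hU.tracePlus_eq_of_tendsto hX hS h1]
    exact (h.solid_det_trace t ht X hS).1
  · obtain ⟨U, hX, hU⟩ := hg.exists_chart
    rw [← hU.traceMinus_eq_of_tendsto hX hS h1]
    exact (h.solid_det_trace t ht X hS).2

/-- The one-sided extensions of the solid motion are local diffeomorphisms. -/
theorem exists_side_inverse {Y : Set E} {X : E} (hs : M.RefSide Y X) (hX : X ∈ M.ref solid) :
    ∃ F ι : E → E, ContDiffAt ℝ 2 F X ∧ F X = M.χ solid t X ∧ 0 < (fderiv ℝ F X).det ∧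
      (M.χ solid t =ᶠ[𝓝[Y] X] F) ∧ ContDiffAt ℝ 2 ι (M.χ solid t X) ∧ ι (M.χ solid t X) = X ∧
      (∀ᶠ y in 𝓝 (M.χ solid t X), F (ι y) = y) ∧ ∀ᶠ Y in 𝓝 X, ι (F Y) = Y := by
  have := hs.neBot
  obtain ⟨F, h1, h2⟩ := (h.hasExt_χ ht hs).slice
  have h3 : F X = M.χ solid t X := tendsto_nhds_unique
    (h1.continuousAt.tendsto.mono_left nhdsWithin_le_nhds)
    (((h.continuousAt_χ_solid ht hX).tendsto.mono_left nhdsWithin_le_nhds).congr' h2)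
  obtain ⟨a, ha, h4⟩ := h.exists_tendsto_J ht hs
  have h5 : Tendsto (M.J solid t) (𝓝[Y] X) (𝓝 a) := h4.comp (tendsto_slice t X Y)
  have h6 : Tendsto (fun y => (fderiv ℝ F y).det) (𝓝[Y] X) (𝓝 (fderiv ℝ F X).det) :=
    ((contDiff_det (n := 0)).continuous.continuousAt.comp
      (h1.continuousAt_fderiv two_ne_zero)).tendsto.mono_left nhdsWithin_le_nhds
  -- Inside the side the motion and its extension agree locally, so the Jacobian is `det ∇F` there;
  -- hence `det ∇F X` is the positive one-sided limit of the Jacobian.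
  have h7 : (fderiv ℝ F X).det = a := by
    refine tendsto_nhds_unique h6 (h5.congr' ?_)
    filter_upwards [eventually_eventually_nhdsWithin.2 h2, hs.eventually_mem_nhds] with y h8 h9
    rw [nhdsWithin_eq_nhds.2 h9] at h8
    rw [J, Mixture.F, EventuallyEq.fderiv_eq h8]
  have h8 : 0 < (fderiv ℝ F X).det := h7 ▸ ha
  obtain ⟨ι, i1, i2, i3, i4⟩ := exists_local_inverse_space two_ne_zero h1 h8.ne'
  rw [h3] at i1 i2 i3
  exact ⟨F, ι, h1, h3, h8, h2, i1, i2, i3, i4⟩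

/-- The convected interface is an oriented surface, and on either side of it the inverse motion has
a smooth extension. -/
theorem exists_interface_chart {X₀ : E} (hX₀ : X₀ ∈ M.Ss) {g : E → ℝ}
    (hg : IsLocalDefining M.Ss M.ms g X₀) :
    ∃ (G : E → ℝ) (U : Set E) (ιp ιm : E → E), M.χ solid t X₀ ∈ U ∧
      IsSurfaceChart (M.interface t) (M.m t) G U ∧ ContDiffAt ℝ 1 ιp (M.χ solid t X₀) ∧
      ContDiffAt ℝ 1 ιm (M.χ solid t X₀) ∧ ιp (M.χ solid t X₀) = X₀ ∧ ιm (M.χ solid t X₀) = X₀ ∧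
      U ⊆ M.body t ∧
      ∀ y ∈ U, (0 < G y → 0 < g (M.inv solid t y) ∧ M.inv solid t y = ιp y) ∧
        (G y < 0 → g (M.inv solid t y) < 0 ∧ M.inv solid t y = ιm y) := by
  have hXr := h.Ss_subset hX₀
  obtain ⟨Ug, hXU, hch⟩ := hg.exists_chart
  set x₀ := M.χ solid t X₀ with hx₀
  have hx₀B : x₀ ∈ M.body t := mem_image_of_mem _ hXr
  have hinv₀ : M.inv solid t x₀ = X₀ := h.inv_solid_χ ht hXr
  obtain ⟨F, ι, f1, f2, f3, f4, i1, i2, i3, i4⟩ :=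
    h.exists_side_inverse ht (Y := {y | 0 < g y}) (Or.inr ⟨hX₀, g, hg, Or.inl rfl⟩) hXr
  obtain ⟨F', ι', -, -, -, f4', i1', i2', -, i4'⟩ :=
    h.exists_side_inverse ht (Y := {y | g y < 0}) (Or.inr ⟨hX₀, g, hg, Or.inr rfl⟩) hXr
  -- The defining function of the reference surface is pushed forward by the extension `F` of the
  -- motion from the positive side, not by the motion itself, which is only continuous across the
  -- surface.
  set G : E → ℝ := fun y => g (ι y) with hG
  have hGc : ContDiffAt ℝ 1 G x₀ :=
    ContDiffAt.comp x₀ (by rw [i2]; exact hg.1) (i1.of_le one_le_two)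
  have f1' : ContDiffAt ℝ 1 F X₀ := f1.of_le one_le_two
  have e1 : ∀ᶠ Y in 𝓝 X₀, 0 < g Y → M.χ solid t Y = F Y := eventually_nhdsWithin_iff.1 f4
  have e1' : ∀ᶠ Y in 𝓝 X₀, g Y < 0 → M.χ solid t Y = F' Y := eventually_nhdsWithin_iff.1 f4'
  have e2 : ∀ᶠ Y in 𝓝 X₀, Y ∈ M.ref solid := (h.open_ref solid).mem_nhds hXr
  have e3 : ∀ᶠ Y in 𝓝 X₀, Y ∈ Ug := hch.isOpen.mem_nhds hXU
  have e4 : ∀ᶠ Y in 𝓝 X₀, ContDiffAt ℝ 1 F Y := f1'.eventually (by simp)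
  have e5 : ∀ᶠ Y in 𝓝 X₀, 0 < (fderiv ℝ F Y).det :=
    ((contDiff_det (n := 0)).continuous.continuousAt.comp
      (f1'.continuousAt_fderiv one_ne_zero)).eventually (lt_mem_nhds f3)
  -- By continuity the motion agrees with `F` on the surface as well, hence on the whole closed
  -- positive side.
  have e6 : ∀ᶠ Y in 𝓝 X₀, Y ∈ M.Ss → M.χ solid t Y = F Y := by
    filter_upwards [e1.eventually_nhds, e2, e3, e4] with Y h1 h2 h3 h4 h5
    have := hch.neBot_pos h3 h5
    refine tendsto_nhds_unique
      ((h.continuousAt_χ_solid ht h2).tendsto.mono_left nhdsWithin_le_nhds)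
      ((h4.continuousAt.tendsto.mono_left (nhdsWithin_le_nhds (s := {y | 0 < g y}))).congr' ?_)
    filter_upwards [eventually_nhdsWithin_iff.2 h1] with y hy
    exact hy.symm
  have e7 : ∀ᶠ Y in 𝓝 X₀, 0 ≤ g Y → M.χ solid t Y = F Y := by
    filter_upwards [e1, e3, e6] with Y h1 h2 h3 h4
    rcases h4.eq_or_lt with h5 | h5
    · exact h3 ((hch.mem_iff Y h2).2 h5.symm)
    · exact h1 h5
  have e8 : ∀ᶠ Y in 𝓝 X₀, g =ᶠ[𝓝 Y] fun Z => G (F Z) := by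
    filter_upwards [i4.eventually_nhds] with Y hY
    filter_upwards [hY] with Z hZ
    rw [hG]
    simp only [hZ]
  have ti : Tendsto (M.inv solid t) (𝓝 x₀) (𝓝 X₀) := by
    have := (h.continuousAt_inv_solid ht hx₀B).tendsto
    rwa [hinv₀] at this
  have tι : Tendsto ι (𝓝 x₀) (𝓝 X₀) := by
    have := i1.continuousAt.tendsto
    rwa [i2] at this
  have hdG : fderiv ℝ G x₀ ≠ 0 := by
    intro h0
    refine hg.2.1 ?_
    rw [e8.self_of_nhds.fderiv_eq, show (fun Z => G (F Z)) = G ∘ F from rfl,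
      fderiv_comp X₀ (by rw [f2]; exact hGc.differentiableAt one_ne_zero)
        (f1'.differentiableAt one_ne_zero), f2, h0, ContinuousLinearMap.zero_comp]
  have key : ∀ᶠ y in 𝓝 x₀, y ∈ M.body t ∧ ContDiffAt ℝ 1 G y ∧ fderiv ℝ G y ≠ 0 ∧
      (y ∈ M.interface t ↔ G y = 0) ∧
      (y ∈ M.interface t → M.m t y = ‖gradient G y‖⁻¹ • gradient G y) ∧
      (0 < G y → 0 < g (M.inv solid t y) ∧ M.inv solid t y = ι y) ∧
      (G y < 0 → g (M.inv solid t y) < 0 ∧ M.inv solid t y = ι' y) := by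
    filter_upwards [(h.isOpen_body ht).mem_nhds hx₀B, hGc.eventually (by simp),
      (hGc.continuousAt_fderiv one_ne_zero).eventually_ne hdG, i3, ti.eventually e7,
      tι.eventually e7, tι.eventually e2, ti.eventually e3, ti.eventually i4, ti.eventually i4',
      ti.eventually e1', ti.eventually e4, ti.eventually e5, ti.eventually e8,
      ti.eventually e1.eventually_nhds]
      with y hyB hGy hdGy a1 a2 a3 a4 a5 a6 a7 a8 a9 a10 a11 a12
    set Y := M.inv solid t y with hY
    have hYr : Y ∈ M.ref solid := inv_solid_mem hyB
    have hYy : M.χ solid t Y = y := χ_inv_solid hyB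
    -- `b1` and `b2` show that `g` at the preimage of `y` and `G y` are nonnegative simultaneously,
    -- with `ι y` the preimage; the second direction uses injectivity of the solid motion. So `G`
    -- separates the images of the two sides although `F` need not be the motion on the negative
    -- side.
    have b1 : 0 ≤ g Y → ι y = Y := fun h0 => by
      have := a2 h0
      rw [hYy] at this
      rw [this, a6]
    have b2 : 0 ≤ G y → Y = ι y := fun h0 =>
      h.solid_inj t ht hYr a4 (by rw [hYy, a3 h0, a1])
    have b3 : y ∈ M.interface t ↔ g Y = 0 := by
      rw [h.mem_interface_iff ht hyB]
      exact hch.mem_iff Y a5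
    refine ⟨hyB, hGy, hdGy, ?_, fun hyS => ?_, fun h0 => ?_, fun h0 => ?_⟩
    · rw [b3]
      constructor
      · intro h0
        rw [hG]
        simp only [b1 h0.ge, h0]
      · intro h0
        rw [b2 h0.ge]
        exact h0
    · have hYS : Y ∈ M.Ss := (h.mem_interface_iff ht hyB).1 hyS
      have hFY : F Y = y := by rw [← a2 (b3.1 hyS).ge, hYy]
      set A := fderiv ℝ F Y with hA
      -- Gradients transform by `∇g = Aᵀ ∇G`. Hence `J F⁻ᵀ m_s`, computed from the positive side, is
      -- a positive multiple of `∇G`, and the prescribed normal `m` is the normalized gradient.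
      have hgr : gradient g Y = transp A (gradient G y) := by
        have : gradient g Y = gradient (fun Z => G (F Z)) Y := by
          rw [gradient, gradient, a11.fderiv_eq]
        rw [this, gradient_comp (by rw [hFY]; exact hGy.differentiableAt one_ne_zero)
          (a9.differentiableAt one_ne_zero), hFY]
      have hlim : Tendsto (M.F solid t) (𝓝[{z | 0 < g z}] Y) (𝓝 A) := by
        refine (((a9.continuousAt_fderiv one_ne_zero).tendsto).mono_left
          nhdsWithin_le_nhds).congr' ?_
        filter_upwards [mem_nhdsWithin_of_mem_nhds a12.eventually_nhds, self_mem_nhdsWithin,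
          mem_nhdsWithin_of_mem_nhds (hch.isOpen.mem_nhds a5)] with z h1 h2 h3
        refine (EventuallyEq.fderiv_eq ?_).symm
        filter_upwards [h1, (hch.contDiffAt h3).continuousAt.eventually (lt_mem_nhds h2)]
          with w h4 h5
        exact h4 h5
      have hpn : M.pushNormal t Y =
          A.det • (transp (ContinuousLinearMap.inverse A)) (M.ms Y) := by
        refine hch.tracePlus_eq_of_tendsto a5 hYS ?_
        have l1 : Tendsto (M.J solid t) (𝓝[{z | 0 < g z}] Y) (𝓝 A.det) :=
          ((contDiff_det (n := 0)).continuous.continuousAt (x := A)).tendsto.comp hlim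
        have l2 := continuous_transp.continuousAt.tendsto.comp
          ((continuousAt_inverse a10.ne').tendsto.comp hlim)
        exact l1.smul (((ContinuousLinearMap.apply ℝ E (M.ms Y)).continuous.tendsto _).comp l2)
      have hgn : 0 < ‖gradient g Y‖ :=
        norm_pos_iff.2 (gradient_ne_zero (hch.fderiv_ne Y a5))
      have hpn' : M.pushNormal t Y = (A.det * ‖gradient g Y‖⁻¹) • gradient G y := by
        rw [hpn, hch.normal Y a5 hYS, map_smul, hgr, transp_inverse_transp a10.ne', ← hgr,
          smul_smul]
      have hc : 0 < A.det * ‖gradient g Y‖⁻¹ := by positivity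
      rw [m, ← hY, hpn', norm_smul, Real.norm_of_nonneg hc.le, smul_smul, mul_inv]
      congr 1
      field_simp
    · have := b2 h0.le
      exact ⟨by rw [this]; exact h0, this⟩
    · have h1 : g Y < 0 := by
        by_contra h2
        have h3 := b1 (not_lt.1 h2)
        rw [hG] at h0
        simp only [h3] at h0
        exact h2 h0
      refine ⟨h1, ?_⟩
      have := a8 h1
      rw [hYy] at this
      rw [this, a7]
  obtain ⟨U, hU, hUo, hxU⟩ := eventually_nhds_iff.1 key
  exact ⟨G, U, ι, ι', hxU, ⟨hUo, fun y hy => (hU y hy).2.1.contDiffWithinAt,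
    fun y hy => (hU y hy).2.2.1, fun y hy => (hU y hy).2.2.2.1, fun y hy => (hU y hy).2.2.2.2.1⟩,
    i1.of_le one_le_two, i1'.of_le one_le_two, i2, i2', fun y hy => (hU y hy).1,
    fun y hy => (hU y hy).2.2.2.2.2⟩

end IsKinematic

end Mixture

end Poro

/-! ### Piecewise smooth fields on the current configuration. -/

namespace Poro

namespace Mixture

open Phase

variable {M : Mixture} {I : Set ℝ} {t : ℝ}
variable {V V' : Type*} [NormedAddCommGroup V] [NormedSpace ℝ V] [NormedAddCommGroup V']
  [NormedSpace ℝ V'] {k : ℕ} {f : ℝ → E → V}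

/-- The pull-back of the field `f` by the solid motion is `C^k` off the reference interface, and
extends smoothly from either side. -/
def PwSmooth (M : Mixture) (k : ℕ) (I : Set ℝ) (f : ℝ → E → V) : Prop :=
  ∀ t ∈ I, ∀ Y X, M.RefSide Y X →
    HasExt k (Prod.snd ⁻¹' Y) (t, X) fun q : ℝ × E => f q.1 (M.χ solid q.1 q.2)

theorem PwField.pwSmooth (hf : M.PwField k I f) : M.PwSmooth k I f :=
  fun _ ht _ _ hs => PwContDiff.hasExt hf hs ht

theorem PwSmooth.of_le {l : ℕ} (hf : M.PwSmooth k I f) (hl : l ≤ k) : M.PwSmooth l I f :=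
  fun t ht Y X hs => (hf t ht Y X hs).of_le hl

theorem PwSmooth.comp_contDiff (hf : M.PwSmooth k I f) {Φ : V → V'} (hΦ : ContDiff ℝ k Φ) :
    M.PwSmooth k I fun t x => Φ (f t x) :=
  fun t ht Y X hs => (hf t ht Y X hs).comp_contDiff hΦ

theorem PwSmooth.prodMk {g : ℝ → E → V'} (hf : M.PwSmooth k I f) (hg : M.PwSmooth k I g) :
    M.PwSmooth k I fun t x => (f t x, g t x) :=
  fun t ht Y X hs => (hf t ht Y X hs).prodMk (hg t ht Y X hs)

theorem PwSmooth.add {g : ℝ → E → V} (hf : M.PwSmooth k I f) (hg : M.PwSmooth k I g) :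
    M.PwSmooth k I fun t x => f t x + g t x :=
  (hf.prodMk hg).comp_contDiff (Φ := fun p : V × V => p.1 + p.2) (by fun_prop)

theorem PwSmooth.sub {g : ℝ → E → V} (hf : M.PwSmooth k I f) (hg : M.PwSmooth k I g) :
    M.PwSmooth k I fun t x => f t x - g t x :=
  (hf.prodMk hg).comp_contDiff (Φ := fun p : V × V => p.1 - p.2) (by fun_prop)

theorem PwSmooth.smul {g : ℝ → E → ℝ} (hg : M.PwSmooth k I g) (hf : M.PwSmooth k I f) :
    M.PwSmooth k I fun t x => g t x • f t x :=
  (hg.prodMk hf).comp_contDiff (Φ := fun p : ℝ × V => p.1 • p.2) (by fun_prop)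

theorem PwSmooth.innerProd {f g : ℝ → E → E} (hf : M.PwSmooth k I f) (hg : M.PwSmooth k I g) :
    M.PwSmooth k I fun t x => (inner ℝ (f t x) (g t x) : ℝ) :=
  (hf.prodMk hg).comp_contDiff (Φ := fun p : E × E => (inner ℝ p.1 p.2 : ℝ))
    (contDiff_fst.inner ℝ contDiff_snd)

theorem PwSmooth.apply {A : ℝ → E → Tensor} {f : ℝ → E → E} (hA : M.PwSmooth k I A)
    (hf : M.PwSmooth k I f) : M.PwSmooth k I fun t x => A t x (f t x) :=
  (hA.prodMk hf).comp_contDiff (Φ := fun p : Tensor × E => p.1 p.2) (by fun_prop)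

theorem contDiff_transp {n : WithTop ℕ∞} : ContDiff ℝ n transp := by
  have : transp = fun A : Tensor => (ContinuousLinearMap.adjoint (𝕜 := ℝ) (E := E) (F := E)) A := rfl
  rw [this]
  exact (ContinuousLinearMap.adjoint (𝕜 := ℝ) (E := E) (F := E)).toContinuousLinearEquiv.contDiff

namespace IsKinematic

variable (h : M.IsKinematic I) (ht : t ∈ I)

include h ht

theorem eventually_mem_side {Y : Set E} {X : E} (hI : IsOpen I) (hs : M.RefSide Y X) :
    ∀ᶠ q in 𝓝[Prod.snd ⁻¹' Y] (t, X), q.1 ∈ I ∧ q.2 ∈ M.ref solid \ M.Ss := by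
  rw [nhdsWithin_snd_preimage]
  exact (tendsto_fst.eventually (hI.mem_nhds ht)).and
    (tendsto_snd.eventually (h.eventually_mem_of_side hs))

/-- Smoothness of fields that are given on the reference configuration. -/
theorem hasExt_of_ref (hI : IsOpen I) {g : ℝ → E → V} {Y : Set E} {X : E} (hs : M.RefSide Y X)
    (hg : HasExt k (Prod.snd ⁻¹' Y) (t, X) fun q : ℝ × E => g q.1 q.2) :
    HasExt k (Prod.snd ⁻¹' Y) (t, X)
      fun q : ℝ × E => g q.1 (M.inv solid q.1 (M.χ solid q.1 q.2)) := by
  refine hg.congr ?_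
  filter_upwards [h.eventually_mem_side ht hI hs] with q hq
  rw [h.inv_solid_χ hq.1 hq.2.1]

omit ht

theorem pwSmooth_v_solid (hI : IsOpen I) : M.PwSmooth 1 I (M.v solid) :=
  fun _ ht _ _ hs => h.hasExt_of_ref ht hI hs (h.hasExt_velRef ht hs)

include ht

/-- Off the interface, the field is its pull-back composed with the smooth inverse of the solid
motion. -/
theorem contDiffAt_of_pwSmooth (hf : M.PwSmooth k I f) (hk : k ≤ 2) {x : E}
    (hx : x ∈ M.body t \ M.interface t) : ContDiffAt ℝ k (fun q : ℝ × E => f q.1 q.2) (t, x) := by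
  have hX := h.inv_mem ht solid hx
  rw [h.offRef_solid ht] at hX
  have h1 := hasExt_univ.1 (hf t ht univ _ (Or.inl ⟨hX, rfl⟩))
  refine (h.contDiffAt_spatial ht solid (f := fun t X => f t (M.χ solid t X)) hk hx
    h1).congr_of_eventuallyEq ?_
  filter_upwards [h.isOpen_off.mem_nhds (mem_off ht hx)] with q hq
  simp only [h.χ_inv hq.1 solid hq.2]

theorem contDiffAt_space_of_pwSmooth (hf : M.PwSmooth k I f) (hk : k ≤ 2) {x : E}
    (hx : x ∈ M.body t \ M.interface t) : ContDiffAt ℝ k (f t) x :=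
  ContDiffAt.comp (f := fun y => (t, y)) (g := fun q : ℝ × E => f q.1 q.2) x
    (h.contDiffAt_of_pwSmooth ht hf hk hx) (by fun_prop)

/-- On either side of the convected interface, the one-sided extension of the pull-back is composed
with the one-sided extension of the inverse motion. -/
theorem isPwC1 {f : ℝ → E → E} (hf : M.PwSmooth 1 I f) :
    IsPwC1 (M.body t) (M.interface t) (M.m t) (f t) where
  isOpen := h.isOpen_body ht
  isOpen_diff := h.isOpen_body_diff ht
  subset := h.interface_subset
  smooth x hx := h.contDiffAt_space_of_pwSmooth ht hf one_le_two hx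
  sides := by
    rintro x ⟨X, hX, rfl⟩
    obtain ⟨g, hg⟩ := h.surface.2.2.2 X hX
    obtain ⟨G, U, ιp, ιm, h1, h2, h3, h4, h5, h6, hUB, h7⟩ := h.exists_interface_chart ht hX hg
    obtain ⟨Fp, p1, p2⟩ := (hf t ht {y | 0 < g y} X (Or.inr ⟨hX, g, hg, Or.inl rfl⟩)).slice
    obtain ⟨Fm, m1, m2⟩ := (hf t ht {y | g y < 0} X (Or.inr ⟨hX, g, hg, Or.inr rfl⟩)).slice
    have hxB : M.χ solid t X ∈ M.body t := hUB h1
    have ti : Tendsto (M.inv solid t) (𝓝 (M.χ solid t X)) (𝓝 X) := by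
      have := (h.continuousAt_inv_solid ht hxB).tendsto
      rwa [h.inv_solid_χ ht (h.Ss_subset hX)] at this
    have c1 : ContDiffAt ℝ 1 (fun y => Fp (ιp y)) (M.χ solid t X) :=
      ContDiffAt.comp _ (by rw [h5]; exact p1) h3
    have c2 : ContDiffAt ℝ 1 (fun y => Fm (ιm y)) (M.χ solid t X) :=
      ContDiffAt.comp _ (by rw [h6]; exact m1) h4
    obtain ⟨U', hU', hU'o, hxU'⟩ := eventually_nhds_iff.1 ((c1.eventually (by simp)).and
      ((c2.eventually (by simp)).and ((ti.eventually (eventually_nhdsWithin_iff.1 p2)).and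
        (ti.eventually (eventually_nhdsWithin_iff.1 m2)))))
    refine ⟨G, U ∩ U', _, _, ⟨h1, hxU'⟩, ⟨h2.isOpen.inter hU'o,
      h2.contDiffOn.mono inter_subset_left, fun y hy => h2.fderiv_ne y hy.1,
      fun y hy => h2.mem_iff y hy.1, fun y hy => h2.normal y hy.1⟩,
      fun y hy => (hU' y hy.2).1.contDiffWithinAt, fun y hy => (hU' y hy.2).2.1.contDiffWithinAt,
      fun y hy => ⟨fun hG => ?_, fun hG => ?_⟩⟩
    · obtain ⟨a1, a2⟩ := (h7 y hy.1).1 hG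
      have := (hU' y hy.2).2.2.1 a1
      simp only [χ_inv_solid (hUB hy.1)] at this
      rw [this, a2]
    · obtain ⟨a1, a2⟩ := (h7 y hy.1).2 hG
      have := (hU' y hy.2).2.2.2 a1
      simp only [χ_inv_solid (hUB hy.1)] at this
      rw [this, a2]

/-- One-sided limits at the interface, along the normal. -/
theorem tendsto_traces (hf : M.PwSmooth k I f) {x : E} (hx : x ∈ M.interface t) :
    Tendsto (fun s : ℝ => f t (x + s • M.m t x)) (𝓝[>] 0) (𝓝 (tracePlus (M.m t x) (f t) x)) ∧
    Tendsto (fun s : ℝ => f t (x - s • M.m t x)) (𝓝[>] 0) (𝓝 (traceMinus (M.m t x) (f t) x)) := by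
  obtain ⟨X, hX, rfl⟩ := hx
  have hx : M.χ solid t X ∈ M.interface t := mem_image_of_mem _ hX
  obtain ⟨g, hg⟩ := h.surface.2.2.2 X hX
  obtain ⟨G, U, ιp, ιm, h1, h2, h3, h4, h5, h6, hUB, h7⟩ := h.exists_interface_chart ht hX hg
  have ti : Tendsto (M.inv solid t) (𝓝 (M.χ solid t X)) (𝓝 X) := by
    have := (h.continuousAt_inv_solid ht (hUB h1)).tendsto
    rwa [h.inv_solid_χ ht (h.Ss_subset hX)] at this
  have hU := h2.isOpen.mem_nhds h1
  obtain ⟨a, ha⟩ :=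
    (hf t ht {y | 0 < g y} X (Or.inr ⟨hX, g, hg, Or.inl rfl⟩)).slice.exists_tendsto
  obtain ⟨b, hb⟩ :=
    (hf t ht {y | g y < 0} X (Or.inr ⟨hX, g, hg, Or.inr rfl⟩)).slice.exists_tendsto
  have t1 : Tendsto (f t) (𝓝[{y | 0 < G y}] (M.χ solid t X)) (𝓝 a) := by
    have : Tendsto (M.inv solid t) (𝓝[{y | 0 < G y}] (M.χ solid t X)) (𝓝[{y | 0 < g y}] X) := by
      refine tendsto_nhdsWithin_iff.2 ⟨ti.mono_left nhdsWithin_le_nhds, ?_⟩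
      filter_upwards [self_mem_nhdsWithin, mem_nhdsWithin_of_mem_nhds hU] with y hy hyU
      exact ((h7 y hyU).1 hy).1
    refine (ha.comp this).congr' ?_
    filter_upwards [mem_nhdsWithin_of_mem_nhds hU] with y hyU
    simp only [Function.comp_apply, χ_inv_solid (hUB hyU)]
  have t2 : Tendsto (f t) (𝓝[{y | G y < 0}] (M.χ solid t X)) (𝓝 b) := by
    have : Tendsto (M.inv solid t) (𝓝[{y | G y < 0}] (M.χ solid t X)) (𝓝[{y | g y < 0}] X) := by
      refine tendsto_nhdsWithin_iff.2 ⟨ti.mono_left nhdsWithin_le_nhds, ?_⟩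
      filter_upwards [self_mem_nhdsWithin, mem_nhdsWithin_of_mem_nhds hU] with y hy hyU
      exact ((h7 y hyU).2 hy).1
    refine (hb.comp this).congr' ?_
    filter_upwards [mem_nhdsWithin_of_mem_nhds hU] with y hyU
    simp only [Function.comp_apply, χ_inv_solid (hUB hyU)]
  rw [h2.tracePlus_eq_of_tendsto h1 hx t1, h2.traceMinus_eq_of_tendsto h1 hx t2]
  exact ⟨h2.tracePlus_eq h1 hx t1, h2.traceMinus_eq h1 hx t2⟩

omit ht in
/-- Fields that extend from either side of the reference interface are locally bounded. -/
theorem exists_bound_ref {g : ℝ × E → V} {X : E} (hX : X ∈ M.ref solid)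
    (hg : ∀ Y, M.RefSide Y X → HasExt k (Prod.snd ⁻¹' Y) (t, X) g) :
    ∃ C, ∀ᶠ q in 𝓝 (t, X), q.2 ∉ M.Ss → ‖g q‖ ≤ C := by
  have hb : ∀ Y, M.RefSide Y X → ∃ C, ∀ᶠ q in 𝓝 (t, X), q.2 ∈ Y → ‖g q‖ ≤ C := by
    intro Y hs
    obtain ⟨a, ha⟩ := (hg Y hs).exists_tendsto
    refine ⟨‖a‖ + 1, ?_⟩
    filter_upwards [eventually_nhdsWithin_iff.1 (ha.norm.eventually (gt_mem_nhds (lt_add_one _)))]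
      with q h2 h3
    exact (h2 h3).le
  by_cases hXS : X ∈ M.Ss
  · obtain ⟨g, hg⟩ := h.surface.2.2.2 X hXS
    obtain ⟨U, hXU, hU⟩ := hg.exists_chart
    obtain ⟨C, hC⟩ := hb _ (Or.inr ⟨hXS, g, hg, Or.inl rfl⟩)
    obtain ⟨C', hC'⟩ := hb _ (Or.inr ⟨hXS, g, hg, Or.inr rfl⟩)
    refine ⟨max C C', ?_⟩
    filter_upwards [hC, hC', continuousAt_snd.eventually (hU.isOpen.mem_nhds hXU)]
      with q h1 h2 h4 h5
    have h6 : g q.2 ≠ 0 := fun h0 => h5 ((hU.mem_iff _ h4).2 h0)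
    rcases lt_or_gt_of_ne h6 with h7 | h7
    · exact (h2 h7).trans (le_max_right _ _)
    · exact (h1 h7).trans (le_max_left _ _)
  · obtain ⟨C, hC⟩ := hb univ (Or.inl ⟨⟨hX, hXS⟩, rfl⟩)
    exact ⟨C, hC.mono fun q hq _ => hq (mem_univ _)⟩

/-- Piecewise smooth fields are bounded, locally in space and time. -/
theorem exists_bound (hf : M.PwSmooth k I f) {x : E} (hx : x ∈ M.body t) :
    ∃ C, ∀ᶠ q in 𝓝 (t, x), q.2 ∉ M.interface q.1 → ‖f q.1 q.2‖ ≤ C := by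
  obtain ⟨C, hC⟩ := h.exists_bound_ref (inv_solid_mem hx) fun Y hs => hf t ht Y _ hs
  have ti : Tendsto (fun q : ℝ × E => (q.1, M.inv solid q.1 q.2)) (𝓝 (t, x))
      (𝓝 (t, M.inv solid t x)) :=
    (continuousAt_fst.prodMk (h.continuousAt_inv_solid_joint ht hx)).tendsto
  have hmem : ∀ᶠ q in 𝓝 (t, x), q.1 ∈ I ∧ q.2 ∈ M.body q.1 := h.solid_open.mem_nhds ⟨ht, hx⟩
  refine ⟨C, ?_⟩
  filter_upwards [ti.eventually hC, hmem] with q h1 h2 h3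
  have h4 := h1 fun h5 => h3 ((h.mem_interface_iff h2.1 h2.2).2 h5)
  rwa [χ_inv_solid h2.2] at h4

theorem volume_interface (hI : IsOpen I) : volume (M.interface t) = 0 :=
  (h.isPwC1 ht (h.pwSmooth_v_solid hI)).null

theorem isPwCont (hI : IsOpen I) (hf : M.PwSmooth 0 I f) :
    IsPwCont (M.body t) (M.interface t) (f t) where
  isOpen := h.isOpen_body ht
  isOpen_diff := h.isOpen_body_diff ht
  null := h.volume_interface ht hI
  cont x hx := (h.contDiffAt_space_of_pwSmooth ht hf (by norm_num) hx).continuousAt.continuousWithinAt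
  bdd x hx := by
    obtain ⟨C, hC⟩ := h.exists_bound ht hf hx
    exact ⟨C, (tendsto_const_nhds.prodMk_nhds tendsto_id : Tendsto (fun y : E => (t, y)) (𝓝 x)
      (𝓝 (t, x))).eventually hC⟩

/-- The solid velocity is continuous across the interface. -/
theorem tendsto_velRef {Y : Set E} {X : E} (hI : IsOpen I) (hs : M.RefSide Y X)
    (hX : X ∈ M.ref solid) :
    Tendsto (M.velRef solid t) (𝓝[Y] X) (𝓝 (M.velRef solid t X)) := by
  have := hs.neBot
  obtain ⟨F, f1, f2⟩ := h.hasExt_χ ht hs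
  have e1 : ∀ᶠ q in 𝓝 (t, X), ContDiffAt ℝ 2 F q := f1.eventually (by simp)
  have tτ : Tendsto (fun τ : ℝ => (τ, X)) (𝓝 t) (𝓝 (t, X)) :=
    tendsto_id.prodMk_nhds tendsto_const_nhds
  -- Even for a particle `X` on the surface, the motion agrees with its one-sided extension at all
  -- times near `t`, by continuity of the motion in space. So the velocity of `X` is the time
  -- derivative of the extension from either side, and is the limit of the velocities on that side.
  have e2 : ∀ᶠ τ in 𝓝 t, M.χ solid τ X = F (τ, X) := by
    filter_upwards [tτ.eventually (eventually_nhdsWithin_iff.1 f2).eventually_nhds,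
      tτ.eventually e1, hI.mem_nhds ht] with τ h1 h2 h3
    have h4 : Tendsto (fun y : E => (τ, y)) (𝓝 X) (𝓝 (τ, X)) :=
      tendsto_const_nhds.prodMk_nhds tendsto_id
    refine tendsto_nhds_unique ((h.continuousAt_χ_solid h3 hX).tendsto.mono_left
      (nhdsWithin_le_nhds (s := Y))) (((h2.continuousAt.tendsto.comp h4).mono_left
      nhdsWithin_le_nhds).congr' ?_)
    filter_upwards [self_mem_nhdsWithin, mem_nhdsWithin_of_mem_nhds (h4.eventually h1)] with y h5 h6
    exact (h6 h5).symm
  have e3 : M.velRef solid t X = fderiv ℝ F (t, X) (1, 0) := by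
    rw [velRef, EventuallyEq.deriv_eq e2]
    exact (deriv_slice (f1.differentiableAt two_ne_zero)).deriv
  rw [e3]
  have t1 : Tendsto (fun y : E => fderiv ℝ F (t, y) (1, 0)) (𝓝[Y] X)
      (𝓝 (fderiv ℝ F (t, X) (1, 0))) :=
    (((ContinuousLinearMap.apply ℝ E ((1 : ℝ), (0 : E))).continuous.tendsto _).comp
      ((f1.continuousAt_fderiv two_ne_zero).tendsto.comp
        (tendsto_nhds_of_tendsto_nhdsWithin (tendsto_slice t X Y))))
  refine t1.congr' ?_
  have h5 := (tendsto_slice t X Y).eventually (eventually_eventually_nhdsWithin.2 f2)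
  have h6 := (tendsto_slice t X Y).eventually (hs.eventually_mem_nhds_prod t)
  have h7 := (tendsto_slice t X Y).eventually (e1.filter_mono nhdsWithin_le_nhds)
  filter_upwards [h5, h6, h7] with y h5 h6 h7
  rw [nhdsWithin_eq_nhds.2 h6] at h5
  have h8 : (fun τ => M.χ solid τ y) =ᶠ[𝓝 t] fun τ => F (τ, y) :=
    (tendsto_id.prodMk_nhds tendsto_const_nhds : Tendsto (fun τ : ℝ => (τ, y)) (𝓝 t)
      (𝓝 (t, y))).eventually h5
  rw [velRef, h8.deriv_eq]
  exact (deriv_slice (h7.differentiableAt two_ne_zero)).deriv.symm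

theorem trace_v_solid (hI : IsOpen I) {x : E} (hx : x ∈ M.interface t) :
    tracePlus (M.m t x) (M.v solid t) x = M.v solid t x ∧
      traceMinus (M.m t x) (M.v solid t) x = M.v solid t x := by
  obtain ⟨X, hX, rfl⟩ := hx
  have hx : M.χ solid t X ∈ M.interface t := mem_image_of_mem _ hX
  obtain ⟨g, hg⟩ := h.surface.2.2.2 X hX
  obtain ⟨G, U, ιp, ιm, h1, h2, h3, h4, h5, h6, hUB, h7⟩ := h.exists_interface_chart ht hX hg
  have hiX := h.inv_solid_χ ht (h.Ss_subset hX)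
  have ti : Tendsto (M.inv solid t) (𝓝 (M.χ solid t X)) (𝓝 X) := by
    have := (h.continuousAt_inv_solid ht (hUB h1)).tendsto
    rwa [hiX] at this
  have hU := h2.isOpen.mem_nhds h1
  have hv : M.v solid t (M.χ solid t X) = M.velRef solid t X := by rw [v, hiX]
  rw [hv]
  constructor
  · refine h2.tracePlus_eq_of_tendsto h1 hx ((h.tendsto_velRef ht hI
      (Or.inr ⟨hX, g, hg, Or.inl rfl⟩) (h.Ss_subset hX)).comp
      (tendsto_nhdsWithin_iff.2 ⟨ti.mono_left nhdsWithin_le_nhds, ?_⟩))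
    filter_upwards [self_mem_nhdsWithin, mem_nhdsWithin_of_mem_nhds hU] with y hy hyU
    exact ((h7 y hyU).1 hy).1
  · refine h2.traceMinus_eq_of_tendsto h1 hx ((h.tendsto_velRef ht hI
      (Or.inr ⟨hX, g, hg, Or.inr rfl⟩) (h.Ss_subset hX)).comp
      (tendsto_nhdsWithin_iff.2 ⟨ti.mono_left nhdsWithin_le_nhds, ?_⟩))
    filter_upwards [self_mem_nhdsWithin, mem_nhdsWithin_of_mem_nhds hU] with y hy hyU
    exact ((h7 y hyU).2 hy).1

end IsKinematic

end Mixture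

end Poro

/-! ### The transport theorem for integrals against a test function. -/

namespace Poro

/-- Local bounds in space-time around `{t} × K` become one bound on `K` at all times near `t`, by
compactness. -/
theorem exists_uniform_bound {X F : Type*} [TopologicalSpace X] [NormedAddCommGroup F] {K : Set X}
    (hK : IsCompact K) {t : ℝ} {P : ℝ × X → Prop} {f : ℝ × X → F}
    (h : ∀ x ∈ K, ∃ C : ℝ, ∀ᶠ q in 𝓝 (t, x), P q → ‖f q‖ ≤ C) :
    ∃ C : ℝ, 0 ≤ C ∧ ∀ᶠ τ in 𝓝 t, ∀ x ∈ K, P (τ, x) → ‖f (τ, x)‖ ≤ C := by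
  obtain ⟨C, h0, hC⟩ := exists_bound_of_locally (K := {t} ×ˢ K) (isCompact_singleton.prod hK)
    (P := P) (f := f) (by rintro ⟨τ, x⟩ ⟨rfl, hx⟩; exact h x hx)
  refine ⟨C, h0, hK.eventually_forall_of_forall_eventually fun x hx => ?_⟩
  exact eventually_nhdsSet_iff_forall.1 hC (t, x) ⟨rfl, hx⟩

namespace Mixture

open Phase

variable {M : Mixture} {I : Set ℝ} {t : ℝ}

/-- The density of `f` per unit reference volume of the solid. -/
noncomputable def refDensity (M : Mixture) (f : ℝ → E → ℝ) (t : ℝ) (X : E) : ℝ :=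
  M.J solid t X * f t (M.χ solid t X)

/-- The rate of change of a quantity convected by the solid, per unit current volume. -/
noncomputable def rate (M : Mixture) (f : ℝ → E → ℝ) (t : ℝ) (x : E) : ℝ :=
  (M.J solid t (M.inv solid t x))⁻¹ *
    deriv (fun τ => M.refDensity f τ (M.inv solid t x)) t

namespace IsKinematic

variable (h : M.IsKinematic I) (ht : t ∈ I)

include h ht

theorem hasExt_refDensity {f : ℝ → E → ℝ} (hf : M.PwSmooth 1 I f) {Y : Set E} {X : E}
    (hs : M.RefSide Y X) :
    HasExt 1 (Prod.snd ⁻¹' Y) (t, X) fun q : ℝ × E => M.refDensity f q.1 q.2 :=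
  ((h.hasExt_J ht hs).prodMk (hf t ht Y X hs)).comp_contDiff (Φ := fun p : ℝ × ℝ => p.1 * p.2)
    (by fun_prop)

theorem hasExt_deriv_refDensity {f : ℝ → E → ℝ} (hf : M.PwSmooth 1 I f) {Y : Set E} {X : E}
    (hs : M.RefSide Y X) :
    HasExt 0 (Prod.snd ⁻¹' Y) (t, X)
      fun q : ℝ × E => deriv (fun τ => M.refDensity f τ q.2) q.1 :=
  (h.hasExt_refDensity ht hf hs).deriv_time (hs.eventually_mem_nhds_prod t)

omit ht

theorem pwSmooth_rate (hI : IsOpen I) {f : ℝ → E → ℝ} (hf : M.PwSmooth 1 I f) :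
    M.PwSmooth 0 I (M.rate f) := by
  intro t ht Y X hs
  have := hs.neBot_prod t
  refine h.hasExt_of_ref ht hI (g := fun t X => (M.J solid t X)⁻¹ *
    deriv (fun τ => M.refDensity f τ X) t) hs ?_
  obtain ⟨a, ha, hJ⟩ := h.exists_tendsto_J ht hs
  exact ((((h.hasExt_J ht hs).of_le zero_le_one).comp_contDiffAt hJ
    (_root_.contDiffAt_inv ℝ ha.ne')).prodMk (h.hasExt_deriv_refDensity ht hf hs)).comp_contDiff
    (Φ := fun p : ℝ × ℝ => p.1 * p.2) (by fun_prop)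

include ht

/-- Change of variables by the solid motion. -/
theorem integral_eq_integral_ref (hI : IsOpen I) {G : E → ℝ} (hG : ∀ x ∉ M.body t, G x = 0) :
    ∫ x, G x = ∫ X in M.ref solid \ M.Ss, M.J solid t X * G (M.χ solid t X) := by
  have hbij := h.bijOn ht solid
  rw [h.offRef_solid ht] at hbij
  have h1 : ∫ x, G x = ∫ x in M.body t \ M.interface t, G x := by
    refine (setIntegral_eq_integral_of_ae_compl_eq_zero ?_).symm
    filter_upwards [measure_eq_zero_iff_ae_notMem.1 (h.volume_interface ht hI)] with x hx hx'
    exact hG x fun hB => hx' ⟨hB, hx⟩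
  have hd : ∀ X ∈ M.ref solid \ M.Ss, HasFDerivWithinAt (M.χ solid t) (M.F solid t X)
      (M.ref solid \ M.Ss) X := fun X hX =>
    (((h.contDiffAt_χ ht solid (by rwa [h.offRef_solid ht])).differentiableAt
      two_ne_zero).comp (f := fun Y => (t, Y)) (g := fun q : ℝ × E => M.χ solid q.1 q.2) X
      (by fun_prop)).hasFDerivAt.hasFDerivWithinAt
  rw [h1, ← hbij.image_eq, integral_image_eq_integral_abs_det_fderiv_smul volume
    h.isOpen_ref_diff.measurableSet hd hbij.injOn]
  refine setIntegral_congr_fun h.isOpen_ref_diff.measurableSet fun X hX => ?_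
  have : 0 < (M.F solid t X).det := h.solid_det t ht X hX
  simp only [abs_of_pos this, smul_eq_mul, J]

theorem hasDerivAt_χ (a : Phase) {X : E} (hX : X ∈ M.offRef a t) :
    HasDerivAt (fun τ => M.χ a τ X) (M.velRef a t X) t := by
  have := deriv_slice ((h.contDiffAt_χ ht a hX).differentiableAt two_ne_zero)
  exact this.differentiableAt.hasDerivAt

/-- The transport theorem, tested with a function. -/
theorem hasDerivAt_integral_test (hI : IsOpen I) {f : ℝ → E → ℝ} (hf : M.PwSmooth 1 I f)
    {ψ : E → ℝ} (hψ : ContDiff ℝ 1 ψ) (hψc : HasCompactSupport ψ) (hψs : tsupport ψ ⊆ M.body t) :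
    HasDerivAt (fun τ => ∫ x, ψ x * f τ x)
      (∫ x, (fderiv ℝ ψ x (f t x • M.v solid t x) + ψ x * M.rate f t x)) t := by
  set K := tsupport ψ with hK
  have hKc : IsCompact K := hψc
  set R := M.ref solid \ M.Ss with hR
  have hRm : MeasurableSet R := h.isOpen_ref_diff.measurableSet
  have hψ0 : ∀ x ∉ K, ψ x = 0 := fun x hx => image_eq_zero_of_notMem_tsupport hx
  have hdψ0 : ∀ x ∉ K, fderiv ℝ ψ x = 0 := fun x hx => fderiv_eq_zero_of_tsupport_subset le_rfl hx
  have hK₀ : IsCompact (M.inv solid t '' K) := hKc.image_of_continuousOn fun x hx =>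
    (h.continuousAt_inv_solid ht (hψs hx)).continuousWithinAt
  -- A relatively compact neighbourhood, in the solid body, of the preimage of the support of `ψ` at
  -- time `t`. By joint continuity of the inverse motion it contains the preimages at all times near
  -- `t`, so the pulled-back integrands live on one fixed set.
  obtain ⟨W, hW, hKW, hWR, hWc⟩ := exists_open_between_and_isCompact_closure hK₀ (h.open_ref solid)
    (by rintro _ ⟨x, hx, rfl⟩; exact inv_solid_mem (hψs hx))
  obtain ⟨C₁, hC₁, b1⟩ := exists_uniform_bound hWc (t := t) (P := fun q => q.2 ∉ M.Ss)
    (f := fun q : ℝ × E => M.refDensity f q.1 q.2) fun X hX =>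
      h.exists_bound_ref (hWR hX) fun Y hs => h.hasExt_refDensity ht hf hs
  obtain ⟨C₂, hC₂, b2⟩ := exists_uniform_bound hWc (t := t) (P := fun q => q.2 ∉ M.Ss)
    (f := fun q : ℝ × E => deriv (fun τ => M.refDensity f τ q.2) q.1) fun X hX =>
      h.exists_bound_ref (hWR hX) fun Y hs => h.hasExt_deriv_refDensity ht hf hs
  obtain ⟨C₃, hC₃, b3⟩ := exists_uniform_bound hWc (t := t) (P := fun q => q.2 ∉ M.Ss)
    (f := fun q : ℝ × E => M.velRef solid q.1 q.2) fun X hX =>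
      h.exists_bound_ref (hWR hX) fun Y hs => h.hasExt_velRef ht hs
  obtain ⟨C₄, hC₄⟩ := hψc.exists_bound_of_continuous hψ.continuous
  obtain ⟨C₅, hC₅⟩ := contDiff_fderiv_bound hψ hψc
  have hC₄' : 0 ≤ C₄ := (norm_nonneg _).trans (hC₄ 0)
  have hC₅' : 0 ≤ C₅ := (norm_nonneg _).trans (hC₅ 0)
  have n1 : ∀ᶠ τ in 𝓝 t, ∀ x ∈ K, x ∈ M.body τ ∧ M.inv solid τ x ∈ W := by
    refine hKc.eventually_forall_of_forall_eventually
      (P := fun τ x => x ∈ M.body τ ∧ M.inv solid τ x ∈ W) fun x hx => ?_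
    filter_upwards [h.solid_open.mem_nhds (show (t, x) ∈ _ from ⟨ht, hψs hx⟩),
      (h.continuousAt_inv_solid_joint ht (hψs hx)).eventually
        (hW.mem_nhds (hKW (mem_image_of_mem _ hx)))] with q h1 h2
    exact ⟨h1.2, h2⟩
  set s : Set ℝ := {τ | τ ∈ I ∧ (∀ x ∈ K, x ∈ M.body τ ∧ M.inv solid τ x ∈ W) ∧
    (∀ X ∈ closure W, X ∉ M.Ss → ‖M.refDensity f τ X‖ ≤ C₁) ∧
    (∀ X ∈ closure W, X ∉ M.Ss → ‖deriv (fun τ => M.refDensity f τ X) τ‖ ≤ C₂) ∧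
    (∀ X ∈ closure W, X ∉ M.Ss → ‖M.velRef solid τ X‖ ≤ C₃)} with hs
  have hsn : s ∈ 𝓝 t := by
    filter_upwards [hI.mem_nhds ht, n1, b1, b2, b3] with τ h1 h2 h3 h4 h5
    exact ⟨h1, h2, h3, h4, h5⟩
  have hout : ∀ τ ∈ s, ∀ X ∈ R, X ∉ W → M.χ solid τ X ∉ K := fun τ hτ X hX hXW hXK => by
    have := (hτ.2.1 _ hXK).2
    rw [h.inv_solid_χ hτ.1 hX.1] at this
    exact hXW this
  have hside : ∀ X ∈ R, M.RefSide univ X := fun X hX => Or.inl ⟨hX, rfl⟩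
  have hoff : ∀ τ ∈ I, ∀ X ∈ R, X ∈ M.offRef solid τ := fun τ hτ X hX => by
    rwa [h.offRef_solid hτ]
  -- In the reference configuration the domain and the interface are fixed; only the integrand
  -- depends on time, and it is differentiated under the integral sign.
  set Φ : ℝ → E → ℝ := fun τ X => ψ (M.χ solid τ X) * M.refDensity f τ X with hΦ
  set Φ' : ℝ → E → ℝ := fun τ X => fderiv ℝ ψ (M.χ solid τ X) (M.velRef solid τ X) *
    M.refDensity f τ X + ψ (M.χ solid τ X) * deriv (fun τ => M.refDensity f τ X) τ with hΦ'
  have hslice : ∀ (τ : ℝ) (X : E), Tendsto (fun Y : E => (τ, Y)) (𝓝 X) (𝓝 (τ, X)) := fun τ X =>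
    tendsto_const_nhds.prodMk_nhds tendsto_id
  have cχ : ∀ τ ∈ I, ContinuousOn (M.χ solid τ) R := fun τ hτ X hX =>
    (h.continuousAt_χ_solid hτ hX.1).continuousWithinAt
  have cE : ∀ τ ∈ I, ContinuousOn (M.refDensity f τ) R := fun τ hτ X hX =>
    ContinuousAt.continuousWithinAt ((hasExt_univ.1 (h.hasExt_refDensity hτ hf
      (hside X hX))).continuousAt.tendsto.comp (hslice τ X))
  have cE' : ∀ τ ∈ I, ContinuousOn (fun X => deriv (fun τ => M.refDensity f τ X) τ) R :=
    fun τ hτ X hX => ContinuousAt.continuousWithinAt ((hasExt_univ.1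
      (h.hasExt_deriv_refDensity hτ hf (hside X hX))).continuousAt.tendsto.comp (hslice τ X))
  have cv : ∀ τ ∈ I, ContinuousOn (M.velRef solid τ) R :=
    fun τ hτ X hX => ContinuousAt.continuousWithinAt ((hasExt_univ.1
      (h.hasExt_velRef hτ (hside X hX))).continuousAt.tendsto.comp (hslice τ X))
  have cΦ : ∀ τ ∈ I, ContinuousOn (Φ τ) R := fun τ hτ =>
    (hψ.continuous.comp_continuousOn (cχ τ hτ)).mul (cE τ hτ)
  have cΦ' : ContinuousOn (Φ' t) R :=
    ((((hψ.continuous_fderiv one_ne_zero).comp_continuousOn (cχ t ht)).clm_apply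
      (cv t ht)).mul (cE t ht)).add ((hψ.continuous.comp_continuousOn (cχ t ht)).mul (cE' t ht))
  have hWfin : volume W < ⊤ := (measure_mono subset_closure).trans_lt hWc.measure_lt_top
  have iW : ∀ C : ℝ, Integrable (W.indicator fun _ => C) (volume.restrict R) := fun C =>
    ((integrable_indicator_iff hW.measurableSet).2
      (integrableOn_const hWfin.ne)).integrableOn
  have ts : t ∈ s := mem_of_mem_nhds hsn
  have bΦ : ∀ X ∈ R, ‖Φ t X‖ ≤ W.indicator (fun _ => C₄ * C₁) X := fun X hX => by
    by_cases hXW : X ∈ W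
    · rw [indicator_of_mem hXW, norm_mul]
      exact mul_le_mul (hC₄ _) (ts.2.2.1 X (subset_closure hXW) hX.2) (norm_nonneg _) hC₄'
    · rw [indicator_of_notMem hXW, hΦ]
      simp only [hψ0 _ (hout t ts X hX hXW), zero_mul, norm_zero, le_refl]
  have bΦ' : ∀ X ∈ R, ∀ τ ∈ s, ‖Φ' τ X‖ ≤ W.indicator (fun _ => C₅ * C₃ * C₁ + C₄ * C₂) X :=
    fun X hX τ hτ => by
      by_cases hXW : X ∈ W
      · have hXc := subset_closure hXW
        rw [indicator_of_mem hXW]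
        refine (norm_add_le _ _).trans (add_le_add ?_ ?_)
        · rw [norm_mul]
          refine mul_le_mul ((ContinuousLinearMap.le_opNorm _ _).trans
            (mul_le_mul (hC₅ _) (hτ.2.2.2.2 X hXc hX.2) (norm_nonneg _) hC₅'))
            (hτ.2.2.1 X hXc hX.2) (norm_nonneg _) (by positivity)
        · rw [norm_mul]
          exact mul_le_mul (hC₄ _) (hτ.2.2.2.1 X hXc hX.2) (norm_nonneg _) hC₄'
      · rw [indicator_of_notMem hXW, hΦ']
        simp only [hψ0 _ (hout τ hτ X hX hXW), hdψ0 _ (hout τ hτ X hX hXW), zero_mul,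
          zero_apply, add_zero, norm_zero, le_refl]
  have key := hasDerivAt_integral_of_dominated_loc_of_deriv_le (μ := volume.restrict R) (F := Φ)
    (F' := Φ') (x₀ := t) (s := s) (bound := W.indicator fun _ => C₅ * C₃ * C₁ + C₄ * C₂) hsn
    (by
      filter_upwards [hI.mem_nhds ht] with τ hτ
      exact (cΦ τ hτ).aestronglyMeasurable hRm)
    ((iW (C₄ * C₁)).mono' ((cΦ t ht).aestronglyMeasurable hRm)
      ((ae_restrict_iff' hRm).2 (Eventually.of_forall bΦ)))
    (cΦ'.aestronglyMeasurable hRm) ((ae_restrict_iff' hRm).2 (Eventually.of_forall bΦ')) (iW _)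
    ((ae_restrict_iff' hRm).2 (Eventually.of_forall fun X hX τ hτ => by
      have d1 := h.hasDerivAt_χ hτ.1 solid (hoff τ hτ.1 X hX)
      have d2 : HasDerivAt (fun τ => ψ (M.χ solid τ X))
          (fderiv ℝ ψ (M.χ solid τ X) (M.velRef solid τ X)) τ :=
        ((hψ.differentiable one_ne_zero (M.χ solid τ X)).hasFDerivAt).comp_hasDerivAt τ d1
      have d3 : HasDerivAt (fun τ => M.refDensity f τ X)
          (deriv (fun τ => M.refDensity f τ X) τ) τ :=
        (deriv_slice (f := fun q : ℝ × E => M.refDensity f q.1 q.2) (q := (τ, X))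
          ((hasExt_univ.1 (h.hasExt_refDensity hτ.1 hf (hside X hX))).differentiableAt
            one_ne_zero)).differentiableAt.hasDerivAt
      exact d2.mul d3))
  have e1 : (fun τ => ∫ x, ψ x * f τ x) =ᶠ[𝓝 t] fun τ => ∫ X in R, Φ τ X := by
    filter_upwards [hsn] with τ hτ
    rw [h.integral_eq_integral_ref hτ.1 hI fun x hx => by
      rw [hψ0 x fun hxK => hx (hτ.2.1 x hxK).1, zero_mul]]
    refine integral_congr_ae (Eventually.of_forall fun X => ?_)
    simp only [hΦ, refDensity]
    ring
  -- The derivative is carried back to the current configuration; the factor `J_s` of the change of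
  -- variables cancels the `J_s⁻¹` in `rate`.
  have e2 : ∫ x, (fderiv ℝ ψ x (f t x • M.v solid t x) + ψ x * M.rate f t x) =
      ∫ X in R, Φ' t X := by
    rw [h.integral_eq_integral_ref ht hI fun x hx => by
      rw [hψ0 x fun hxK => hx (hψs hxK), hdψ0 x fun hxK => hx (hψs hxK), zero_mul,
        zero_apply, add_zero]]
    refine setIntegral_congr_fun hRm fun X hX => ?_
    have hJ := h.solid_det t ht X hX
    simp only [hΦ', rate, v, h.inv_solid_χ ht hX.1, map_smul, smul_eq_mul]
    rw [refDensity]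
    field_simp
  rw [e2]
  exact key.2.congr_of_eventuallyEq e1

end IsKinematic

end Mixture

end Poro

/-! ### The transport theorem on a fixed Lipschitz domain. -/

namespace Poro

namespace Mixture

open Phase

variable {M : Mixture} {I : Set ℝ} {t : ℝ}

namespace IsKinematic

variable (h : M.IsKinematic I) (ht : t ∈ I)

include h ht

theorem eventually_subset_body (hI : IsOpen I) {K : Set E} (hK : IsCompact K) (hKB : K ⊆ M.body t) :
    ∀ᶠ τ in 𝓝 t, τ ∈ I ∧ K ⊆ M.body τ :=
  Filter.Eventually.and (hI.mem_nhds ht) (hK.eventually_forall_of_forall_eventually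
    (P := fun τ x => x ∈ M.body τ) fun x hx => by
      filter_upwards [h.solid_open.mem_nhds (show (t, x) ∈ _ from ⟨ht, hKB hx⟩)] with q hq
      exact hq.2)

/-- Bounds on a piecewise smooth field, truncated to `U`, near the time `t`. -/
theorem exists_truncation (hI : IsOpen I) {F : Type*} [NormedAddCommGroup F] [NormedSpace ℝ F]
    [MeasurableSpace F] [BorelSpace F] [SecondCountableTopology F] {f : ℝ → E → F}
    (hf : M.PwSmooth 0 I f) {U : Set E} (hU : IsOpen U) (hUc : IsCompact (closure U))
    (hUB : closure U ⊆ M.body t) :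
    ∃ C : ℝ, ∀ᶠ τ in 𝓝 t, Integrable ((U \ M.interface τ).indicator (f τ)) ∧
      ∀ x, ‖(U \ M.interface τ).indicator (f τ) x‖ ≤ C := by
  obtain ⟨C, hC0, hC⟩ := exists_uniform_bound hUc (t := t) (P := fun q => q.2 ∉ M.interface q.1)
    (f := fun q : ℝ × E => f q.1 q.2) fun x hx => h.exists_bound ht hf (hUB hx)
  refine ⟨C, ?_⟩
  filter_upwards [hC, h.eventually_subset_body ht hI hUc hUB] with τ h1 h2
  obtain ⟨-, -, -, -, h3⟩ := (h.isPwCont h2.1 hI hf).exists_truncation hU hUc h2.2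
  refine ⟨h3, fun x => ?_⟩
  by_cases hx : x ∈ U \ M.interface τ
  · rw [indicator_of_mem hx]
    exact h1 x (subset_closure hx.1) hx.2
  · rwa [indicator_of_notMem hx, norm_zero]

/-- The complement of the interface is open in space-time, so the truncation, although it depends on
time through the interface, is invisible near `(t, x)`. -/
theorem tendsto_truncation {F : Type*} [NormedAddCommGroup F] [NormedSpace ℝ F] {f : ℝ → E → F}
    (hf : M.PwSmooth 0 I f) {U : Set E} (hU : IsOpen U) (hUB : U ⊆ M.body t) {x : E} (hx : x ∈ U)
    (hxS : x ∉ M.interface t) :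
    Tendsto (fun q : ℝ × E => (U \ M.interface q.1).indicator (f q.1) q.2) (𝓝 (t, x))
      (𝓝 (f t x)) := by
  have hx' : x ∈ M.body t \ M.interface t := ⟨hUB hx, hxS⟩
  refine (h.contDiffAt_of_pwSmooth ht hf (by norm_num) hx').continuousAt.tendsto.congr' ?_
  filter_upwards [h.isOpen_off.mem_nhds (mem_off ht hx'),
    continuousAt_snd.eventually (hU.mem_nhds hx)] with q h1 h2
  exact (indicator_of_mem (show q.2 ∈ U \ M.interface q.1 from ⟨h2, h1.2.2⟩) _).symm

set_option maxHeartbeats 1000000 in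
/-- The transport theorem on a fixed Lipschitz domain, for a field that is smooth on either side of
the convected interface. -/
theorem hasDerivAt_setIntegral (hI : IsOpen I) {f : ℝ → E → ℝ} (hf : M.PwSmooth 1 I f) {Ω : Set E}
    (hΩ : IsLipschitzDomain Ω) (hΩB : closure Ω ⊆ M.body t)
    (hcross : area (frontier Ω ∩ M.interface t) = 0) :
    HasDerivAt (fun τ => ∫ x in Ω, f τ x)
      (-(∫ y in frontier Ω, inner ℝ (outerNormal Ω y) (f t y • M.v solid t y) ∂area) +
        ∫ x in Ω, M.rate f t x) t := by
  obtain ⟨U, hU, hΩU, hUB, hUc⟩ := exists_open_between_and_isCompact_closure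
    hΩ.2.1.isCompact_closure (h.isOpen_body ht) hΩB
  have hf0 : M.PwSmooth 0 I f := hf.of_le zero_le_one
  have hv0 : M.PwSmooth 0 I (M.v solid) := (h.pwSmooth_v_solid hI).of_le zero_le_one
  have hW : M.PwSmooth 0 I fun τ x => f τ x • M.v solid τ x := hf0.smul hv0
  have hq := h.pwSmooth_rate hI hf
  obtain ⟨C, hC⟩ := h.exists_truncation ht hI hf0 hU hUc hUB
  obtain ⟨CW, hCW⟩ := h.exists_truncation ht hI hW hU hUc hUB
  obtain ⟨Cq, hCq⟩ := h.exists_truncation ht hI hq hU hUc hUB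
  have hev := eventually_tsupport_smoothInd_subset hΩ.2.1 hU hΩU
  have hIB := h.eventually_subset_body ht hI hUc hUB
  have hSv : ∀ τ ∈ I, ∀ᵐ x : E, x ∉ M.interface τ := fun τ hτ =>
    measure_eq_zero_iff_ae_notMem.1 (h.volume_interface hτ hI)
  have hSfr : ∀ᵐ y ∂area.restrict (frontier Ω), y ∉ M.interface t := by
    rw [ae_restrict_iff' isClosed_frontier.measurableSet]
    filter_upwards [measure_eq_zero_iff_ae_notMem.1 hcross] with x hx hxΩ hxS using hx ⟨hxΩ, hxS⟩
  have hfrv : ∀ᵐ y : E, y ∉ frontier Ω := by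
    have := hΩ.isGaussNhd.volume_frontier
    rw [inter_univ] at this
    exact measure_eq_zero_iff_ae_notMem.1 this
  have hmul : ∀ n (g : E → ℝ), Integrable g → Integrable fun x => smoothInd Ω n x * g x := by
    intro n g hg
    refine hg.norm.mono' ((contDiff_smoothInd hΩ.1 n).continuous.aestronglyMeasurable.mul
      hg.aestronglyMeasurable) (Eventually.of_forall fun x => ?_)
    rw [norm_mul]
    exact mul_le_of_le_one_left (norm_nonneg _) (abs_smoothInd_le n x)
  have hUi : ∀ C : ℝ, Integrable (U.indicator fun _ => C) := fun C =>
    (integrable_indicator_iff hU.measurableSet).2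
      (integrableOn_const ((measure_mono subset_closure).trans_lt hUc.measure_lt_top).ne)
  have hbd : ∀ {τ : ℝ} {g : E → ℝ} {C : ℝ} (n : ℕ),
      (∀ x, ‖(U \ M.interface τ).indicator g x‖ ≤ C) →
      ∀ x, ‖smoothInd Ω n x * (U \ M.interface τ).indicator g x‖ ≤ U.indicator (fun _ => C) x := by
    intro τ g C n hg x
    by_cases hx : x ∈ U
    · rw [indicator_of_mem hx, norm_mul]
      exact (mul_le_of_le_one_left (norm_nonneg _) (abs_smoothInd_le n x)).trans (hg x)
    · rw [indicator_of_notMem hx, indicator_of_notMem fun h => hx h.1, mul_zero, norm_zero]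
  have hind : ∀ {τ : ℝ} {g : E → ℝ}, τ ∈ I → ∫ x in Ω, g x =
      ∫ x, Ω.indicator (fun _ => (1 : ℝ)) x * (U \ M.interface τ).indicator g x := by
    intro τ g hτ
    rw [← integral_indicator hΩ.1.measurableSet]
    refine integral_congr_ae ?_
    filter_upwards [hSv τ hτ] with x hx
    by_cases hxΩ : x ∈ Ω
    · rw [indicator_of_mem hxΩ, indicator_of_mem hxΩ, one_mul, indicator_of_mem
        (show x ∈ U \ M.interface τ from ⟨hΩU (subset_closure hxΩ), hx⟩)]
    · rw [indicator_of_notMem hxΩ, indicator_of_notMem hxΩ, zero_mul]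
  -- The integrals against mollified indicators converge to the integral over `Ω` at each time near
  -- `t`. The candidate derivative is constant in `τ`, so uniform convergence of the derivatives
  -- along the product filter is the same as joint convergence as `n → ∞` and `τ → t`.
  refine hasDerivAt_of_tendstoUniformlyOnFilter (l := atTop) (𝕜 := ℝ)
    (f := fun (n : ℕ) τ => ∫ x, smoothInd Ω n x * f τ x)
    (f' := fun n τ => ∫ x, (fderiv ℝ (smoothInd Ω n) x (f τ x • M.v solid τ x) +
      smoothInd Ω n x * M.rate f τ x))
    (g' := fun _ => -(∫ y in frontier Ω, inner ℝ (outerNormal Ω y) (f t y • M.v solid t y) ∂area) +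
        ∫ x in Ω, M.rate f t x) ?_ ?_ ?_
  -- The boundary term is obtained from the joint limit, with the field and the interface evaluated
  -- at the moving time `τ`.
  · have L1 : Tendsto (fun i : ℕ × ℝ => ∫ x, fderiv ℝ (smoothInd Ω i.1) x
        ((U \ M.interface i.2).indicator (fun x => f i.2 x • M.v solid i.2 x) x)) (atTop ×ˢ 𝓝 t)
        (𝓝 (-∫ y in frontier Ω, inner ℝ (outerNormal Ω y) (f t y • M.v solid t y) ∂area)) := by
      refine tendsto_integral_fderiv_smoothInd hΩ tendsto_fst
        (W := fun i : ℕ × ℝ => (U \ M.interface i.2).indicator fun x => f i.2 x • M.v solid i.2 x)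
        (W₀ := fun y => f t y • M.v solid t y) (tendsto_snd.eventually hCW) ?_
      filter_upwards [hSfr, ae_restrict_mem isClosed_frontier.measurableSet] with y hyS hy
      have h1 := h.tendsto_truncation ht hW hU (subset_closure.trans hUB)
        (hΩU (frontier_subset_closure hy)) hyS
      rw [nhds_prod_eq] at h1
      exact h1.comp ((tendsto_snd.comp tendsto_fst).prodMk tendsto_snd)
    have L2 : Tendsto (fun i : ℕ × ℝ => ∫ x, smoothInd Ω i.1 x *
        (U \ M.interface i.2).indicator (M.rate f i.2) x) (atTop ×ˢ 𝓝 t)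
        (𝓝 (∫ x in Ω, M.rate f t x)) := by
      rw [hind ht]
      refine tendsto_integral_filter_of_dominated_convergence (U.indicator fun _ => Cq) ?_ ?_
        (hUi Cq) ?_
      · filter_upwards [tendsto_snd.eventually hCq] with i hi
        exact (hmul i.1 _ hi.1).aestronglyMeasurable
      · filter_upwards [tendsto_snd.eventually hCq] with i hi
        exact Eventually.of_forall (hbd i.1 hi.2)
      · filter_upwards [hfrv, hSv t ht] with x hx hxS
        refine Tendsto.mul ((tendsto_smoothInd hΩ.1 hx).comp tendsto_fst) ?_
        by_cases hxU : x ∈ U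
        · have h1 := h.tendsto_truncation ht hq hU (subset_closure.trans hUB) hxU hxS
          rw [indicator_of_mem (show x ∈ U \ M.interface t from ⟨hxU, hxS⟩)]
          exact h1.comp ((tendsto_id.prodMk_nhds tendsto_const_nhds :
            Tendsto (fun τ : ℝ => (τ, x)) (𝓝 t) (𝓝 (t, x))).comp tendsto_snd)
        · have : ∀ τ, (U \ M.interface τ).indicator (M.rate f τ) x = 0 := fun τ =>
            indicator_of_notMem (fun h => hxU h.1) _
          simp only [this]
          exact tendsto_const_nhds
    have L := L1.add L2
    rw [Metric.tendstoUniformlyOnFilter_iff]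
    intro ε hε
    filter_upwards [L.eventually (Metric.ball_mem_nhds _ hε), hev.prod_inl (𝓝 t),
      tendsto_snd.eventually hCW, tendsto_snd.eventually hCq, tendsto_snd.eventually hIB]
      with i h1 h2 h3 h4 h5
    rw [dist_comm]
    convert Metric.mem_ball.1 h1 using 2
    rw [← integral_add (integrable_fderiv_apply (contDiff_smoothInd hΩ.1 i.1)
      (hasCompactSupport_smoothInd hΩ.2.1 i.1) h3.1) (hmul i.1 _ h4.1)]
    refine integral_congr_ae ?_
    filter_upwards [hSv i.2 h5.1] with x hx
    by_cases hxU : x ∈ U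
    · have hm : x ∈ U \ M.interface i.2 := ⟨hxU, hx⟩
      rw [indicator_of_mem hm, indicator_of_mem hm]
    · rw [fderiv_eq_zero_of_tsupport_subset h2 hxU,
        image_eq_zero_of_notMem_tsupport fun h => hxU (h2 h)]
      simp
  · filter_upwards [hev.prod_inl (𝓝 t), tendsto_snd.eventually hIB] with i h1 h2
    exact h.hasDerivAt_integral_test h2.1 hI hf (contDiff_smoothInd hΩ.1 i.1)
      (hasCompactSupport_smoothInd hΩ.2.1 i.1) (h1.trans (subset_closure.trans h2.2))
  · filter_upwards [hC, hIB] with τ h1 h2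
    have e1 : ∀ᶠ n in atTop, ∫ x, smoothInd Ω n x * (U \ M.interface τ).indicator (f τ) x =
        ∫ x, smoothInd Ω n x * f τ x := by
      filter_upwards [hev] with n hn
      refine integral_congr_ae ?_
      filter_upwards [hSv τ h2.1] with x hx
      by_cases hxU : x ∈ U
      · rw [indicator_of_mem (show x ∈ U \ M.interface τ from ⟨hxU, hx⟩)]
      · rw [image_eq_zero_of_notMem_tsupport fun h => hxU (hn h), zero_mul, zero_mul]
    refine Tendsto.congr' e1 ?_
    rw [hind h2.1]
    refine tendsto_integral_of_dominated_convergence (U.indicator fun _ => C)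
      (fun n => (hmul n _ h1.1).aestronglyMeasurable) (hUi C)
      (fun n => Eventually.of_forall (hbd n h1.2)) ?_
    filter_upwards [hfrv] with x hx
    exact (tendsto_smoothInd hΩ.1 hx).mul_const _

end IsKinematic

end Mixture

end Poro

/-! ### Jacobi's formula and material rates. -/

namespace Poro

/-- As a polynomial in `s`, `det (1 + s N) = 1 + s tr N + s² p(s)`. -/
theorem hasDerivAt_det_id_add_smul (L : Tensor) :
    HasDerivAt (fun s : ℝ => (ContinuousLinearMap.id ℝ E + s • L).det) (tr L) 0 := by
  set N : Matrix (Fin 3) (Fin 3) ℝ := Matrix.of fun i j => inner ℝ (e i) (L (e j)) with hN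
  have h1 : ∀ s : ℝ, (ContinuousLinearMap.id ℝ E + s • L).det = (1 + s • N).det := fun s => by
    rw [det_eq]
    congr 1
    ext i j
    have : (inner ℝ (e i) (e j) : ℝ) = if i = j then 1 else 0 := by
      rw [← eBasis_apply, ← eBasis_apply]
      exact orthonormal_iff_ite.1 eBasis.orthonormal i j
    simp [hN, inner_add_right, inner_smul_right, this, Matrix.one_apply]
  have h2 : tr L = N.trace := by
    rw [tr_eq_sum]; rfl
  simp only [h1, h2]
  rw [funext fun s : ℝ => Matrix.det_one_add_smul s N]
  have h3 := ((hasDerivAt_id (0 : ℝ)).const_mul N.trace).const_add (1 : ℝ)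
  set p := (Matrix.det (1 + (Polynomial.X : Polynomial ℝ) • N.map Polynomial.C)).divX.divX
  have h4 := (p.hasDerivAt (0 : ℝ)).mul ((hasDerivAt_id (0 : ℝ)).pow 2)
  have h5 := h3.add h4
  have h6 : N.trace * 1 + (Polynomial.eval 0 p.derivative * (id ^ 2 : ℝ → ℝ) 0 +
      Polynomial.eval 0 p * (↑(2 : ℕ) * id (0 : ℝ) ^ (2 - 1) * 1)) = N.trace := by simp
  rw [h6] at h5
  exact h5

/-- Jacobi's formula. -/
theorem hasDerivAt_det {A : ℝ → Tensor} {L : Tensor} {t : ℝ} (hA : HasDerivAt A (L ∘L A t) t) :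
    HasDerivAt (fun τ => (A τ).det) ((A t).det * tr L) t := by
  have hd : DifferentiableAt ℝ (fun B : Tensor => B.det) (A t) :=
    (contDiff_det (n := 1)).contDiffAt.differentiableAt one_ne_zero
  have h1 := hd.hasFDerivAt.comp_hasDerivAt t hA
  have h2 : HasDerivAt (fun s : ℝ => A t + s • (L ∘L A t)) (L ∘L A t) 0 := by
    simpa using ((hasDerivAt_id (0 : ℝ)).smul_const (L ∘L A t)).const_add (A t)
  have h3 : HasFDerivAt (fun B : Tensor => B.det) (fderiv ℝ (fun B : Tensor => B.det) (A t))
      (A t + (0 : ℝ) • (L ∘L A t)) := by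
    simpa using hd.hasFDerivAt
  have h4 := h3.comp_hasDerivAt (0 : ℝ) h2
  -- Along the line `A + s L A = (1 + s L) A` the determinant factors, so its derivative at the
  -- identity determines the derivative at `A` in the direction `L A`.
  have h5 : ((fun B : Tensor => B.det) ∘ fun s : ℝ => A t + s • (L ∘L A t)) =
      fun s : ℝ => (ContinuousLinearMap.id ℝ E + s • L).det * (A t).det := by
    ext s
    have : A t + s • (L ∘L A t) = (ContinuousLinearMap.id ℝ E + s • L) * A t := by
      ext u; simp
    simp only [Function.comp_apply, this, ContinuousLinearMap.det, ContinuousLinearMap.toLinearMap_mul,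
      map_mul]
  rw [h5] at h4
  rw [h4.unique ((hasDerivAt_det_id_add_smul L).mul_const _)] at h1
  rw [mul_comm]
  exact h1

namespace Mixture

open Phase

variable {M : Mixture} {I : Set ℝ} {t : ℝ}

namespace IsKinematic

variable (h : M.IsKinematic I) (ht : t ∈ I) (a : Phase)

include h ht

theorem contDiffAt_velRef {X : E} (hX : X ∈ M.offRef a t) :
    ContDiffAt ℝ 1 (fun q : ℝ × E => M.velRef a q.1 q.2) (t, X) :=
  hasExt_univ.1 (HasExt.deriv_time (k := 1) (f := fun q : ℝ × E => M.χ a q.1 q.2)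
    (hasExt_univ.2 (h.contDiffAt_χ ht a hX)) (Eventually.of_forall fun _ => univ_mem))

theorem contDiffAt_v {x : E} (hx : x ∈ M.body t \ M.interface t) :
    ContDiffAt ℝ 1 (fun q : ℝ × E => M.v a q.1 q.2) (t, x) :=
  h.contDiffAt_spatial ht a one_le_two hx (h.contDiffAt_velRef ht a (h.inv_mem ht a hx))

theorem contDiffAt_v_space {x : E} (hx : x ∈ M.body t \ M.interface t) :
    ContDiffAt ℝ 1 (M.v a t) x :=
  ContDiffAt.comp (f := fun y => (t, y)) (g := fun q : ℝ × E => M.v a q.1 q.2) x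
    (h.contDiffAt_v ht a hx) (by fun_prop)

theorem inv_χ {X : E} (hX : X ∈ M.offRef a t) : M.inv a t (M.χ a t X) = X :=
  h.inv_eq ht a hX.1 ((h.bijOn ht a).mapsTo hX) rfl

theorem eventually_off {X : E} (hX : X ∈ M.offRef a t) :
    ∀ᶠ q in 𝓝 (t, X), q.1 ∈ I ∧ q.2 ∈ M.offRef a q.1 := by
  have h1 : Tendsto (fun q : ℝ × E => (q.1, M.χ a q.1 q.2)) (𝓝 (t, X)) (𝓝 (t, M.χ a t X)) :=
    continuousAt_fst.prodMk (h.contDiffAt_χ ht a hX).continuousAt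
  filter_upwards [h1.eventually (h.isOpen_off.mem_nhds (mem_off ht ((h.bijOn ht a).mapsTo hX))),
    continuousAt_snd.eventually ((h.open_ref a).mem_nhds hX.1)] with q h2 h3
  exact ⟨h2.1, h3, fun h4 => h2.2.2 h4.2⟩

theorem hasFDerivAt_χ {X : E} (hX : X ∈ M.offRef a t) :
    HasFDerivAt (M.χ a t) (M.F a t X) X :=
  (fderiv_slice ((h.contDiffAt_χ ht a hX).differentiableAt two_ne_zero)).differentiableAt.hasFDerivAt

/-- The gradient of the material velocity is computed twice: by the chain rule for the spatial
velocity composed with the motion, and as a mixed second derivative of the motion. Symmetry of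
second derivatives turns the latter into the time derivative of `F`. -/
theorem hasDerivAt_F {X : E} (hX : X ∈ M.offRef a t) :
    HasDerivAt (fun τ => M.F a τ X) (M.L a t (M.χ a t X) ∘L M.F a t X) t := by
  have hx := (h.bijOn ht a).mapsTo hX
  set f : ℝ × E → E := fun q => M.χ a q.1 q.2 with hf
  have hc : ContDiffAt ℝ 2 f (t, X) := h.contDiffAt_χ ht a hX
  have hd : DifferentiableAt ℝ (fderiv ℝ f) (t, X) :=
    (hc.fderiv_right (m := 1) (by norm_num)).differentiableAt one_ne_zero
  have hev : ∀ᶠ q in 𝓝 (t, X), DifferentiableAt ℝ f q :=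
    (hc.eventually (by simp)).mono fun q hq => hq.differentiableAt two_ne_zero
  have h1 := deriv_slice (V := ℝ × E →L[ℝ] E) hd
  have h2 : HasDerivAt (fun τ => M.F a τ X)
      (fderiv ℝ (fderiv ℝ f) (t, X) (1, 0) ∘L ContinuousLinearMap.inr ℝ ℝ E) t := by
    have h3 : HasDerivAt (fun τ => fderiv ℝ f (τ, X) ∘L ContinuousLinearMap.inr ℝ ℝ E)
        (fderiv ℝ (fderiv ℝ f) (t, X) (1, 0) ∘L ContinuousLinearMap.inr ℝ ℝ E) t := by
      simpa using h1.clm_comp (hasDerivAt_const t (ContinuousLinearMap.inr ℝ ℝ E))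
    refine h3.congr_of_eventuallyEq ?_
    filter_upwards [(tendsto_id.prodMk_nhds tendsto_const_nhds : Tendsto (fun τ : ℝ => (τ, X))
      (𝓝 t) (𝓝 (t, X))).eventually hev] with τ hτ
    exact (fderiv_slice hτ).fderiv
  convert h2 using 1
  have h4 : HasFDerivAt (M.velRef a t) (M.L a t (M.χ a t X) ∘L M.F a t X) X := by
    have h5 : HasFDerivAt (fun Y => M.v a t (M.χ a t Y)) (M.L a t (M.χ a t X) ∘L M.F a t X) X :=
      ((h.contDiffAt_v_space ht a hx).differentiableAt one_ne_zero).hasFDerivAt.comp X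
        (h.hasFDerivAt_χ ht a hX)
    refine h5.congr_of_eventuallyEq ?_
    filter_upwards [(tendsto_const_nhds.prodMk_nhds tendsto_id : Tendsto (fun Y : E => (t, Y))
      (𝓝 X) (𝓝 (t, X))).eventually (h.eventually_off ht a hX)] with Y hY
    simp only [v, h.inv_χ ht a hY.2]
  have h6 : HasFDerivAt (M.velRef a t) ((ContinuousLinearMap.apply ℝ E ((1 : ℝ), (0 : E))) ∘L
      (fderiv ℝ (fderiv ℝ f) (t, X) ∘L ContinuousLinearMap.inr ℝ ℝ E)) X := by
    have h7 := (ContinuousLinearMap.apply ℝ E ((1 : ℝ), (0 : E))).hasFDerivAt.comp X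
      (fderiv_slice (V := ℝ × E →L[ℝ] E) hd)
    refine h7.congr_of_eventuallyEq ?_
    filter_upwards [(tendsto_const_nhds.prodMk_nhds tendsto_id : Tendsto (fun Y : E => (t, Y))
      (𝓝 X) (𝓝 (t, X))).eventually hev] with Y hY
    exact (deriv_slice hY).deriv
  rw [h4.unique h6]
  ext u
  exact (hc.isSymmSndFDerivAt (by simp)) (0, u) (1, 0)

theorem hasDerivAt_J {X : E} (hX : X ∈ M.offRef a t) :
    HasDerivAt (fun τ => M.J a τ X) (M.J a t X * tr (M.L a t (M.χ a t X))) t :=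
  hasDerivAt_det (h.hasDerivAt_F ht a hX)

/-- The material time derivative. -/
theorem hasDerivAt_material {V : Type*} [NormedAddCommGroup V] [NormedSpace ℝ V] {f : ℝ → E → V}
    {X : E} (hX : X ∈ M.offRef a t)
    (hf : DifferentiableAt ℝ (fun q : ℝ × E => f q.1 q.2) (t, M.χ a t X)) :
    HasDerivAt (fun τ => f τ (M.χ a τ X)) (deriv (fun τ => f τ (M.χ a t X)) t +
      fderiv ℝ (f t) (M.χ a t X) (M.v a t (M.χ a t X))) t := by
  have h1 := hf.hasFDerivAt.comp_hasDerivAt t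
    ((hasDerivAt_id t).prodMk (h.hasDerivAt_χ ht a hX))
  have h2 := (deriv_slice hf).deriv
  have h3 := (fderiv_slice hf).fderiv
  simp only at h2 h3
  rw [show fderiv ℝ (f t) (M.χ a t X) = _ from h3, show deriv (fun τ => f τ (M.χ a t X)) t = _ from h2,
    ContinuousLinearMap.comp_apply, ContinuousLinearMap.inr_apply, ← map_add, Prod.mk_add_mk, add_zero,
    zero_add, v, h.inv_χ ht a hX]
  exact h1

/-- The acceleration is the material derivative of the spatial velocity: at a fixed particle off the
interface, the velocity is the spatial field along the path for all nearby times. -/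
theorem acc_eq {x : E} (hx : x ∈ M.body t \ M.interface t) :
    M.acc a t x = deriv (fun τ => M.v a τ x) t + M.L a t x (M.v a t x) := by
  have hX := h.inv_mem ht a hx
  have h1 := h.hasDerivAt_material ht a (f := M.v a) hX
    ((h.contDiffAt_v ht a (by rwa [h.χ_inv ht a hx])).differentiableAt one_ne_zero)
  rw [h.χ_inv ht a hx] at h1
  rw [acc, accRef, L, ← h1.deriv]
  refine EventuallyEq.deriv_eq ?_
  filter_upwards [(tendsto_id.prodMk_nhds tendsto_const_nhds : Tendsto
    (fun τ : ℝ => (τ, M.inv a t x)) (𝓝 t) (𝓝 (t, M.inv a t x))).eventually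
    (h.eventually_off ht a hX)] with τ hτ
  simp only [v]
  rw [h.inv_χ (show τ ∈ I from hτ.1) a hτ.2]

/-- The rate of change of a density, per unit volume. -/
theorem hasDerivAt_density {f : ℝ → E → ℝ} {x : E} (hx : x ∈ M.body t \ M.interface t)
    (hf : DifferentiableAt ℝ (fun q : ℝ × E => f q.1 q.2) (t, x)) :
    HasDerivAt (fun τ => M.J a τ (M.inv a t x) * f τ (M.χ a τ (M.inv a t x)))
      (M.J a t (M.inv a t x) *
        (deriv (fun τ => f τ x) t + divVec (fun y => f t y • M.v a t y) x)) t := by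
  have hX := h.inv_mem ht a hx
  have h1 := h.hasDerivAt_material ht a (f := f) hX (by rwa [h.χ_inv ht a hx])
  have h2 := (h.hasDerivAt_J ht a hX).mul h1
  rw [h.χ_inv ht a hx] at h2
  have hfs : DifferentiableAt ℝ (f t) x := (fderiv_slice hf).differentiableAt
  rw [divVec_smul hfs ((h.contDiffAt_v_space ht a hx).differentiableAt one_ne_zero), divVec]
  have h3 : M.J a t (M.inv a t x) * (deriv (fun τ => f τ x) t +
      (fderiv ℝ (f t) x (M.v a t x) + f t x * tr (fderiv ℝ (M.v a t) x))) =
      M.J a t (M.inv a t x) * tr (M.L a t x) * f t x +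
      M.J a t (M.inv a t x) * (deriv (fun τ => f τ x) t + fderiv ℝ (f t) x (M.v a t x)) := by
    rw [show M.L a t x = fderiv ℝ (M.v a t) x from rfl]
    ring
  rw [h3]
  exact h2

/-- By Jacobi's formula the derivative at a fixed particle acquires the term `f div v_s`, which
completes the convective derivative to a divergence. -/
theorem rate_eq {f : ℝ → E → ℝ} {x : E} (hx : x ∈ M.body t \ M.interface t)
    (hf : DifferentiableAt ℝ (fun q : ℝ × E => f q.1 q.2) (t, x)) :
    M.rate f t x = deriv (fun τ => f τ x) t + divVec (fun y => f t y • M.v solid t y) x := by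
  have h1 := (h.hasDerivAt_density ht solid hx hf).deriv
  have h2 := h.J_pos ht solid (h.inv_mem ht solid hx)
  rw [rate]
  unfold refDensity
  rw [h1, inv_mul_cancel_left₀ h2.ne']

end IsKinematic

end Mixture

end Poro

namespace Poro

/-! ### Tensor algebra -/

theorem dyad_apply (u w x : E) : dyad u w x = (inner ℝ w x : ℝ) • u := by
  simp [dyad]

theorem transp_transp (A : Tensor) : transp (transp A) = A := ContinuousLinearMap.adjoint_adjoint A

theorem transp_comp (A B : Tensor) : transp (A ∘L B) = transp B ∘L transp A :=
  ContinuousLinearMap.adjoint_comp A B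

theorem transp_add (A B : Tensor) : transp (A + B) = transp A + transp B :=
  map_add ContinuousLinearMap.adjoint A B

theorem transp_sub (A B : Tensor) : transp (A - B) = transp A - transp B :=
  map_sub ContinuousLinearMap.adjoint A B

theorem transp_smul (c : ℝ) (A : Tensor) : transp (c • A) = c • transp A := by
  refine ContinuousLinearMap.ext fun u => ext_inner_right ℝ fun v => ?_
  simp [transp_comp_inner, inner_smul_left, inner_smul_right]

theorem transp_id : transp (ContinuousLinearMap.id ℝ E) = ContinuousLinearMap.id ℝ E := by
  refine ContinuousLinearMap.ext fun u => ext_inner_right ℝ fun v => ?_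
  simp [transp_comp_inner]

theorem transp_dyad (u w : E) : transp (dyad u w) = dyad w u := by
  refine ContinuousLinearMap.ext fun x => ext_inner_right ℝ fun v => ?_
  rw [transp_comp_inner, dyad_apply, dyad_apply, inner_smul_left, inner_smul_right,
    real_inner_comm u x]
  simp [mul_comm]

theorem tr_comp_comm (A B : Tensor) : tr (A ∘L B) = tr (B ∘L A) :=
  LinearMap.trace_mul_comm ℝ (A : E →ₗ[ℝ] E) (B : E →ₗ[ℝ] E)

theorem tr_transp (A : Tensor) : tr (transp A) = tr A := by
  rw [tr_eq_sum, tr_eq_sum]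
  refine Finset.sum_congr rfl fun i _ => ?_
  rw [real_inner_comm, transp_comp_inner]

theorem ddot_comm (A B : Tensor) : ddot A B = ddot B A := by
  rw [ddot, ← tr_transp, transp_comp, transp_transp, ddot]

theorem ddot_add_right (A B B' : Tensor) : ddot A (B + B') = ddot A B + ddot A B' := by
  rw [ddot, ContinuousLinearMap.comp_add, tr_add, ddot, ddot]

theorem ddot_smul_right (c : ℝ) (A B : Tensor) : ddot A (c • B) = c * ddot A B := by
  rw [ddot, ContinuousLinearMap.comp_smul, tr_smul, ddot]

theorem ddot_add_left (A A' B : Tensor) : ddot (A + A') B = ddot A B + ddot A' B := by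
  rw [ddot_comm, ddot_add_right, ddot_comm B, ddot_comm B]

theorem ddot_smul_left (c : ℝ) (A B : Tensor) : ddot (c • A) B = c * ddot A B := by
  rw [ddot_comm, ddot_smul_right, ddot_comm]

theorem ddot_sub_left (A A' B : Tensor) : ddot (A - A') B = ddot A B - ddot A' B := by
  rw [sub_eq_add_neg, ← neg_one_smul ℝ, ddot_add_left, ddot_smul_left]
  ring

theorem ddot_sub_right (A B B' : Tensor) : ddot A (B - B') = ddot A B - ddot A B' := by
  rw [ddot_comm, ddot_sub_left, ddot_comm B, ddot_comm B']

theorem ddot_id (B : Tensor) : ddot (ContinuousLinearMap.id ℝ E) B = tr B := by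
  rw [ddot, transp_id, ContinuousLinearMap.id_comp]

theorem ddot_transp (A B : Tensor) : ddot (transp A) (transp B) = ddot A B := by
  rw [ddot, transp_transp, tr_comp_comm, ← ddot, ddot_comm]

theorem ddot_symPart {A : Tensor} (hA : transp A = A) (B : Tensor) :
    ddot A (symPart B) = ddot A B := by
  have : ddot A (transp B) = ddot A B := by
    conv_lhs => rw [← hA]
    exact ddot_transp A B
  rw [symPart, ddot_smul_right, ddot_add_right, this]
  ring

theorem transp_symPart (A : Tensor) : transp (symPart A) = symPart A := by
  rw [symPart, transp_smul, transp_add, transp_transp, add_comm]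

theorem ddot_dyad (u w : E) (H : Tensor) : ddot (dyad u w) H = inner ℝ u (H w) := by
  rw [ddot, transp_dyad, tr_comp_comm]
  have : H ∘L dyad w u = (innerSL ℝ u).smulRight (H w) := by
    ext x
    simp [dyad_apply]
  rw [this, tr_smulRight]
  rfl

theorem eq_sum_dyad (H : Tensor) :
    H = ∑ i, ∑ j, (inner ℝ (e i) (H (e j)) : ℝ) • dyad (e i) (e j) := by
  refine ContinuousLinearMap.ext fun x => ?_
  conv_lhs => rw [← eBasis.sum_repr' x, map_sum]
  simp only [sum_apply, smul_apply, dyad_apply, map_smul,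
    eBasis_apply]
  rw [Finset.sum_comm]
  refine Finset.sum_congr rfl fun j _ => ?_
  conv_lhs => rw [← eBasis.sum_repr' (H (e j))]
  simp only [eBasis_apply, Finset.smul_sum]
  refine Finset.sum_congr rfl fun i _ => ?_
  rw [smul_comm]

/-- The expansion of `H` in dyads is averaged with its transpose, which has the same coefficients.
-/
theorem eq_sum_symPart_dyad {H : Tensor} (hH : transp H = H) :
    H = ∑ i, ∑ j, (inner ℝ (e i) (H (e j)) : ℝ) • symPart (dyad (e i) (e j)) := by
  have h1 : symPart H = H := by
    rw [symPart, hH, ← two_smul ℝ, smul_smul]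
    norm_num
  have h2 := congrArg transp (eq_sum_dyad H)
  have h3 : ∀ f : Fin 3 → Tensor, transp (∑ i, f i) = ∑ i, transp (f i) := fun f =>
    map_sum ContinuousLinearMap.adjoint f _
  simp only [h3, transp_smul] at h2
  rw [hH] at h2
  have h4 : H = (1 / 2 : ℝ) • ((∑ i, ∑ j, (inner ℝ (e i) (H (e j)) : ℝ) • dyad (e i) (e j)) +
      ∑ i, ∑ j, (inner ℝ (e i) (H (e j)) : ℝ) • transp (dyad (e i) (e j))) := by
    rw [← h2, ← eq_sum_dyad H]
    rwa [symPart, hH, eq_comm] at h1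
  refine h4.trans ?_
  simp only [symPart, smul_add, Finset.sum_add_distrib, Finset.smul_sum]
  congr 1 <;>
  exact Finset.sum_congr rfl fun i _ => Finset.sum_congr rfl fun j _ => smul_comm _ _ _

theorem det_transp (A : Tensor) : (transp A).det = A.det := by
  rw [det_eq, det_eq, ← Matrix.det_transpose]
  congr 1
  ext i j
  simp only [Matrix.transpose_apply, Matrix.of_apply]
  rw [real_inner_comm, transp_comp_inner]

theorem finrank_E : Module.finrank ℝ E = 3 := by
  rw [Module.finrank_eq_card_basis eBasis.toBasis, Fintype.card_fin]

theorem det_smul (c : ℝ) (A : Tensor) : (c • A).det = c ^ 3 * A.det := by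
  rw [ContinuousLinearMap.det, ContinuousLinearMap.toLinearMap_smul, LinearMap.det_smul, finrank_E]

theorem det_comp (A B : Tensor) : (A ∘L B).det = A.det * B.det := by
  rw [ContinuousLinearMap.det, ContinuousLinearMap.toLinearMap_comp, LinearMap.det_comp]

namespace Mixture

/-- The exponent `-1/3` makes the scalar factor cube to the inverse determinant; `Aᵀ A` is positive
definite because `A` is injective. -/
theorem isochoric_mem {A : Tensor} (hA : A.det ≠ 0) :
    isochoric (transp A ∘L A) ∈ isochoricStrains := by
  set C := transp A ∘L A with hC
  have hd : C.det = A.det ^ 2 := by rw [hC, det_comp, det_transp, sq]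
  have hd0 : 0 < C.det := by rw [hd]; positivity
  refine ⟨?_, fun u hu => ?_, ?_⟩
  · rw [isochoric, transp_smul, hC, transp_comp, transp_transp]
  · rw [isochoric, smul_apply, inner_smul_left, hC, ContinuousLinearMap.comp_apply,
      transp_comp_inner, real_inner_self_eq_norm_sq]
    have h1 : A u ≠ 0 := fun h0 => hu <| by
      have h6 := ContinuousLinearMap.toContinuousLinearEquivOfDetNeZero_apply A hA u
      rw [h0] at h6
      exact (ContinuousLinearEquiv.map_eq_zero_iff _).1 h6
    have h2 : 0 < ‖A u‖ := norm_pos_iff.2 h1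
    have h3 := Real.rpow_pos_of_pos hd0 (-(1 / 3))
    simp only [conj_trivial]
    positivity
  · rw [isochoric, det_smul, ← Real.rpow_natCast, ← Real.rpow_mul hd0.le]
    norm_num
    rw [Real.rpow_neg_one, inv_mul_cancel₀ hd0.ne']

theorem contDiffAt_isochoric {n : WithTop ℕ∞} {C : Tensor} (hC : 0 < C.det) :
    ContDiffAt ℝ n isochoric C :=
  (contDiff_det.contDiffAt.rpow_const_of_ne hC.ne').smul contDiffAt_id

theorem det_C (M : Mixture) (t : ℝ) (X : E) : (M.C t X).det = M.J Phase.solid t X ^ 2 := by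
  rw [C, det_comp, det_transp, sq, J]

theorem transp_dΨdC (M : Mixture) (C : Tensor) (X : E) : transp (M.dΨdC C X) = M.dΨdC C X := by
  have h3 : ∀ f : Fin 3 → Tensor, transp (∑ i, f i) = ∑ i, transp (f i) := fun f =>
    map_sum ContinuousLinearMap.adjoint f _
  rw [dΨdC]
  simp only [h3, transp_smul, transp_dyad]
  rw [Finset.sum_comm]
  refine Finset.sum_congr rfl fun j _ => Finset.sum_congr rfl fun i _ => ?_
  have : symPart (dyad (e i) (e j)) = symPart (dyad (e j) (e i)) := by
    rw [symPart, symPart, transp_dyad, transp_dyad, add_comm]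
  rw [this]

/-- The coefficients of `dΨdC` are derivatives along the symmetrized dyads. A symmetric `H` is a
combination of these, so linearity of the derivative gives the claim; symmetry of `H` is essential.
-/
theorem ddot_dΨdC (M : Mixture) (C : Tensor) (X : E) {H : Tensor} (hH : transp H = H) :
    ddot (M.dΨdC C X) H = fderiv ℝ (fun A : Tensor => M.Ψhat (isochoric A) X) C H := by
  have h1 : ∀ f : Fin 3 → Tensor, ddot (∑ i, f i) H = ∑ i, ddot (f i) H := fun f => by
    simp [Fin.sum_univ_three, ddot_add_left]
  conv_rhs => rw [eq_sum_symPart_dyad hH]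
  simp only [dΨdC, h1, ddot_smul_left, ddot_dyad, map_sum, map_smul, smul_eq_mul]
  exact Finset.sum_congr rfl fun i _ => Finset.sum_congr rfl fun j _ => mul_comm _ _

theorem transp_Te (M : Mixture) (t : ℝ) (x : E) : transp (M.Te t x) = M.Te t x := by
  rw [Te, TeRef, transp_smul, transp_comp, transp_comp, transp_transp, transp_dΨdC,
    ContinuousLinearMap.comp_assoc]

theorem transp_T (M : Mixture) (a : Phase) (t : ℝ) (x : E) : transp (M.T a t x) = M.T a t x := by
  cases a <;>
  simp only [T, transp_add, transp_smul, transp_id, transp_sub, transp_Te, D, transp_symPart]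

end Mixture

end Poro

/-! ### Regularity of the energies, and the balances of mass, kinetic and elastic energy. -/

namespace Poro

namespace Mixture

open Phase

variable {M : Mixture} {I : Set ℝ} {t : ℝ}

namespace IsKinematic

variable (h : M.IsKinematic I) (ht : t ∈ I) (hI : IsOpen I) (hreg : M.IsRegular I)

include h

theorem hasExt_C (ht : t ∈ I) {Y : Set E} {X : E} (hs : M.RefSide Y X) :
    HasExt 1 (Prod.snd ⁻¹' Y) (t, X) fun q : ℝ × E => M.C q.1 q.2 :=
  (h.hasExt_F ht hs).comp_contDiff (Φ := fun A : Tensor => transp A ∘L A)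
    (contDiff_transp.clm_comp contDiff_id)

/-- The one-sided limits of the strain. -/
theorem exists_tendsto_C (ht : t ∈ I) {Y : Set E} {X : E} (hs : M.RefSide Y X) :
    ∃ B : Tensor, 0 < B.det ∧ isochoric B ∈ isochoricStrains ∧
      Tendsto (fun q : ℝ × E => M.C q.1 q.2) (𝓝[Prod.snd ⁻¹' Y] (t, X)) (𝓝 B) := by
  have := hs.neBot_prod t
  obtain ⟨A, hA⟩ := (h.hasExt_F ht hs).exists_tendsto
  obtain ⟨a, ha, hJ⟩ := h.exists_tendsto_J ht hs
  have hdet : A.det = a := tendsto_nhds_unique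
    (((contDiff_det (n := 0)).continuous.tendsto A).comp hA) hJ
  refine ⟨transp A ∘L A, ?_, isochoric_mem (by rw [hdet]; exact ha.ne'), ?_⟩
  · rw [det_comp, det_transp, hdet]; positivity
  · exact (((contDiff_transp (n := 0)).clm_comp contDiff_id).continuous.tendsto A).comp hA

include hreg

/-- The one-sided limit of the Jacobian is positive, so the limiting strain is nonsingular and its
isochoric part belongs to the set on which the energy is assumed regular. -/
theorem hasExt_Ψhat (ht : t ∈ I) {Y : Set E} {X : E} (hs : M.RefSide Y X) :
    HasExt 1 (Prod.snd ⁻¹' Y) (t, X)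
      fun q : ℝ × E => M.Ψhat (isochoric (M.C q.1 q.2)) q.2 := by
  have := hs.neBot_prod t
  obtain ⟨B, hB, hBm, hC⟩ := h.exists_tendsto_C ht hs
  have h1 : HasExt 1 (Prod.snd ⁻¹' Y) (t, X) fun q : ℝ × E => isochoric (M.C q.1 q.2) :=
    (h.hasExt_C ht hs).comp_contDiffAt hC (contDiffAt_isochoric hB)
  have h2 : HasExt 1 (Prod.snd ⁻¹' Y) (t, X) fun q : ℝ × E => (isochoric (M.C q.1 q.2), q.2) :=
    h1.prodMk (contDiffAt_snd.hasExt)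
  refine HasExt.comp (Φ := fun q : Tensor × E => M.Ψhat q.1 q.2)
    (hreg.Ψhat_reg.hasExt hs hBm) h2 ?_
  rw [nhdsWithin_snd_preimage, nhdsWithin_snd_preimage]
  rw [nhdsWithin_snd_preimage] at hC
  exact ((contDiffAt_isochoric (n := 0) hB).continuousAt.tendsto.comp hC).prodMk tendsto_snd

include hI

theorem pwSmooth_v (a : Phase) : M.PwSmooth 1 I (M.v a) := by
  cases a
  · exact h.pwSmooth_v_solid hI
  · exact hreg.vf_reg.pwSmooth

omit h hI in
theorem pwSmooth_φ (a : Phase) : M.PwSmooth 1 I (M.φ a) := (hreg.φ_reg a).pwSmooth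

omit h hI in
theorem pwSmooth_T (a : Phase) : M.PwSmooth 1 I (M.T a) := (hreg.T_reg a).pwSmooth

omit h hI in
theorem pwSmooth_ρ (a : Phase) : M.PwSmooth 1 I (M.ρ a) :=
  (pwSmooth_φ hreg a).comp_contDiff (Φ := fun r : ℝ => M.ρstar a * r) (by fun_prop)

theorem pwSmooth_w : M.PwSmooth 1 I M.w :=
  (h.pwSmooth_v hI hreg fluid).sub (h.pwSmooth_v hI hreg solid)

theorem pwSmooth_k (a : Phase) : M.PwSmooth 1 I (M.k a) :=
  ((pwSmooth_ρ hreg a).prodMk (h.pwSmooth_v hI hreg a)).comp_contDiff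
    (Φ := fun p : ℝ × E => 1 / 2 * p.1 * ‖p.2‖ ^ 2)
    ((contDiff_const.mul contDiff_fst).mul (contDiff_snd.norm_sq ℝ))

theorem pwSmooth_ψs : M.PwSmooth 1 I M.ψs := by
  intro t ht Y X hs
  have := hs.neBot_prod t
  refine h.hasExt_of_ref ht hI (g := fun t X => (M.J solid t X)⁻¹ * M.Ψs t X) hs ?_
  obtain ⟨a, ha, hJ⟩ := h.exists_tendsto_J ht hs
  have h1 := (h.hasExt_J ht hs).comp_contDiffAt hJ (_root_.contDiffAt_inv ℝ ha.ne')
  have h2 := (((h.hasExt_J ht hs).prodMk (pwSmooth_φ hreg solid t ht Y X hs)).prodMk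
    (h.hasExt_Ψhat hreg ht hs))
  exact (h1.prodMk h2).comp_contDiff (Φ := fun p : ℝ × (ℝ × ℝ) × ℝ => p.1 * (p.2.1.1 * p.2.1.2 * p.2.2))
    (by fun_prop)

theorem pwSmooth_energy : M.PwSmooth 1 I M.energy :=
  ((h.pwSmooth_k hI hreg solid).add (h.pwSmooth_k hI hreg fluid)).add (h.pwSmooth_ψs hI hreg)

omit hI hreg
include ht

theorem differentiableAt_of_pwSmooth {V : Type*} [NormedAddCommGroup V] [NormedSpace ℝ V]
    {f : ℝ → E → V} (hf : M.PwSmooth 1 I f) {x : E} (hx : x ∈ M.body t \ M.interface t) :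
    DifferentiableAt ℝ (fun q : ℝ × E => f q.1 q.2) (t, x) :=
  (h.contDiffAt_of_pwSmooth ht hf one_le_two hx).differentiableAt one_ne_zero

theorem differentiableAt_space {V : Type*} [NormedAddCommGroup V] [NormedSpace ℝ V]
    {f : ℝ → E → V} (hf : M.PwSmooth 1 I f) {x : E} (hx : x ∈ M.body t \ M.interface t) :
    DifferentiableAt ℝ (f t) x :=
  (h.contDiffAt_space_of_pwSmooth ht hf one_le_two hx).differentiableAt one_ne_zero

theorem differentiableAt_time {V : Type*} [NormedAddCommGroup V] [NormedSpace ℝ V]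
    {f : ℝ → E → V} (hf : M.PwSmooth 1 I f) {x : E} (hx : x ∈ M.body t \ M.interface t) :
    DifferentiableAt ℝ (fun τ => f τ x) t :=
  (deriv_slice (q := (t, x)) (h.differentiableAt_of_pwSmooth ht hf hx)).differentiableAt

include hI hreg

/-- Balance of mass, in terms of the volume fractions. -/
theorem volume_balance (hmass : M.MassBalance t) (a : Phase) {x : E}
    (hx : x ∈ M.body t \ M.interface t) :
    deriv (fun τ => M.φ a τ x) t + divVec (fun y => M.φ a t y • M.v a t y) x = 0 := by
  have h1 := hmass.balance a x hx
  have h2 : deriv (fun τ => M.ρ a τ x) t = M.ρstar a * deriv (fun τ => M.φ a τ x) t :=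
    deriv_const_mul _ (h.differentiableAt_time ht (pwSmooth_φ hreg a) hx)
  have h3 : divVec (fun y => M.ρ a t y • M.v a t y) x =
      M.ρstar a * divVec (fun y => M.φ a t y • M.v a t y) x := by
    have : (fun y => M.ρ a t y • M.v a t y) =
        fun y => M.ρstar a • (M.φ a t y • M.v a t y) := by
      ext1 y; rw [ρ, smul_smul]
    rw [this, divVec, fderiv_fun_const_smul, tr_smul, divVec]
    exact (h.differentiableAt_space ht (pwSmooth_φ hreg a) hx).smul
      (h.differentiableAt_space ht (h.pwSmooth_v hI hreg a) hx)
  rw [h2, h3, ← mul_add] at h1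
  exact (mul_eq_zero.1 h1).resolve_left (hmass.ρstar_pos a).ne'

/-- The power of the inertial forces. -/
theorem kinetic_balance (hmass : M.MassBalance t) (a : Phase) {x : E}
    (hx : x ∈ M.body t \ M.interface t) :
    deriv (fun τ => M.k a τ x) t + divVec (fun y => M.k a t y • M.v a t y) x =
      M.ρ a t x * inner ℝ (M.acc a t x) (M.v a t x) := by
  have dρt := (h.differentiableAt_time ht (pwSmooth_ρ hreg a) hx).hasDerivAt
  have dvt := (h.differentiableAt_time ht (h.pwSmooth_v hI hreg a) hx).hasDerivAt
  have dρ := (h.differentiableAt_space ht (pwSmooth_ρ hreg a) hx)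
  have dv := (h.differentiableAt_space ht (h.pwSmooth_v hI hreg a) hx)
  have dk := (h.differentiableAt_space ht (h.pwSmooth_k hI hreg a) hx)
  have h1 := hmass.balance a x hx
  rw [divVec_smul dρ dv] at h1
  have h2 : deriv (fun τ => M.k a τ x) t = 1 / 2 * deriv (fun τ => M.ρ a τ x) t * ‖M.v a t x‖ ^ 2
      + M.ρ a t x * inner ℝ (deriv (fun τ => M.v a τ x) t) (M.v a t x) := by
    have := ((dρt.const_mul (1 / 2 : ℝ)).mul dvt.norm_sq).deriv
    refine this.trans ?_
    rw [real_inner_comm]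
    ring
  have h3 : fderiv ℝ (M.k a t) x (M.v a t x) =
      1 / 2 * fderiv ℝ (M.ρ a t) x (M.v a t x) * ‖M.v a t x‖ ^ 2
      + M.ρ a t x * inner ℝ (M.L a t x (M.v a t x)) (M.v a t x) := by
    have h4 := ((dρ.hasFDerivAt.const_mul (1 / 2 : ℝ)).mul dv.hasFDerivAt.norm_sq).fderiv
    have h5 := congrArg (fun A : E →L[ℝ] ℝ => A (M.v a t x)) h4
    refine (Eq.trans ?_ h5).trans ?_
    · rfl
    · simp only [add_apply, smul_apply, ContinuousLinearMap.comp_apply, smul_eq_mul, innerSL_apply_apply]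
      rw [real_inner_comm, L, two_smul]
      ring
  rw [divVec_smul dk dv, h2, h3, h.acc_eq ht a hx, inner_add_left]
  rw [show M.k a t x = 1 / 2 * M.ρ a t x * ‖M.v a t x‖ ^ 2 from rfl]
  -- Mass balance multiplied by `‖v_a‖² / 2` removes all terms containing derivatives of the
  -- density.
  linear_combination (1 / 2 * ‖M.v a t x‖ ^ 2) * h1

/-- The stress power of the elastic stress. -/
theorem rate_ψs (hmass : M.MassBalance t) {x : E} (hx : x ∈ M.body t \ M.interface t) :
    M.rate M.ψs t x = ddot (M.Te t x) (M.D solid t x) := by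
  set X := M.inv solid t x with hX
  have hXo : X ∈ M.offRef solid t := h.inv_mem ht solid hx
  have hXR : X ∈ M.ref solid \ M.Ss := by rwa [h.offRef_solid ht] at hXo
  have hs : M.RefSide univ X := Or.inl ⟨hXR, rfl⟩
  have hJ : 0 < M.J solid t X := h.J_pos ht solid hXo
  have e1 : (fun τ => M.refDensity M.ψs τ X) =ᶠ[𝓝 t] fun τ => M.Ψs τ X := by
    filter_upwards [hI.mem_nhds ht] with τ hτ
    have := h.solid_det τ hτ X hXR
    rw [refDensity, ψs, h.inv_solid_χ hτ hXR.1, mul_inv_cancel_left₀ this.ne']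
  -- Mass balance of the solid says that `J_s φ_s` does not change at a particle, so only the strain
  -- energy of the pure solid contributes to the rate.
  have hφ : HasDerivAt (fun τ => M.φRs τ X) 0 t := by
    have h1 := h.hasDerivAt_density ht solid hx
      (h.differentiableAt_of_pwSmooth ht (pwSmooth_φ hreg solid) hx)
    rw [h.volume_balance ht hI hreg hmass solid hx, mul_zero] at h1
    exact h1
  set F := M.F solid t X with hF
  set L := M.L solid t x with hL
  have hFd : HasDerivAt (fun τ => M.F solid τ X) (L ∘L F) t := by
    have := h.hasDerivAt_F ht solid hXo
    rwa [h.χ_inv ht solid hx] at this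
  -- From `Ḟ = L F` one gets `Ċ = 2 Fᵀ D F`; this direction is symmetric, as `ddot_dΨdC` requires.
  have hCd : HasDerivAt (fun τ => M.C τ X) ((2 : ℝ) • (transp F ∘L M.D solid t x ∘L F)) t := by
    let tl : Tensor →L[ℝ] Tensor := LinearMap.toContinuousLinearMap
      { toFun := transp, map_add' := transp_add, map_smul' := transp_smul }
    have h1 : HasDerivAt (fun τ => transp (M.F solid τ X)) (transp (L ∘L F)) t :=
      tl.hasFDerivAt.comp_hasDerivAt t hFd
    have h2 := h1.clm_comp hFd
    have h3 : (2 : ℝ) • (transp F ∘L M.D solid t x ∘L F) =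
        transp (L ∘L F) ∘L F + transp F ∘L (L ∘L F) := by
      rw [show M.D solid t x = (1 / 2 : ℝ) • (L + transp L) from rfl, transp_comp]
      ext u
      simp [add_comm]
    rw [h3]
    exact h2
  have hCdet : 0 < (M.C t X).det := by rw [det_C]; positivity
  have hΨ : HasFDerivAt (fun A : Tensor => M.Ψhat (isochoric A) X)
      (fderiv ℝ (fun A : Tensor => M.Ψhat (isochoric A) X) (M.C t X)) (M.C t X) := by
    have h1 : ContDiffAt ℝ 1 (fun q : Tensor × E => M.Ψhat q.1 q.2) (isochoric (M.C t X), X) :=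
      hreg.Ψhat_reg.1 _ (isochoric_mem hJ.ne') X hXR
    have h2 : ContDiffAt ℝ 1 (fun A : Tensor => (isochoric A, X)) (M.C t X) :=
      (contDiffAt_isochoric hCdet).prodMk contDiffAt_const
    have h3 : ContDiffAt ℝ 1 (fun A : Tensor => M.Ψhat (isochoric A) X) (M.C t X) :=
      ContDiffAt.comp (f := fun A : Tensor => (isochoric A, X))
        (g := fun q : Tensor × E => M.Ψhat q.1 q.2) (M.C t X) h1 h2
    exact (h3.differentiableAt one_ne_zero).hasFDerivAt
  have hsym : transp (transp F ∘L M.D solid t x ∘L F) = transp F ∘L M.D solid t x ∘L F := by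
    rw [transp_comp, transp_comp, transp_transp, D, transp_symPart, ContinuousLinearMap.comp_assoc]
  have hd := hφ.mul (hΨ.comp_hasDerivAt t hCd)
  have hd' : deriv (fun τ => M.Ψs τ X) t =
      M.φRs t X * (2 * ddot (M.dΨdC (M.C t X) X) (transp F ∘L M.D solid t x ∘L F)) := by
    refine hd.deriv.trans ?_
    rw [ddot_dΨdC _ _ _ hsym, map_smul, smul_eq_mul]
    ring
  rw [rate, ← hX, e1.deriv_eq, hd', Te, ← hX, TeRef, ddot_smul_left, ← hF]
  -- Cyclicity of the trace moves `F` and `Fᵀ` from the stress to the stretching.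
  have hcyc : ddot (F ∘L M.dΨdC (M.C t X) X ∘L transp F) (M.D solid t x) =
      ddot (M.dΨdC (M.C t X) X) (transp F ∘L M.D solid t x ∘L F) := by
    rw [ddot, ddot, transp_comp, transp_comp, transp_transp, ContinuousLinearMap.comp_assoc,
      ContinuousLinearMap.comp_assoc, tr_comp_comm, ContinuousLinearMap.comp_assoc,
      ContinuousLinearMap.comp_assoc]
  rw [hcyc]
  ring

end IsKinematic

end Mixture

end Poro

/-! ### The local balance of power. -/

namespace Poro

theorem divVec_add {V W : E → E} {x : E} (hV : DifferentiableAt ℝ V x)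
    (hW : DifferentiableAt ℝ W x) : divVec (fun y => V y + W y) x = divVec V x + divVec W x := by
  rw [divVec, fderiv_fun_add hV hW, tr_add, divVec, divVec]

theorem divVec_sub {V W : E → E} {x : E} (hV : DifferentiableAt ℝ V x)
    (hW : DifferentiableAt ℝ W x) : divVec (fun y => V y - W y) x = divVec V x - divVec W x := by
  rw [divVec, fderiv_fun_sub hV hW, sub_eq_add_neg, ← neg_one_smul ℝ, tr_add, tr_smul, divVec,
    divVec]
  ring

/-- The power of a symmetric stress. -/
theorem divVec_apply {T : E → Tensor} {V : E → E} {x : E} (hT : DifferentiableAt ℝ T x)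
    (hV : DifferentiableAt ℝ V x) (hs : ∀ y, transp (T y) = T y) :
    divVec (fun y => T y (V y)) x = inner ℝ (divTensor T x) (V x) + ddot (T x) (fderiv ℝ V x) := by
  let tl : Tensor →L[ℝ] Tensor := LinearMap.toContinuousLinearMap
    { toFun := transp, map_add' := transp_add, map_smul' := transp_smul }
  -- Directional derivatives of a symmetric tensor field are symmetric; this lets the divergence act
  -- on rows or columns alike.
  have h1 : ∀ u, transp (fderiv ℝ T x u) = fderiv ℝ T x u := fun u => by
    have h2 : HasFDerivAt (fun y => transp (T y)) (tl ∘L fderiv ℝ T x) x :=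
      tl.hasFDerivAt.comp x hT.hasFDerivAt
    simp only [hs] at h2
    exact congrArg (fun A : E →L[ℝ] Tensor => A u) (h2.unique hT.hasFDerivAt)
  rw [divVec, (hT.hasFDerivAt.clm_apply hV.hasFDerivAt).fderiv, tr_add, add_comm, ddot, hs]
  congr 1
  rw [tr_eq_sum, divTensor, sum_inner]
  refine Finset.sum_congr rfl fun i _ => ?_
  rw [ContinuousLinearMap.flip_apply, ← transp_comp_inner, h1]

namespace Mixture

open Phase

variable {M : Mixture} {I : Set ℝ} {t : ℝ}

/-- The flux of power through a surface, relative to the solid. -/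
noncomputable def powerFlux (M : Mixture) (t : ℝ) (x : E) : E :=
  M.T solid t x (M.v solid t x) + M.T fluid t x (M.v fluid t x) - M.k fluid t x • M.w t x

namespace IsKinematic

variable (h : M.IsKinematic I) (ht : t ∈ I) (hI : IsOpen I) (hreg : M.IsRegular I)

include h hI hreg

theorem pwSmooth_powerFlux : M.PwSmooth 1 I M.powerFlux :=
  (((pwSmooth_T hreg solid).apply (h.pwSmooth_v hI hreg solid)).add
    ((pwSmooth_T hreg fluid).apply (h.pwSmooth_v hI hreg fluid))).sub
    ((h.pwSmooth_k hI hreg fluid).smul (h.pwSmooth_w hI hreg))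

theorem pwSmooth_bodyPower : M.PwSmooth 0 I M.bodyPower := by
  have hv := fun a => (h.pwSmooth_v hI hreg a).of_le zero_le_one
  exact ((hreg.b_reg solid).pwSmooth.innerProd (hv solid)).add
    ((hreg.b_reg fluid).pwSmooth.innerProd (hv fluid))

include ht

omit hI hreg in
theorem rate_add {f g : ℝ → E → ℝ} (hf : M.PwSmooth 1 I f) (hg : M.PwSmooth 1 I g) {x : E}
    (hx : x ∈ M.body t \ M.interface t) :
    M.rate (fun τ x => f τ x + g τ x) t x = M.rate f t x + M.rate g t x := by
  have h1 := h.hasDerivAt_density ht solid hx (h.differentiableAt_of_pwSmooth ht hf hx)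
  have h2 := h.hasDerivAt_density ht solid hx (h.differentiableAt_of_pwSmooth ht hg hx)
  have h3 := (h1.add h2).deriv
  rw [rate, rate, rate, ← mul_add]
  congr 1
  unfold refDensity
  rw [h1.deriv, h2.deriv, ← h3]
  congr 1
  ext τ
  simp only [Pi.add_apply]
  ring

/-- `rate` follows the solid, while the fluid energy is balanced along `v_f = v_s + w`; the
difference is the divergence of the relative flux `k_f w`. -/
theorem rate_k_fluid (hmass : M.MassBalance t) {x : E} (hx : x ∈ M.body t \ M.interface t) :
    M.rate (M.k fluid) t x = M.ρ fluid t x * inner ℝ (M.acc fluid t x) (M.v fluid t x) -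
      divVec (fun y => M.k fluid t y • M.w t y) x := by
  have dk := h.differentiableAt_space ht (h.pwSmooth_k hI hreg fluid) hx
  have dv := fun a => h.differentiableAt_space ht (h.pwSmooth_v hI hreg a) hx
  have h1 := h.kinetic_balance ht hI hreg hmass fluid hx
  rw [h.rate_eq ht hx (h.differentiableAt_of_pwSmooth ht (h.pwSmooth_k hI hreg fluid) hx), ← h1]
  have h2 : (fun y => M.k fluid t y • M.w t y) =
      fun y => M.k fluid t y • M.v fluid t y - M.k fluid t y • M.v solid t y := by
    ext1 y; rw [w, smul_sub]
  rw [h2, divVec_sub (dk.fun_smul (dv fluid)) (dk.fun_smul (dv solid))]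
  ring

theorem rate_energy (hmass : M.MassBalance t) {x : E} (hx : x ∈ M.body t \ M.interface t) :
    M.rate M.energy t x = M.ρ solid t x * inner ℝ (M.acc solid t x) (M.v solid t x) +
      M.ρ fluid t x * inner ℝ (M.acc fluid t x) (M.v fluid t x) -
      divVec (fun y => M.k fluid t y • M.w t y) x + ddot (M.Te t x) (M.D solid t x) := by
  have hks := h.pwSmooth_k hI hreg solid
  have hkf := h.pwSmooth_k hI hreg fluid
  have h1 : M.rate M.energy t x =
      M.rate (M.k solid) t x + M.rate (M.k fluid) t x + M.rate M.ψs t x := by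
    rw [← h.rate_add ht hks hkf hx, ← h.rate_add ht (hks.add hkf) (h.pwSmooth_ψs hI hreg) hx]
    rfl
  rw [h1, h.rate_k_fluid ht hI hreg hmass hx, h.rate_ψs ht hI hreg hmass hx,
    h.rate_eq ht hx (h.differentiableAt_of_pwSmooth ht hks hx),
    h.kinetic_balance ht hI hreg hmass solid hx]
  ring

/-- Incompressibility of the constituents. -/
theorem saturation_constraint (hmass : ∀ t ∈ I, M.MassBalance t) {x : E}
    (hx : x ∈ M.body t \ M.interface t) :
    M.φ solid t x * tr (M.L solid t x) + M.φ fluid t x * tr (M.L fluid t x) +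
      fderiv ℝ (M.φ fluid t) x (M.w t x) = 0 := by
  have dφ := fun a => h.differentiableAt_space ht (pwSmooth_φ hreg a) hx
  have dv := fun a => h.differentiableAt_space ht (h.pwSmooth_v hI hreg a) hx
  have h1 := fun a => h.volume_balance ht hI hreg (hmass t ht) a hx
  have hs := h1 solid
  have hf := h1 fluid
  rw [divVec_smul (dφ _) (dv _)] at hs hf
  -- Saturation holds in a space-time neighbourhood, which is why mass balance is assumed at all
  -- times in `I`: it can then be differentiated in time and in space.
  have hev : ∀ᶠ q in 𝓝 (t, x), M.φ solid q.1 q.2 = 1 - M.φ fluid q.1 q.2 := by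
    filter_upwards [h.isOpen_off.mem_nhds (mem_off ht hx)] with q hq
    linarith [(hmass q.1 hq.1).saturation q.2 hq.2]
  have e1 : deriv (fun τ => M.φ solid τ x) t = -deriv (fun τ => M.φ fluid τ x) t := by
    have : (fun τ => M.φ solid τ x) =ᶠ[𝓝 t] fun τ => 1 - M.φ fluid τ x :=
      (tendsto_id.prodMk_nhds tendsto_const_nhds : Tendsto (fun τ : ℝ => (τ, x)) (𝓝 t)
        (𝓝 (t, x))).eventually hev
    rw [this.deriv_eq, deriv_const_sub]
  have e2 : fderiv ℝ (M.φ solid t) x = -fderiv ℝ (M.φ fluid t) x := by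
    have : M.φ solid t =ᶠ[𝓝 x] fun y => 1 - M.φ fluid t y :=
      (tendsto_const_nhds.prodMk_nhds tendsto_id : Tendsto (fun y : E => (t, y)) (𝓝 x)
        (𝓝 (t, x))).eventually hev
    rw [this.fderiv_eq, fderiv_const_sub]
  rw [e1, e2] at hs
  simp only [divVec, neg_apply] at hs hf
  rw [w, map_sub, L, L]
  linarith

/-- The local form of the balance of power. -/
theorem local_power_balance (hmass : ∀ t ∈ I, M.MassBalance t) (hmom : M.MomentumBalance t) {x : E}
    (hx : x ∈ M.body t \ M.interface t) :
    divVec (M.powerFlux t) x + M.bodyPower t x - M.rate M.energy t x = M.dissipation t x := by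
  have dv := fun a => h.differentiableAt_space ht (h.pwSmooth_v hI hreg a) hx
  have dT := fun a => h.differentiableAt_space ht (pwSmooth_T hreg a) hx
  have dTv : ∀ a, DifferentiableAt ℝ (fun y => M.T a t y (M.v a t y)) x := fun a =>
    (dT a).clm_apply (dv a)
  have dkw : DifferentiableAt ℝ (fun y => M.k fluid t y • M.w t y) x :=
    h.differentiableAt_space ht ((h.pwSmooth_k hI hreg fluid).smul (h.pwSmooth_w hI hreg)) hx
  have e1 : divVec (M.powerFlux t) x =
      inner ℝ (divTensor (M.T solid t) x) (M.v solid t x) + ddot (M.T solid t x) (M.L solid t x) +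
      (inner ℝ (divTensor (M.T fluid t) x) (M.v fluid t x) + ddot (M.T fluid t x) (M.L fluid t x)) -
      divVec (fun y => M.k fluid t y • M.w t y) x := by
    rw [show M.powerFlux t = fun y => (M.T solid t y (M.v solid t y) + M.T fluid t y (M.v fluid t y))
      - M.k fluid t y • M.w t y from rfl, divVec_sub ((dTv solid).fun_add (dTv fluid)) dkw,
      divVec_add (dTv solid) (dTv fluid), divVec_apply (dT solid) (dv solid) (M.transp_T solid t),
      divVec_apply (dT fluid) (dv fluid) (M.transp_T fluid t)]
    rfl
  have hDL : ∀ a, M.D a t x = symPart (M.L a t x) := fun a => rfl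
  have hDs : ∀ a, transp (M.D a t x) = M.D a t x := fun a => transp_symPart _
  have hsym : ∀ {A : Tensor} (a : Phase), transp A = A →
      ddot A (M.L a t x) = ddot A (M.D a t x) := fun a hA => by rw [hDL, ddot_symPart hA]
  have e2 : ddot (M.T solid t x) (M.L solid t x) = -(M.φ solid t x * M.p t x) * tr (M.L solid t x) +
      ddot (M.Te t x) (M.D solid t x) + 2 * M.μB t x * (ddot (M.D solid t x) (M.D solid t x) -
        ddot (M.D fluid t x) (M.D solid t x)) := by
    simp only [T, ddot_add_left, ddot_smul_left, ddot_sub_left, ddot_id, hsym _ (M.transp_Te t x),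
      hsym _ (hDs _)]
  have e3 : ddot (M.T fluid t x) (M.L fluid t x) = -(M.φ fluid t x * M.p t x) * tr (M.L fluid t x) +
      (2 * M.μf t x * ddot (M.D fluid t x) (M.D fluid t x) +
      2 * M.μB t x * (ddot (M.D fluid t x) (M.D fluid t x) -
        ddot (M.D solid t x) (M.D fluid t x))) := by
    simp only [T, ddot_add_left, ddot_smul_left, ddot_sub_left, ddot_id, hsym _ (hDs _)]
  -- The momentum balance of each phase is multiplied by the velocity of that phase.
  have e4 : ∀ a, M.ρ a t x * inner ℝ (M.acc a t x) (M.v a t x) -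
      inner ℝ (divTensor (M.T a t) x) (M.v a t x) - inner ℝ (M.b a t x) (M.v a t x) -
      inner ℝ (M.pint a t x) (M.v a t x) = 0 := fun a => by
    have := congrArg (fun u => inner ℝ u (M.v a t x)) (hmom.balance a x hx)
    simpa only [inner_sub_left, real_inner_smul_left, inner_zero_left] using this
  have e5 := e4 solid
  have e6 := e4 fluid
  simp only [pint, inner_neg_left] at e5 e6
  have e7 : inner ℝ (M.pf t x) (M.v fluid t x) - inner ℝ (M.pf t x) (M.v solid t x) =
      M.p t x * fderiv ℝ (M.φ fluid t) x (M.w t x) -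
        M.μD t x * M.φ fluid t x ^ 2 / M.κs t x * ‖M.w t x‖ ^ 2 := by
    rw [← inner_sub_right, ← w, pf, inner_sub_left, real_inner_smul_left, real_inner_smul_left,
      inner_gradient, real_inner_self_eq_norm_sq]
  have e8 := h.saturation_constraint ht hI hreg hmass hx
  rw [e1, e2, e3, h.rate_energy ht hI hreg (hmass t ht) hx, bodyPower, dissipation, ddot_sub_left,
    ddot_sub_right, ddot_sub_right, ddot_comm (M.D solid t x) (M.D fluid t x)]
  -- The two momentum powers cancel inertia, stress divergence and body forces. The interaction
  -- power contributes the Darcy drag and `p ∇φ_f · w`, and the latter cancels against the pressure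
  -- parts of the stress powers by the saturation constraint.
  linear_combination -e5 - e6 - e7 - M.p t x * e8

end IsKinematic

end Mixture

end Poro

/-! ### The power expended on the interface. -/

namespace Poro

theorem continuous_dyad : Continuous fun p : E × E => dyad p.1 p.2 := by
  have : (fun p : E × E => dyad p.1 p.2) = fun p => (innerSL ℝ p.2).smulRight p.1 := by
    ext p x
    simp [dyad_apply]
  rw [this]
  exact ((ContinuousLinearMap.smulRightL ℝ E E).continuous₂).comp
    (((innerSL ℝ).continuous.comp continuous_snd).prodMk continuous_fst)

namespace Mixture

open Phase

variable {M : Mixture} {I : Set ℝ} {t : ℝ}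

namespace IsKinematic

variable (h : M.IsKinematic I) (ht : t ∈ I)

include h ht

theorem trace_comp {V V' : Type*} [NormedAddCommGroup V] [NormedSpace ℝ V] [NormedAddCommGroup V']
    {k : ℕ} {f : ℝ → E → V} (hf : M.PwSmooth k I f) {x : E} (hx : x ∈ M.interface t) {Φ : V → V'}
    (hΦ : Continuous Φ) :
    tracePlus (M.m t x) (fun y => Φ (f t y)) x = Φ (tracePlus (M.m t x) (f t) x) ∧
    traceMinus (M.m t x) (fun y => Φ (f t y)) x = Φ (traceMinus (M.m t x) (f t) x) := by
  obtain ⟨h1, h2⟩ := h.tendsto_traces ht hf hx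
  exact ⟨((hΦ.tendsto _).comp h1).limUnder_eq, ((hΦ.tendsto _).comp h2).limUnder_eq⟩

/-- The jump of the power flux is the power expended on the interface. -/
theorem normalJump_powerFlux (hI : IsOpen I) (hreg : M.IsRegular I) (hmass : M.MassBalance t)
    (hmom : M.MomentumBalance t) {x : E} (hx : x ∈ M.interface t) :
    normalJump (M.m t) (M.powerFlux t) x = M.interfacePower t x := by
  set m := M.m t x with hm
  -- All primitive fields are bundled into one. The trace of any quantity depending continuously on
  -- them is then the same function of the single trace `P` or `N`, and the claim becomes algebra in
  -- these two values.
  set f : ℝ → E → (ℝ × ℝ) × (E × E) × (Tensor × Tensor) := fun t y =>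
    ((M.φ solid t y, M.φ fluid t y), (M.v solid t y, M.v fluid t y),
      (M.T solid t y, M.T fluid t y)) with hf
  have hsm : M.PwSmooth 1 I f :=
    ((pwSmooth_φ hreg solid).prodMk (pwSmooth_φ hreg fluid)).prodMk
      (((h.pwSmooth_v hI hreg solid).prodMk (h.pwSmooth_v hI hreg fluid)).prodMk
        ((pwSmooth_T hreg solid).prodMk (pwSmooth_T hreg fluid)))
  have tr1 : ∀ {V' : Type} [NormedAddCommGroup V']
      {Φ : (ℝ × ℝ) × (E × E) × (Tensor × Tensor) → V'} (g : E → V'), Continuous Φ →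
      (∀ y, g y = Φ (f t y)) → tracePlus m g x = Φ (tracePlus m (f t) x) ∧
        traceMinus m g x = Φ (traceMinus m (f t) x) := fun g hΦ hg => by
    rw [funext hg]
    exact h.trace_comp ht hsm hx hΦ
  have hv := h.trace_v_solid ht hI hx
  have hvs := tr1 (Φ := fun p => p.2.1.1) (M.v solid t) (by fun_prop) fun y => rfl
  have hTs := tr1 (Φ := fun p => p.2.2.1) (M.T solid t) (by fun_prop) fun y => rfl
  have hTf := tr1 (Φ := fun p => p.2.2.2) (M.T fluid t) (by fun_prop) fun y => rfl
  have hTs' := tr1 (Φ := fun p => transp p.2.2.1) (M.T solid t)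
    (continuous_transp.comp (by fun_prop)) fun y => (M.transp_T solid t y).symm
  have hTf' := tr1 (Φ := fun p => transp p.2.2.2) (M.T fluid t)
    (continuous_transp.comp (by fun_prop)) fun y => (M.transp_T fluid t y).symm
  have hP := tr1 (Φ := fun p => p.2.2.1 p.2.1.1 + p.2.2.2 p.2.1.2 -
    (1 / 2 * (M.ρstar fluid * p.1.2) * ‖p.2.1.2‖ ^ 2) • (p.2.1.2 - p.2.1.1)) (M.powerFlux t)
    (by fun_prop) fun y => rfl
  have hflt := tr1 (Φ := fun p => p.1.2 • (p.2.1.2 - p.2.1.1)) (M.vflt t) (by fun_prop) fun y => rfl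
  have hd := tr1 (Φ := fun p => M.ρstar fluid * p.1.2 * inner ℝ (p.2.1.2 - p.2.1.1) m)
    (fun y => M.ρ fluid t y * inner ℝ (M.w t y) m) (by fun_prop) fun y => rfl
  have hTw := tr1 (Φ := fun p => inner ℝ (p.2.2.2 m) (p.2.1.2 - p.2.1.1))
    (fun y => inner ℝ (M.T fluid t y m) (M.w t y)) (by fun_prop) fun y => rfl
  have hw := tr1 (Φ := fun p => ‖p.2.1.2 - p.2.1.1‖ ^ 2)
    (fun y => ‖M.w t y‖ ^ 2) (by fun_prop) fun y => rfl
  have hJs := tr1 (Φ := fun p => (M.ρstar solid * p.1.1) • dyad (p.2.1.1 - p.2.1.1)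
      (p.2.1.1 - p.2.1.1) - p.2.2.1)
    (fun y => M.ρ solid t y • dyad (M.v solid t y - M.v solid t y)
      (M.v solid t y - M.v solid t y) - M.T solid t y)
    (by
      have := continuous_dyad.comp (show Continuous fun p : (ℝ × ℝ) × (E × E) × (Tensor × Tensor) =>
        (p.2.1.1 - p.2.1.1, p.2.1.1 - p.2.1.1) by fun_prop)
      simp only [Function.comp_def] at this
      fun_prop) fun y => rfl
  have hJf := tr1 (Φ := fun p => (M.ρstar fluid * p.1.2) • dyad (p.2.1.2 - p.2.1.1)
      (p.2.1.2 - p.2.1.1) - p.2.2.2)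
    (fun y => M.ρ fluid t y • dyad (M.v fluid t y - M.v solid t y)
      (M.v fluid t y - M.v solid t y) - M.T fluid t y)
    (by
      have := continuous_dyad.comp (show Continuous fun p : (ℝ × ℝ) × (E × E) × (Tensor × Tensor) =>
        (p.2.1.2 - p.2.1.1, p.2.1.2 - p.2.1.1) by fun_prop)
      simp only [Function.comp_def] at this
      fun_prop) fun y => rfl
  have c1 := hmass.jump_cond x hx
  have c2 := hmom.jump_cond solid x hx
  have c3 := hmom.jump_cond fluid x hx
  have c4 := hmom.ξ_sum x hx
  rw [← hm] at c1 c2 c3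
  simp only [jump] at c1 c2 c3
  rw [hflt.1, hflt.2] at c1
  rw [hJs.1, hJs.2] at c2
  rw [hJf.1, hJf.2] at c3
  rw [normalJump, interfacePower, d, mean, jump, jump, jump, ← hm, hP.1, hP.2, hd.1, hd.2, hTw.1,
    hTw.2, hw.1, hw.2]
  rw [hvs.1, hvs.2] at hv
  rw [hTs.1, hTs.2] at hTs'
  rw [hTf.1, hTf.2] at hTf'
  -- From here on the traces are arbitrary values, constrained by the jump conditions, the
  -- continuity of `v_s` and the symmetry of the stresses.
  generalize tracePlus m (f t) x = P at *
  generalize traceMinus m (f t) x = N at *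
  obtain ⟨⟨ps, pf⟩, ⟨pv, pu⟩, pS, pF⟩ := P
  obtain ⟨⟨ns, nf⟩, ⟨nv, nu⟩, nS, nF⟩ := N
  simp only at *
  obtain ⟨rfl, rfl⟩ := hv
  set v := M.v solid t x
  set a := pu - v with ha
  set b := nu - v with hb
  have hpu : pu = a + v := by rw [ha, sub_add_cancel]
  have hnu : nu = b + v := by rw [hb, sub_add_cancel]
  have sym : ∀ {A : Tensor}, A = transp A → ∀ u, (inner ℝ (A u) m : ℝ) = inner ℝ (A m) u :=
    fun {A} hA u => by
      conv_lhs => rw [hA]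
      rw [transp_comp_inner, real_inner_comm]
  -- The momentum jumps are added, so that `ξ_s + ξ_f` drops out; the solid has no momentum flux
  -- relative to itself. The result is paired with the common value `v` of the solid velocity.
  have c5 : inner ℝ ((pS m - nS m) + (pF m - nF m)) v =
      M.ρstar fluid * pf * inner ℝ a m * inner ℝ a v -
        M.ρstar fluid * nf * inner ℝ b m * inner ℝ b v := by
    have c6 : (pS m - nS m) + (pF m - nF m) = (M.ρstar fluid * pf * inner ℝ a m) • a -
        (M.ρstar fluid * nf * inner ℝ b m) • b := by
      have c7 := congrArg₂ (fun u w : E => u + w) c2 c3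
      simp only [sub_self, sub_apply, smul_apply, dyad_apply, smul_zero, zero_sub, smul_smul,
        add_zero, real_inner_comm] at c7
      rw [← sub_eq_zero, ← neg_eq_zero, ← c7, ← sub_eq_zero]
      rw [eq_neg_of_add_eq_zero_left c4, real_inner_comm m a, real_inner_comm m b]
      abel
    rw [c6, inner_sub_left, real_inner_smul_left, real_inner_smul_left]
  simp only [inner_sub_left, inner_add_left, real_inner_smul_left] at c1 c5
  rw [hpu, hnu]
  simp only [inner_sub_left, inner_add_left, real_inner_smul_left, map_add, sym hTs'.1, sym hTs'.2,
    sym hTf'.1, sym hTf'.2, norm_add_sq_real]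
  -- `c1` states that the normal filtration velocity, hence the mass flux, has no jump. Its multiple
  -- with `‖v‖² / 2` disposes of the part of `k_f` due to the solid velocity. The multiple with
  -- `(‖a‖² + ‖b‖²) / 4` accounts for `d` being defined as the mean of the two one-sided fluxes.
  linear_combination c5 - (1 / 4 * M.ρstar fluid * (‖a‖ ^ 2 + ‖b‖ ^ 2) +
    1 / 2 * M.ρstar fluid * ‖v‖ ^ 2) * c1

end IsKinematic

end Mixture

end Poro

/-! ### The global balance of power. -/

theorem propositionB3 (M : Poro.Mixture) (I : Set ℝ) (hI : IsOpen I)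
    (hkin : M.IsKinematic I) (hreg : M.IsRegular I)
    (hmass : ∀ t ∈ I, M.MassBalance t) (hmom : ∀ t ∈ I, M.MomentumBalance t)
    (t : ℝ) (ht : t ∈ I)
    (Ω : Set Poro.E) (hΩ : Poro.IsLipschitzDomain Ω) (hΩB : closure Ω ⊆ M.body t)
    (hcross : Poro.area (frontier Ω ∩ M.interface t) = 0) :
    (∀ᶠ τ in 𝓝 t, IntegrableOn (M.energy τ) Ω) ∧
    DifferentiableAt ℝ (fun τ => ∫ x in Ω, M.energy τ x) t ∧
    IntegrableOn (M.energyFlux Ω t) (frontier Ω) Poro.area ∧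
    IntegrableOn (M.tractionPower Ω t) (frontier Ω) Poro.area ∧
    IntegrableOn (M.bodyPower t) Ω ∧
    IntegrableOn (M.dissipation t) Ω ∧
    IntegrableOn (M.interfacePower t) (Ω ∩ M.interface t) Poro.area ∧
    M.Wext Ω t = deriv (fun τ => ∫ x in Ω, M.energy τ x) t + (∫ x in Ω, M.dissipation t x)
      + ∫ x in Ω ∩ M.interface t, M.interfacePower t x ∂Poro.area := by
  have hIB := hkin.eventually_subset_body ht hI hΩ.2.1.isCompact_closure hΩB
  have hv := fun a => hkin.pwSmooth_v hI hreg a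
  have hT := fun a => Poro.Mixture.IsKinematic.pwSmooth_T hreg a
  have hk := fun a => hkin.pwSmooth_k hI hreg a
  have he := hkin.pwSmooth_energy hI hreg
  have hpf := hkin.pwSmooth_powerFlux hI hreg
  have hfront : ∀ {f : ℝ → Poro.E → Poro.E}, M.PwSmooth 1 I f →
      IntegrableOn (fun x => inner ℝ (Poro.outerNormal Ω x) (f t x)) (frontier Ω) Poro.area :=
    fun hf => (hkin.isPwCont ht hI (hf.of_le zero_le_one)).integrableOn_frontier hΩ hΩB hcross
  have hint : ∀ {f : ℝ → Poro.E → ℝ}, M.PwSmooth 0 I f → IntegrableOn (f t) Ω :=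
    fun hf => (hkin.isPwCont ht hI hf).integrableOn hΩ.1 hΩ.2.1 hΩB
  have ha := hfront (he.smul (hv .solid))
  have hb := hfront hpf
  have hc := hfront ((((hk .solid).add (hkin.pwSmooth_ψs hI hreg)).smul (hv .solid)).add
    ((hk .fluid).smul (hv .fluid)))
  have hd := hfront (((hT .solid).apply (hv .solid)).add ((hT .fluid).apply (hv .fluid)))
  have hflux : M.energyFlux Ω t = fun x => inner ℝ (Poro.outerNormal Ω x)
      ((M.k .solid t x + M.ψs t x) • M.v .solid t x + M.k .fluid t x • M.v .fluid t x) :=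
    funext fun x => real_inner_comm _ _
  -- Symmetry of the stresses turns the traction power `T n · v` into the flux `n · T v` of a vector
  -- field.
  have htrac : M.tractionPower Ω t = fun x => inner ℝ (Poro.outerNormal Ω x)
      (M.T .solid t x (M.v .solid t x) + M.T .fluid t x (M.v .fluid t x)) := by
    ext1 x
    rw [Poro.Mixture.tractionPower, inner_add_right, ← Poro.transp_comp_inner,
      ← Poro.transp_comp_inner, M.transp_T, M.transp_T]
  have hbody := hint (hkin.pwSmooth_bodyPower hI hreg)
  have hrate := hint (hkin.pwSmooth_rate hI he)
  have hpw := hkin.isPwC1 ht hpf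
  obtain ⟨hj, hdiv⟩ := hpw.divergence hΩ hΩB hcross
  have hdivi : IntegrableOn (Poro.divVec (M.powerFlux t)) Ω :=
    hpw.isPwCont_divVec.integrableOn hΩ.1 hΩ.2.1 hΩB
  -- The viscosities, the permeability and the pressure are not assumed regular one by one. The
  -- dissipation is integrable because it equals, almost everywhere, a combination of piecewise
  -- continuous fields.
  have hdiss : (fun x => Poro.divVec (M.powerFlux t) x + M.bodyPower t x - M.rate M.energy t x)
      =ᵐ[volume.restrict Ω] M.dissipation t := by
    rw [EventuallyEq, ae_restrict_iff' hΩ.1.measurableSet]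
    filter_upwards [measure_eq_zero_iff_ae_notMem.1 (hkin.volume_interface ht hI)] with x hx hxΩ
    exact hkin.local_power_balance ht hI hreg hmass (hmom t ht) ⟨hΩB (subset_closure hxΩ), hx⟩
  -- Inside the body the interface is the complement of an open set.
  have hmS : MeasurableSet (Ω ∩ M.interface t) := by
    have : Ω ∩ M.interface t = Ω \ (M.body t \ M.interface t) := by
      ext x
      exact ⟨fun hx => ⟨hx.1, fun h => h.2 hx.2⟩, fun hx => ⟨hx.1, by
        by_contra h; exact hx.2 ⟨hΩB (subset_closure hx.1), h⟩⟩⟩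
    rw [this]
    exact hΩ.1.measurableSet.diff (hkin.isOpen_body_diff ht).measurableSet
  have hjump : EqOn (Poro.normalJump (M.m t) (M.powerFlux t)) (M.interfacePower t)
      (Ω ∩ M.interface t) := fun x hx =>
    hkin.normalJump_powerFlux ht hI hreg (hmass t ht) (hmom t ht) hx.2
  have hder := hkin.hasDerivAt_setIntegral ht hI he hΩ hΩB hcross
  refine ⟨?_, hder.differentiableAt, hflux ▸ hc, htrac ▸ hd, hbody,
    ((hdivi.add hbody).sub hrate).congr hdiss, hj.congr_fun hjump hmS, ?_⟩
  · filter_upwards [hIB] with τ hτ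
    exact (hkin.isPwCont hτ.1 hI (he.of_le zero_le_one)).integrableOn hΩ.1 hΩ.2.1 hτ.2
  -- The fluid energy flux is split as `k_f v_f = k_f v_s + k_f w`: the first part joins the energy
  -- convected by the solid, the second belongs to `powerFlux`.
  · have h1 : -(∫ x in frontier Ω, M.energyFlux Ω t x ∂Poro.area) +
        ∫ x in frontier Ω, M.tractionPower Ω t x ∂Poro.area =
        -(∫ x in frontier Ω, inner ℝ (Poro.outerNormal Ω x)
          (M.energy t x • M.v .solid t x) ∂Poro.area) +
        ∫ x in frontier Ω, inner ℝ (Poro.outerNormal Ω x) (M.powerFlux t x) ∂Poro.area := by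
      rw [hflux, htrac, neg_add_eq_sub, neg_add_eq_sub]
      refine (integral_sub hd hc).symm.trans (Eq.trans ?_ (integral_sub hb ha))
      refine integral_congr_ae (Eventually.of_forall fun x => ?_)
      simp only [Poro.Mixture.powerFlux, Poro.Mixture.energy, Poro.Mixture.w, inner_add_right,
        inner_sub_right, inner_smul_right]
      ring
    have hsum : IntegrableOn (fun x => Poro.divVec (M.powerFlux t) x + M.bodyPower t x) Ω :=
      hdivi.add hbody
    rw [Poro.Mixture.Wext, h1, hdiv, hder.deriv, ← integral_congr_ae hdiss,
      integral_sub hsum hrate, integral_add hdivi hbody,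
      ← setIntegral_congr_fun hmS hjump]
    ring
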